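/- Call $D\subset\mathbb{C}$ a direct tract of $f$ with boundary value $R>0$ if $D$ is an unbounded domain with unbounded complement whose boundary consists of piecewise smooth curves, $f$ is continuous on $\overline{D}$ and holomorphic in $D$, $|f(z)|=R$ for $z\in\partial D$, and $|f(z)|>R$ for $z\in D$. Call $D$ a logarithmic tract of $f$ if, in addition, the restriction $f:D\to\{w\in\mathbb{C}:|w|>R\}$ is a universal covering. Theorem. Let $D$ be a direct tract of $f$ with boundary value $R$ whose boundary is a single unbounded simple curve (an injective continuous image of $\mathbb{R}$ both of whose ends tend to $\infty$). Then $D$ is a logarithmic tract of $f$. Moreover, there are a conformal bijection $\varphi$ of the unit disc $\mathbb{D}$ onto $D$ with $\varphi(t)\to\infty$ as $t\to1$ in $\mathbb{D}$, and constants $c>0$ and $\theta\in\mathbb{R}$, such that $$f(z)=R\,e^{i\theta}\exp\left(c\,\frac{1+\varphi^{-1}(z)}{1-\varphi^{-1}(z)}\right)\qquad\text{for all } z\in D.$$ Furthermore, $f$ has no critical points in $D$, and there is no path in $D$ tending to $\infty$ along which $f$ tends to a finite limit. -/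

import Mathlib

open Set Filter Topology

namespace DirectTract

/-- The trace of a piecewise smooth curve: a continuous curve on a nondegenerate interval `I` which,
off a locally finite set `S` of parameters, is continuously differentiable with nonvanishing
derivative, one-sided derivatives at the break points included. -/
def IsPiecewiseSmoothCurve (C : Set ℂ) : Prop :=
  ∃ (I S : Set ℝ) (γ : ℝ → ℂ), I.OrdConnected ∧ I.Nontrivial ∧ ContinuousOn γ I ∧
    (∀ a b : ℝ, (S ∩ Icc a b).Finite) ∧
    (∀ a b : ℝ, a < b → Icc a b ⊆ I → Disjoint (Ioo a b) S →
      ContDiffOn ℝ 1 γ (Icc a b) ∧ ∀ t ∈ Icc a b, derivWithin γ (Icc a b) t ≠ 0) ∧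
    γ '' I = C

/-- `Γ` is a simple curve in the plane, both of whose ends tend to infinity; equivalently,
`Γ ∪ {∞}` is a Jordan curve through `∞` in the Riemann sphere. -/
def IsUnboundedSimpleCurve (Γ : Set ℂ) : Prop :=
  ∃ γ : ℝ → ℂ, Continuous γ ∧ Function.Injective γ ∧
    Tendsto (fun t => ‖γ t‖) atTop atTop ∧ Tendsto (fun t => ‖γ t‖) atBot atTop ∧
    range γ = Γ

/-- `D` is a direct tract of `f` with boundary value `R`. Only the values of `f` on the closure of
`D` matter. -/
structure IsDirectTract (f : ℂ → ℂ) (D : Set ℂ) (R : ℝ) : Prop where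
  isOpen : IsOpen D
  isConnected : IsConnected D
  unbounded : ¬ Bornology.IsBounded D
  unbounded_compl : ¬ Bornology.IsBounded Dᶜ
  piecewiseSmooth : ∃ 𝒞 : Set (Set ℂ), (∀ C ∈ 𝒞, IsPiecewiseSmoothCurve C) ∧ frontier D = ⋃₀ 𝒞
  holomorphic : DifferentiableOn ℂ f D
  continuousOn : ContinuousOn f (closure D)
  pos : 0 < R
  norm_eq : ∀ z ∈ frontier D, ‖f z‖ = R
  lt_norm : ∀ z ∈ D, R < ‖f z‖

/-- The complement `{w : |w| > R}` of the closed disc of radius `R` about the origin. -/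
def exteriorDisc (R : ℝ) : Set ℂ := {w | R < ‖w‖}

theorem IsDirectTract.mapsTo {f : ℂ → ℂ} {D : Set ℂ} {R : ℝ} (h : IsDirectTract f D R) :
    MapsTo f D (exteriorDisc R) := h.lt_norm

/-- A universal covering: a surjective covering map with simply connected total space. -/
structure IsUniversalCovering {E X : Type*} [TopologicalSpace E] [TopologicalSpace X]
    (p : E → X) : Prop where
  isCoveringMap : IsCoveringMap p
  surjective : Function.Surjective p
  simplyConnected : SimplyConnectedSpace E

/-- `D` is a logarithmic tract of `f` with boundary value `R`: a direct tract such that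
`f : D → {w : |w| > R}` is a universal covering. -/
structure IsLogarithmicTract (f : ℂ → ℂ) (D : Set ℂ) (R : ℝ) : Prop
    extends IsDirectTract f D R where
  isUniversalCovering :
    IsUniversalCovering (MapsTo.restrict f D (exteriorDisc R) toIsDirectTract.mapsTo)

/-- `Γ : [0, ∞) → D` is a path in `D` tending to infinity along which `f` tends to the finite
value `a`. -/
structure IsAsymptoticPathIn (f : ℂ → ℂ) (D : Set ℂ) (a : ℂ) (Γ : ℝ → ℂ) : Prop where
  continuousOn : ContinuousOn Γ (Ici 0)
  mapsTo : MapsTo Γ (Ici 0) D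
  tendsto_infty : Tendsto (fun t => ‖Γ t‖) atTop atTop
  tendsto_value : Tendsto (fun t => f (Γ t)) atTop (𝓝 a)

/-- `φ` is a Riemann map of the open unit disc onto `D`, that is, a holomorphic bijection. -/
structure IsRiemannMap (φ : ℂ → ℂ) (D : Set ℂ) : Prop where
  holomorphic : DifferentiableOn ℂ φ (Metric.ball 0 1)
  bijOn : BijOn φ (Metric.ball 0 1) D

end DirectTract

/-! Write `f = exp g` on `D` and transport `g` to the unit disc by a Riemann map `φ` with inverse
`ψ`. Then `G = g ∘ φ - log R` has real part `log (|f ∘ φ| / R) > 0`. This real part tends to `0` at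
every point of the circle that does not correspond to infinity, because `|f| = R` on the finite
boundary. If `1` is the only point that corresponds to infinity, `Re G` is a positive multiple of
the Poisson kernel at `1` (`re_eq_poisson`), so `G(t) = c (1 + t) / (1 - t) + iθ`. Hence `g` maps
`D` conformally onto the half-plane `Re > log R`. The covering property, the formula and the absence
of critical points all follow from this.

The boundary curve enters in two ways. First, it is connected and unbounded, so `D` has no holes
(`holeFree_of_frontier`); Dixon's form of Cauchy's theorem then gives holomorphic logarithms, and
with square roots the Riemann mapping theorem. Second, `D` is locally connected at finite boundary
points and at infinity. Both facts come from a Janiszewski-type argument: a compact set does not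
separate two points if a certain function has a continuous logarithm on it, and logarithms glue over
connected intersections (`exists_isPreconnected_of_inter`).

Local connectivity at infinity makes `ψ` converge there. Two different limit points on the circle
would be joined by connected sets on which a bounded nonvanishing univalent function is arbitrarily
small, which a length-area estimate excludes (`false_of_small_near_antipodes`). Local connectivity
at a finite boundary point `w` bounds `g` near `w`, since `f` is close to `f w ≠ 0` there. As `g ∘
φ` blows up at `1`, this forces `φ → ∞` at `1`. The same oscillation bound rules out finite
asymptotic values: along a path to infinity `g` is unbounded, whereas a finite limit of `f`,
necessarily nonzero, would keep `g` bounded. -/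

namespace DirectTract

/-! ### Continuous logarithms and separation in the plane -/

open Complex in
/-- Two continuous logarithms of the same function on a preconnected set differ by a constant. -/
lemma sub_eq_sub_of_exp_eq {X : Type*} [TopologicalSpace X] {S : Set X} (hS : IsPreconnected S)
    {L₁ L₂ : X → ℂ} (h₁ : ContinuousOn L₁ S) (h₂ : ContinuousOn L₂ S)
    (h : ∀ x ∈ S, exp (L₁ x) = exp (L₂ x)) {x y : X} (hx : x ∈ S) (hy : y ∈ S) :
    L₁ x - L₂ x = L₁ y - L₂ y := by
  refine hS.induction₂ (fun a b => L₁ a - L₂ a = L₁ b - L₂ b) ?_ ?_ ?_ hx hy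
  · intro a ha
    have hc := (h₁.sub h₂) a ha
    have := hc (Metric.ball_mem_nhds _ one_pos)
    filter_upwards [this, self_mem_nhdsWithin] with b hb hbS
    have hb' : ‖(L₁ b - L₂ b) - (L₁ a - L₂ a)‖ < 1 := by simpa [dist_eq_norm] using hb
    -- The increment `d` lies in `2πiℤ` and has imaginary part below `1 < π` in absolute value, so
    -- it vanishes: the difference is locally constant.
    set d := (L₁ b - L₂ b) - (L₁ a - L₂ a) with hd
    have him : |d.im| < 1 := (Complex.abs_im_le_norm d).trans_lt hb'
    have hpi := Real.pi_gt_three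
    have h0 : exp d = exp 0 := by
      rw [hd, exp_sub, exp_sub, exp_sub, h b hbS, h a ha]
      simp
    have := exp_inj_of_neg_pi_lt_of_le_pi (x := d) (y := 0) (by linarith [(abs_lt.1 him).1])
      (by linarith [(abs_lt.1 him).2]) (by simp; linarith) (by simp; linarith) h0
    rw [hd] at this
    exact (sub_eq_zero.1 this).symm
  · intro a b c _ _ _ h1 h2; exact h1.trans h2
  · intro a b _ _ h1; exact h1.symm

/-- `F` has a continuous logarithm on `S`. -/
def HasLogOn {X : Type*} [TopologicalSpace X] (F : X → ℂ) (S : Set X) : Prop :=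
  ∃ L : X → ℂ, ContinuousOn L S ∧ ∀ x ∈ S, Complex.exp (L x) = F x

lemma HasLogOn.mul {X : Type*} [TopologicalSpace X] {F G : X → ℂ} {S : Set X}
    (hF : HasLogOn F S) (hG : HasLogOn G S) : HasLogOn (fun x => F x * G x) S := by
  obtain ⟨L, hL, h1⟩ := hF
  obtain ⟨M, hM, h2⟩ := hG
  exact ⟨fun x => L x + M x, hL.add hM, fun x hx => by rw [Complex.exp_add, h1 x hx, h2 x hx]⟩

lemma HasLogOn.congr {X : Type*} [TopologicalSpace X] {F G : X → ℂ} {S : Set X}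
    (hF : HasLogOn F S) (h : ∀ x ∈ S, F x = G x) : HasLogOn G S := by
  obtain ⟨L, hL, h1⟩ := hF
  exact ⟨L, hL, fun x hx => by rw [h1 x hx, h x hx]⟩

lemma hasLogOn_of_norm_sub_one_lt {X : Type*} [TopologicalSpace X] {F : X → ℂ} {S : Set X}
    (hc : ContinuousOn F S) (h : ∀ x ∈ S, ‖F x - 1‖ < 1) : HasLogOn F S := by
  have hs : ∀ x ∈ S, F x ∈ Complex.slitPlane := fun x hx => by
    have := Complex.mem_slitPlane_of_norm_lt_one (h x hx)
    simpa using this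
  exact ⟨fun x => Complex.log (F x), hc.clog hs, fun x hx =>
    Complex.exp_log (Complex.slitPlane_ne_zero (hs x hx))⟩

lemma isSimplyConnected_of_convex {S : Set ℂ} (hS : Convex ℝ S) (hne : S.Nonempty) :
    IsSimplyConnected S := by
  have := hS.contractibleSpace hne
  exact SimplyConnectedSpace.ofContractible S

/-- The map `ζ ↦ 1 - v ζ`, `v ≠ 0`, on a neighbourhood of infinity has no extension to a continuous
map of the plane into the punctured plane. -/
lemma not_exists_nonvanishing_extension {v : ℂ} (hv : v ≠ 0) {Φ : ℂ → ℂ} (hc : Continuous Φ)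
    (h0 : ∀ z, Φ z ≠ 0) {r : ℝ} (hr : ∀ z, r < ‖z‖ → Φ z = 1 - v * z) : False := by
  obtain ⟨M, hM, hexp⟩ := Complex.exists_continuousOn_eqOn_exp_comp
    (isSimplyConnected_of_convex convex_univ univ_nonempty) isOpen_univ hc.continuousOn
    (by rintro ⟨z, -, hz⟩; exact h0 z hz)
  have hexp' : ∀ z, Complex.exp (M z) = Φ z := fun z => hexp (mem_univ z)
  have hMc : Continuous M := continuousOn_univ.1 hM
  -- The circle of radius `ρ` lies where `Φ` is `1 - v z` and surrounds `1 / v`. There the logarithm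
  -- `M` is a primitive of `1 / (z - 1 / v)`, so the integral of that function is `0`, although it
  -- is also `2πi`.
  set ρ : ℝ := |r| + ‖v⁻¹‖ + 1
  have hρ : 0 < ρ := by positivity
  have hder : ∀ z, r < ‖z‖ → HasDerivAt M (z - v⁻¹)⁻¹ z := by
    intro z hz
    have h1 : ∀ᶠ w in 𝓝 z, Complex.exp (M w) = 1 - v * w := by
      filter_upwards [(isOpen_lt continuous_const continuous_norm).mem_nhds hz] with w hw
      rw [hexp', hr w hw]
    have hid : HasDerivAt (fun w : ℂ => v⁻¹ * (1 - Complex.exp w))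
        (v⁻¹ * (-Complex.exp (M z))) (M z) := by
      simpa using ((Complex.hasDerivAt_exp (M z)).const_sub 1).const_mul v⁻¹
    have := HasDerivAt.of_local_left_inverse (f := fun w : ℂ => v⁻¹ * (1 - Complex.exp w))
      hMc.continuousAt hid (by simp [hv]) (h1.mono fun w hw => by
        simp only [hw]; field_simp; ring)
    refine this.congr_deriv ?_
    rw [hexp', hr z hz]
    congr 1
    field_simp
    ring
  have hI := circleIntegral.integral_eq_zero_of_hasDerivWithinAt (f := M) (c := 0) hρ.le
    (fun z hz => (hder z (by
      have : ‖z‖ = ρ := by simpa using hz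
      rw [this]
      have := le_abs_self r
      have := norm_nonneg v⁻¹
      simp only [ρ]; linarith)).hasDerivWithinAt)
  rw [circleIntegral.integral_sub_inv_of_mem_ball] at hI
  · exact Complex.two_pi_I_ne_zero hI
  · simp only [Metric.mem_ball, dist_zero_right, ρ]
    have := abs_nonneg r
    linarith

/-- If `ζ ↦ 1 - v ζ` has a continuous logarithm on the compact set `X`, then `X` does not separate
`1 / v` from infinity. -/
lemma not_isBounded_connectedComponentIn {X : Set ℂ} (hX : IsCompact X) {v : ℂ} (hv : v ≠ 0)
    (hlog : HasLogOn (fun ζ => 1 - v * ζ) X) :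
    ¬ Bornology.IsBounded (connectedComponentIn Xᶜ v⁻¹) := by
  intro hb
  obtain ⟨L, hL, hexp⟩ := hlog
  set C := connectedComponentIn Xᶜ v⁻¹ with hC
  have hXo : IsOpen Xᶜ := hX.isClosed.isOpen_compl
  have hvX : v⁻¹ ∈ Xᶜ := by
    intro h
    have := hexp _ h
    simp only [mul_inv_cancel₀ hv, sub_self] at this
    exact Complex.exp_ne_zero _ this
  have hCo : IsOpen C := hXo.connectedComponentIn
  have hclos : closure C ⊆ C ∪ X := by
    intro z hz
    by_contra hcon
    simp only [mem_union, not_or] at hcon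
    have hzC : C ⊆ insert z C := subset_insert _ _
    have hp : IsPreconnected (insert z C) :=
      isPreconnected_connectedComponentIn.subset_closure hzC (insert_subset hz subset_closure)
    have : insert z C ⊆ C := hp.subset_connectedComponentIn
      (hzC (mem_connectedComponentIn hvX))
      (insert_subset hcon.2 (connectedComponentIn_subset _ _))
    exact hcon.1 (this (mem_insert _ _))
  -- By Tietze `L` extends to the plane. Replacing `1 - v z` by `exp L'` on the bounded component
  -- `C`, which contains its only zero, leaves it continuous because the boundary of `C` lies in
  -- `X`. The result is a forbidden nonvanishing extension.
  obtain ⟨L', hL'⟩ := ContinuousMap.exists_restrict_eq hX.isClosed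
    ⟨X.domRestrict L, continuousOn_iff_continuous_domRestrict.1 hL⟩
  have hL'' : ∀ z ∈ X, L' z = L z := fun z hz => by
    simpa using congrArg (fun g : C(X, ℂ) => g ⟨z, hz⟩) hL'
  classical
  set Φ : ℂ → ℂ := fun z => if z ∈ C then Complex.exp (L' z) else 1 - v * z with hΦ
  have hΦ1 : ∀ z ∈ closure C, Φ z = Complex.exp (L' z) := by
    intro z hz
    by_cases h : z ∈ C
    · simp [hΦ, h]
    · have hzX := (hclos hz).resolve_left h
      simp [hΦ, h, hL'' z hzX, hexp z hzX]
  have hΦ2 : ∀ z ∈ Cᶜ, Φ z = 1 - v * z := fun z hz => by simp [hΦ, show z ∉ C from hz]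
  obtain ⟨r, hr⟩ := hb.subset_closedBall 0
  refine not_exists_nonvanishing_extension hv (Φ := Φ) (r := r) ?_ ?_ ?_
  · have h1 : ContinuousOn Φ (closure C ∪ Cᶜ) := by
      refine ContinuousOn.union_of_isClosed ?_ ?_ isClosed_closure hCo.isClosed_compl
      · exact (ContinuousOn.congr (by fun_prop) hΦ1)
      · exact (ContinuousOn.congr (by fun_prop) hΦ2)
    rw [← continuousOn_univ]
    refine h1.mono fun z _ => ?_
    by_cases h : z ∈ C
    · exact Or.inl (subset_closure h)
    · exact Or.inr h
  · intro z
    by_cases h : z ∈ C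
    · simp [hΦ, h]
    · rw [hΦ2 z h]
      intro h0
      have : z = v⁻¹ := by
        field_simp
        linear_combination -h0
      exact h (this ▸ mem_connectedComponentIn hvX)
  · intro z hz
    refine hΦ2 z fun h => ?_
    have := hr h
    simp at this
    linarith

/-- If `v` can be joined to `0` by a connected set of parameters `u` for which `1 - u ζ` has no zero
on the compact set `X`, then `1 - v ζ` has a continuous logarithm on `X`. -/
lemma hasLogOn_one_sub_mul {X S : Set ℂ} (hX : IsCompact X) (hS : IsPreconnected S)
    (h0 : (0 : ℂ) ∈ S) (h : ∀ u ∈ S, ∀ ζ ∈ X, 1 - u * ζ ≠ 0) {v : ℂ} (hv : v ∈ S) :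
    HasLogOn (fun ζ => 1 - v * ζ) X := by
  have key : HasLogOn (fun ζ => 1 - (0 : ℂ) * ζ) X → HasLogOn (fun ζ => 1 - v * ζ) X := by
    refine hS.induction₂' (fun a b => HasLogOn (fun ζ => 1 - a * ζ) X →
      HasLogOn (fun ζ => 1 - b * ζ) X) ?_ (fun a b c _ _ _ h1 h2 h3 => h2 (h1 h3)) h0 hv
    intro a ha
    -- By compactness of `X`, nearby parameters give quotients uniformly close to `1`, which have
    -- principal logarithms. Possession of a logarithm therefore propagates along `S` in both
    -- directions, starting from the constant `1` at `u = 0`.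
    have hev : ∀ᶠ b in 𝓝 a, ∀ ζ ∈ X, ‖(1 - b * ζ) / (1 - a * ζ) - 1‖ < 1 ∧
        ‖(1 - a * ζ) / (1 - b * ζ) - 1‖ < 1 ∧ 1 - b * ζ ≠ 0 := by
      refine hX.eventually_forall_of_forall_eventually fun ζ hζ => ?_
      have hne := h a ha ζ hζ
      have c1 : ContinuousAt (fun p : ℂ × ℂ => ‖(1 - p.1 * p.2) / (1 - a * p.2) - 1‖) (a, ζ) := by
        fun_prop (disch := exact hne)
      have c2 : ContinuousAt (fun p : ℂ × ℂ => ‖(1 - a * p.2) / (1 - p.1 * p.2) - 1‖) (a, ζ) := by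
        fun_prop (disch := exact hne)
      have c3 : ContinuousAt (fun p : ℂ × ℂ => 1 - p.1 * p.2) (a, ζ) := by fun_prop
      have e1 := c1.eventually_lt_const (u := 1) (by simp [div_self hne])
      have e2 := c2.eventually_lt_const (u := 1) (by simp [div_self hne])
      have e3 := c3.eventually_ne hne
      filter_upwards [e1, e2, e3] with p h1 h2 h3 using ⟨h1, h2, h3⟩
    filter_upwards [mem_nhdsWithin_of_mem_nhds hev] with b hb
    have hne := h a ha
    constructor
    · intro hl
      refine (hl.mul (hasLogOn_of_norm_sub_one_lt (F := fun ζ => (1 - b * ζ) / (1 - a * ζ)) ?_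
        fun ζ hζ => (hb ζ hζ).1)).congr fun ζ hζ => ?_
      · exact ContinuousOn.div (by fun_prop) (by fun_prop) hne
      · exact mul_div_cancel₀ _ (hne ζ hζ)
    · intro hl
      refine (hl.mul (hasLogOn_of_norm_sub_one_lt (F := fun ζ => (1 - a * ζ) / (1 - b * ζ)) ?_
        fun ζ hζ => (hb ζ hζ).2.1)).congr fun ζ hζ => ?_
      · exact ContinuousOn.div (by fun_prop) (by fun_prop) fun ζ hζ => (hb ζ hζ).2.2
      · exact mul_div_cancel₀ _ (hb ζ hζ).2.2
  exact key ⟨fun _ => 0, continuousOn_const, fun _ _ => by simp⟩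

/-- Logarithms on two closed sets with preconnected intersection can be glued. -/
lemma HasLogOn.union {X : Type*} [TopologicalSpace X] {F : X → ℂ} {S T : Set X}
    (hS : HasLogOn F S) (hT : HasLogOn F T) (hSc : IsClosed S) (hTc : IsClosed T)
    (hST : IsPreconnected (S ∩ T)) : HasLogOn F (S ∪ T) := by
  classical
  obtain ⟨L, hL, h1⟩ := hS
  obtain ⟨M, hM, h2⟩ := hT
  -- On the preconnected overlap the two logarithms differ by one constant in `2πiℤ`; shifting `M`
  -- by it makes them agree.
  obtain ⟨c, hc, hexp⟩ : ∃ c : ℂ, (∀ x ∈ S ∩ T, L x = M x + c) ∧ Complex.exp c = 1 := by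
    rcases (S ∩ T).eq_empty_or_nonempty with he | ⟨y, hy⟩
    · exact ⟨0, by simp [he], Complex.exp_zero⟩
    · refine ⟨L y - M y, fun x hx => ?_, ?_⟩
      · have := sub_eq_sub_of_exp_eq hST (hL.mono inter_subset_left) (hM.mono inter_subset_right)
          (fun z hz => by rw [h1 z hz.1, h2 z hz.2]) hx hy
        linear_combination this
      · rw [Complex.exp_sub, h1 y hy.1, ← h2 y hy.2, div_self (Complex.exp_ne_zero _)]
  set N : X → ℂ := fun x => if x ∈ S then L x else M x + c with hN
  have hNS : ∀ x ∈ S, N x = L x := fun x hx => by simp [hN, hx]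
  have hNT : ∀ x ∈ T, N x = M x + c := fun x hx => by
    by_cases h : x ∈ S
    · rw [hNS x h, hc x ⟨h, hx⟩]
    · simp [hN, h]
  refine ⟨N, (hL.congr hNS).union_of_isClosed ((hM.add continuousOn_const).congr hNT) hSc hTc, ?_⟩
  rintro x (hx | hx)
  · rw [hNS x hx, h1 x hx]
  · rw [hNT x hx, Complex.exp_add, h2 x hx, hexp, mul_one]

/-- A form of Janiszewski's theorem on the sphere, in the coordinate `ζ = 1 / (z - q)`: if neither
`X₁` nor `X₂` separates `p` from `q` and `X₁ ∩ X₂` is preconnected, then `X₁ ∪ X₂` does not separate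
`p` from `q`. -/
lemma exists_isPreconnected_of_inter {X₁ X₂ S₁ S₂ : Set ℂ} {p q : ℂ} (hX₁ : IsCompact X₁)
    (hX₂ : IsCompact X₂) (h0 : (0 : ℂ) ∈ X₁) (hX : IsPreconnected (X₁ ∩ X₂))
    (hS₁ : IsPreconnected S₁) (hS₂ : IsPreconnected S₂) (hp₁ : p ∈ S₁) (hq₁ : q ∈ S₁)
    (hp₂ : p ∈ S₂) (hq₂ : q ∈ S₂)
    (h₁ : ∀ ζ ∈ X₁, ζ ≠ 0 → q + ζ⁻¹ ∉ S₁) (h₂ : ∀ ζ ∈ X₂, ζ ≠ 0 → q + ζ⁻¹ ∉ S₂) :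
    ∃ S : Set ℂ, IsPreconnected S ∧ p ∈ S ∧ q ∈ S ∧
      ∀ z ∈ S, z ≠ q → (z - q)⁻¹ ∉ X₁ ∪ X₂ := by
  rcases eq_or_ne p q with rfl | hpq
  · exact ⟨{p}, isPreconnected_singleton, rfl, rfl, fun z hz h => absurd hz h⟩
  set v := p - q with hv
  have hv0 : v ≠ 0 := sub_ne_zero.2 hpq
  -- The parameters `u = z - q`, `z ∈ S`, join `0` to `v`, and a zero of `1 - u ζ` means `q + 1 / ζ
  -- = z ∈ S`. So not being separated by `X` yields a logarithm on `X`.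
  have main : ∀ {X S : Set ℂ}, IsCompact X → IsPreconnected S → p ∈ S → q ∈ S →
      (∀ ζ ∈ X, ζ ≠ 0 → q + ζ⁻¹ ∉ S) → HasLogOn (fun ζ => 1 - v * ζ) X := by
    intro X S hX hS hp hq h
    refine hasLogOn_one_sub_mul hX (S := (fun z => z - q) '' S)
      (hS.image _ (by fun_prop)) ⟨q, hq, sub_self q⟩ ?_ ⟨p, hp, rfl⟩
    rintro _ ⟨z, hz, rfl⟩ ζ hζ h0
    have hζ0 : ζ ≠ 0 := by rintro rfl; simp at h0
    refine h ζ hζ hζ0 ?_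
    convert hz
    field_simp
    linear_combination h0
  have hlog := (main hX₁ hS₁ hp₁ hq₁ h₁).union (main hX₂ hS₂ hp₂ hq₂ h₂) hX₁.isClosed hX₂.isClosed hX
  have hK := hX₁.union hX₂
  have hunb := not_isBounded_connectedComponentIn hK hv0 hlog
  set C := connectedComponentIn (X₁ ∪ X₂)ᶜ v⁻¹ with hC
  have hCsub : C ⊆ (X₁ ∪ X₂)ᶜ := connectedComponentIn_subset _ _
  have hvC : v⁻¹ ∈ C := by
    refine mem_connectedComponentIn ?_
    by_contra hcon
    obtain ⟨L, -, hL⟩ := hlog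
    have := hL v⁻¹ (not_not.1 hcon)
    simp only [mul_inv_cancel₀ hv0, sub_self] at this
    exact Complex.exp_ne_zero _ this
  have hC0 : ∀ ζ ∈ C, ζ ≠ 0 := by
    rintro ζ hζ rfl
    exact hCsub hζ (Or.inl h0)
  set T := (fun ζ => q + ζ⁻¹) '' C with hT
  have hTc : IsPreconnected T := isPreconnected_connectedComponentIn.image _
    (continuousOn_const.add (continuousOn_inv₀.mono hC0))
  -- Back in the `z`-plane, `p` corresponds to `1 / v` and `q` to infinity. Since `C` is unbounded,
  -- `q` may be added to `T` without losing connectedness.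
  have hq : q ∈ closure T := by
    rw [Metric.mem_closure_iff]
    intro ε hε
    have : ¬ C ⊆ Metric.closedBall 0 ε⁻¹ := fun h => hunb (Metric.isBounded_closedBall.subset h)
    obtain ⟨ζ, hζ, hn⟩ := not_subset.1 this
    refine ⟨_, ⟨ζ, hζ, rfl⟩, ?_⟩
    simp only [Metric.mem_closedBall, dist_zero_right, not_le] at hn
    rw [dist_comm, dist_eq_norm]
    simp only [add_sub_cancel_left, norm_inv]
    exact inv_lt_of_inv_lt₀ hε hn
  refine ⟨insert q T, hTc.subset_closure (subset_insert _ _) (insert_subset hq subset_closure),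
    Or.inr ⟨v⁻¹, hvC, by simp [hv]⟩, Or.inl rfl, ?_⟩
  rintro z (rfl | ⟨ζ, hζ, rfl⟩) hz
  · exact absurd rfl hz
  · simpa using hCsub hζ

/-! ### Local connectivity of the domain at its boundary and at infinity -/

/-- The image of `Y ∪ {∞}` under `z ↦ 1 / (z - q)`. -/
def invSet (q : ℂ) (Y : Set ℂ) : Set ℂ := {ζ | ζ = 0 ∨ q + ζ⁻¹ ∈ Y}

lemma isCompact_invSet {q : ℂ} {Y : Set ℂ} (hY : IsClosed Y) (hq : q ∉ Y) :
    IsCompact (invSet q Y) := by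
  obtain ⟨d, hd, hdY⟩ := Metric.isOpen_iff.1 hY.isOpen_compl q hq
  refine Metric.isCompact_of_isClosed_isBounded ?_ ?_
  · rw [← isOpen_compl_iff, isOpen_iff_mem_nhds]
    intro ζ hζ
    simp only [invSet, mem_compl_iff, mem_ofPred_eq, not_or] at hζ
    have hc : ContinuousAt (fun ζ : ℂ => q + ζ⁻¹) ζ :=
      continuousAt_const.add (continuousAt_inv₀ hζ.1)
    filter_upwards [isOpen_ne.mem_nhds hζ.1, hc (hY.isOpen_compl.mem_nhds hζ.2)] with x h1 h2
    simp only [invSet, mem_compl_iff, mem_ofPred_eq, not_or]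
    exact ⟨h1, h2⟩
  · refine (Metric.isBounded_closedBall (x := 0) (r := d⁻¹)).subset ?_
    rintro ζ (rfl | h)
    · simp [hd.le]
    · have : q + ζ⁻¹ ∉ Metric.ball q d := fun h' => hdY h' h
      simp only [Metric.mem_ball, dist_eq_norm, add_sub_cancel_left, norm_inv, not_lt] at this
      simp only [Metric.mem_closedBall, dist_zero_right]
      exact le_inv_of_le_inv₀ hd this

lemma invSet_inter {q : ℂ} {Y Z : Set ℂ} : invSet q Y ∩ invSet q Z = invSet q (Y ∩ Z) := by
  ext ζ
  simp only [invSet, mem_inter_iff, mem_ofPred_eq]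
  tauto

lemma invSet_union {q : ℂ} {Y Z : Set ℂ} : invSet q (Y ∪ Z) = invSet q Y ∪ invSet q Z := by
  ext ζ
  simp only [invSet, mem_union, mem_ofPred_eq]
  tauto

lemma invSet_eq_insert {q : ℂ} {Y : Set ℂ} :
    invSet q Y = insert 0 ((fun z => (z - q)⁻¹) '' Y) := by
  ext ζ
  simp only [invSet, mem_ofPred_eq, mem_insert_iff, mem_image]
  constructor
  · rintro (h | h)
    · exact Or.inl h
    · exact Or.inr ⟨_, h, by simp⟩
  · rintro (h | ⟨z, hz, rfl⟩)
    · exact Or.inl h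
    · exact Or.inr (by simpa using hz)

/-- The curve runs to infinity along `l`, so its inversion accumulates at `0`, the image of
infinity, and this point can be adjoined. -/
lemma isPreconnected_invSet_image {γ : ℝ → ℂ} (hγ : Continuous γ) {I : Set ℝ}
    (hI : IsPreconnected I) {q : ℂ} (hq : q ∉ γ '' I) {l : Filter ℝ} [l.NeBot] (hl : I ∈ l)
    (hlim : Tendsto (fun t => ‖γ t‖) l atTop) : IsPreconnected (invSet q (γ '' I)) := by
  rw [invSet_eq_insert, image_image]
  have hne : ∀ t ∈ I, γ t - q ≠ 0 := fun t ht h => hq ⟨t, ht, sub_eq_zero.1 h⟩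
  have h1 : IsPreconnected ((fun t => (γ t - q)⁻¹) '' I) :=
    hI.image _ (ContinuousOn.inv₀ (by fun_prop) hne)
  refine h1.subset_closure (subset_insert _ _) (insert_subset ?_ subset_closure)
  refine mem_closure_of_tendsto (b := l) (f := fun t => (γ t - q)⁻¹) ?_
    (mem_of_superset hl fun t ht => ⟨t, ht, rfl⟩)
  refine tendsto_inv₀_cobounded.comp ?_
  rw [← tendsto_norm_atTop_iff_cobounded]
  refine tendsto_atTop_mono (f := fun t => ‖γ t‖ - ‖q‖) (fun t => norm_sub_norm_le _ _) ?_
  exact tendsto_atTop_add_const_right _ _ hlim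

lemma isProperMap_of_tendsto {γ : ℝ → ℂ} (hγ : Continuous γ)
    (htop : Tendsto (fun t => ‖γ t‖) atTop atTop) (hbot : Tendsto (fun t => ‖γ t‖) atBot atTop) :
    IsProperMap γ := by
  rw [isProperMap_iff_tendsto_cocompact]
  refine ⟨hγ, ?_⟩
  rw [cocompact_eq_atBot_atTop, ← Metric.cobounded_eq_cocompact, tendsto_sup,
    ← tendsto_norm_atTop_iff_cobounded, ← tendsto_norm_atTop_iff_cobounded]
  exact ⟨hbot, htop⟩

/-- Off the frontier the plane splits into the disjoint open sets `D` and the exterior of `D`, so a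
connected set stays on one side. -/
lemma subset_of_isPreconnected_of_frontier {S D : Set ℂ} (hS : IsPreconnected S) (hD : IsOpen D)
    (hne : (S ∩ D).Nonempty) (hfr : ∀ z ∈ S, z ∉ frontier D) : S ⊆ D := by
  refine hS.subset_left_of_subset_union hD isClosed_closure.isOpen_compl
    (disjoint_compl_right.mono_left subset_closure) (fun z hz => ?_) hne
  by_cases h : z ∈ D
  · exact Or.inl h
  · refine Or.inr fun hc => hfr z hz ?_
    rw [hD.frontier_eq]
    exact ⟨hc, h⟩

/-- A domain bounded by an unbounded simple curve is locally connected at its finite boundary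
points. -/
theorem exists_isPreconnected_subset_ball {D : Set ℂ} (hDo : IsOpen D) (hDc : IsConnected D)
    (hcurve : IsUnboundedSimpleCurve (frontier D)) {w : ℂ} (hw : w ∈ frontier D) {ε : ℝ}
    (hε : 0 < ε) : ∃ δ > 0, ∀ p ∈ D ∩ Metric.ball w δ, ∀ q ∈ D ∩ Metric.ball w δ,
      ∃ S, IsPreconnected S ∧ p ∈ S ∧ q ∈ S ∧ S ⊆ D ∩ Metric.ball w ε := by
  obtain ⟨γ, hγ, hinj, htop, hbot, hran⟩ := hcurve
  rw [← hran] at hw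
  obtain ⟨s, rfl⟩ := hw
  have hclosed := (isProperMap_of_tendsto hγ htop hbot).isClosedMap
  obtain ⟨η, hη, hηε⟩ := Metric.continuousAt_iff.1 (hγ.continuousAt (x := s)) ε hε
  set a := s - η / 2
  set b := s + η / 2
  -- The two tails of the curve are connected on the sphere, since they meet at infinity; the arc
  -- between them lies in the `ε`-ball.
  set B := γ '' Iic a ∪ γ '' Ici b with hB
  have hBc : IsClosed B := (hclosed _ isClosed_Iic).union (hclosed _ isClosed_Ici)
  have hsB : γ s ∉ B := by
    rintro (⟨t, ht, h⟩ | ⟨t, ht, h⟩)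
    · rw [hinj h] at ht; simp only [mem_Iic, a] at ht; linarith
    · rw [hinj h] at ht; simp only [mem_Ici, b] at ht; linarith
  have hrest : ∀ z ∈ frontier D, z ∉ B → z ∈ Metric.ball (γ s) ε := by
    intro z hz hzB
    rw [← hran] at hz
    obtain ⟨t, rfl⟩ := hz
    have h1 : a < t := by
      by_contra h
      exact hzB (Or.inl ⟨t, not_lt.1 h, rfl⟩)
    have h2 : t < b := by
      by_contra h
      exact hzB (Or.inr ⟨t, not_lt.1 h, rfl⟩)
    refine hηε ?_
    rw [Real.dist_eq, abs_lt]
    simp only [a, b] at h1 h2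
    constructor <;> linarith
  obtain ⟨δ, hδ, hδB⟩ := Metric.isOpen_iff.1 (hBc.isOpen_compl.inter Metric.isOpen_ball)
    (γ s) ⟨hsB, Metric.mem_ball_self hε⟩
  refine ⟨δ, hδ, fun p hp q hq => ?_⟩
  have hDfr : ∀ z ∈ D, z ∉ frontier D := fun z hz h => by
    rw [hDo.frontier_eq] at h; exact h.2 hz
  have hBsub : B ⊆ frontier D := by
    rw [← hran, hB]; exact union_subset (image_subset_range _ _) (image_subset_range _ _)
  -- The frontier does not separate `p` from `q`, as both lie in `D`; `Y` does not, as both lie in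
  -- the `δ`-ball. Their intersection is `B`, connected through infinity, so the union does not
  -- separate them either.
  set Y := B ∪ (Metric.ball (γ s) ε)ᶜ with hY
  have hYc : IsClosed Y := hBc.union Metric.isOpen_ball.isClosed_compl
  have hqY : q ∉ Y := by
    rintro (h | h)
    · exact (hδB hq.2).1 h
    · exact h (hδB hq.2).2
  have hqB : q ∉ B := (hδB hq.2).1
  have hinter : frontier D ∩ Y = B := by
    ext z
    constructor
    · rintro ⟨h1, h2 | h2⟩
      · exact h2
      · by_contra h; exact h2 (hrest z h1 h)
    · exact fun h => ⟨hBsub h, Or.inl h⟩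
  obtain ⟨S, hS, hpS, hqS, hSX⟩ := exists_isPreconnected_of_inter (p := p) (q := q)
    (X₁ := invSet q (frontier D)) (X₂ := invSet q Y) (S₁ := D) (S₂ := Metric.ball (γ s) δ)
    (isCompact_invSet isClosed_frontier (hDfr q hq.1)) (isCompact_invSet hYc hqY) (Or.inl rfl)
    (by
      rw [invSet_inter, hinter, hB, invSet_union]
      rw [hB, mem_union, not_or] at hqB
      exact IsPreconnected.union 0 (Or.inl rfl) (Or.inl rfl)
        (isPreconnected_invSet_image hγ isPreconnected_Iic hqB.1 (Iic_mem_atBot a) hbot)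
        (isPreconnected_invSet_image hγ isPreconnected_Ici hqB.2 (Ici_mem_atTop b) htop))
    hDc.isPreconnected (convex_ball _ _).isPreconnected hp.1 hq.1 hp.2 hq.2
    (fun ζ hζ h0 h => hDfr _ h (hζ.resolve_left h0))
    (fun ζ hζ h0 h => by
      rcases hζ.resolve_left h0 with h' | h'
      · exact (hδB h).1 h'
      · exact h' (hδB h).2)
  have key : ∀ z ∈ S, z ∉ frontier D ∪ Y := by
    intro z hz
    rcases eq_or_ne z q with rfl | hzq
    · rintro (h | h)
      · exact hDfr _ hq.1 h
      · exact hqY h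
    · have := hSX z hz hzq
      rintro (h | h)
      · exact this (Or.inl (Or.inr (by simpa using h)))
      · exact this (Or.inr (Or.inr (by simpa using h)))
  refine ⟨S, hS, hpS, hqS, subset_inter ?_ ?_⟩
  · exact subset_of_isPreconnected_of_frontier hS hDo ⟨p, hpS, hp.1⟩
      fun z hz h => key z hz (Or.inl h)
  · intro z hz
    by_contra h
    exact key z hz (Or.inr (Or.inr h))

lemma isPreconnected_lt_norm {M : ℝ} (hM : 0 < M) : IsPreconnected {z : ℂ | M < ‖z‖} := by
  have : {z : ℂ | M < ‖z‖} = Complex.exp '' {z | Real.log M < z.re} := by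
    ext z
    constructor
    · intro hz
      have hz' : 0 < ‖z‖ := hM.trans hz
      refine ⟨Complex.log z, ?_, Complex.exp_log (norm_pos_iff.1 hz')⟩
      simp only [mem_ofPred_eq, Complex.log_re]
      exact Real.log_lt_log hM hz
    · rintro ⟨u, hu, rfl⟩
      simp only [mem_ofPred_eq, Complex.norm_exp] at hu ⊢
      exact (Real.log_lt_iff_lt_exp hM).1 hu
  rw [this]
  exact (convex_halfSpace_re_gt _).isPreconnected.image _ Complex.continuous_exp.continuousOn

/-- A domain bounded by an unbounded simple curve is locally connected at infinity. -/
theorem exists_isPreconnected_subset_lt_norm {D : Set ℂ} (hDo : IsOpen D) (hDc : IsConnected D)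
    (hcurve : IsUnboundedSimpleCurve (frontier D)) (N : ℝ) :
    ∃ M : ℝ, ∀ p ∈ D, M < ‖p‖ → ∀ q ∈ D, M < ‖q‖ →
      ∃ S, IsPreconnected S ∧ p ∈ S ∧ q ∈ S ∧ S ⊆ D ∩ {z | N < ‖z‖} := by
  obtain ⟨γ, hγ, hinj, htop, hbot, hran⟩ := hcurve
  obtain ⟨b, hb⟩ := (htop.eventually_gt_atTop N).exists_forall_of_atTop
  obtain ⟨a, ha⟩ := (hbot.eventually_gt_atTop N).exists_forall_of_atBot
  -- Now the roles are exchanged: the tails lie outside the disc of radius `N`, so the frontier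
  -- meets `Y` exactly in the compact arc `B`.
  set B := γ '' Icc a b with hB
  have hBk : IsCompact B := isCompact_Icc.image hγ
  have hDfr : ∀ z ∈ D, z ∉ frontier D := fun z hz h => by
    rw [hDo.frontier_eq] at h; exact h.2 hz
  have hBsub : B ⊆ frontier D := by rw [← hran]; exact image_subset_range _ _
  set Y := B ∪ Metric.closedBall 0 N with hY
  have hYk : IsCompact Y := hBk.union (isCompact_closedBall _ _)
  obtain ⟨M, hM⟩ := hYk.isBounded.subset_closedBall 0
  have hMY : ∀ z, |M| + 1 < ‖z‖ → z ∉ Y := by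
    intro z hz h
    have := hM h
    simp only [Metric.mem_closedBall, dist_zero_right] at this
    linarith [le_abs_self M]
  -- `|M| + 1` is positive, which makes the exterior of the disc of this radius connected through
  -- the exponential map; that exterior avoids `Y`.
  refine ⟨|M| + 1, fun p hp hpM q hq hqM => ?_⟩
  have hqY := hMY q hqM
  have hne : ∀ z ∈ Y, z - q ≠ 0 := fun z hz h => hqY (sub_eq_zero.1 h ▸ hz)
  have hcont : ∀ Z ⊆ Y, ContinuousOn (fun z => (z - q)⁻¹) Z := fun Z hZ =>
    ContinuousOn.inv₀ (by fun_prop) fun z hz => hne z (hZ hz)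
  have hinter : frontier D ∩ Y = B := by
    ext z
    constructor
    · rintro ⟨h1, h2 | h2⟩
      · exact h2
      · rw [← hran] at h1
        obtain ⟨t, rfl⟩ := h1
        simp only [Metric.mem_closedBall, dist_zero_right] at h2
        refine ⟨t, ⟨?_, ?_⟩, rfl⟩
        · by_contra h; linarith [ha t (not_le.1 h).le]
        · by_contra h; linarith [hb t (not_le.1 h).le]
    · exact fun h => ⟨hBsub h, Or.inl h⟩
  obtain ⟨S, hS, hpS, hqS, hSX⟩ := exists_isPreconnected_of_inter (p := p) (q := q)
    (X₁ := invSet q (frontier D)) (X₂ := (fun z => (z - q)⁻¹) '' Y) (S₁ := D)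
    (S₂ := {z | |M| + 1 < ‖z‖})
    (isCompact_invSet isClosed_frontier (hDfr q hq)) (hYk.image_of_continuousOn (hcont Y subset_rfl))
    (Or.inl rfl)
    (by
      have : invSet q (frontier D) ∩ (fun z => (z - q)⁻¹) '' Y = (fun z => (z - q)⁻¹) '' B := by
        rw [← hinter]
        ext ζ
        constructor
        · rintro ⟨h | h, z, hz, rfl⟩
          · exact absurd h (inv_ne_zero (hne z hz))
          · exact ⟨z, ⟨by simpa using h, hz⟩, rfl⟩
        · rintro ⟨z, hz, rfl⟩
          exact ⟨Or.inr (by simpa using hz.1), z, hz.2, rfl⟩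
      rw [this]
      exact (isPreconnected_Icc.image _ hγ.continuousOn).image _ (hcont B subset_union_left))
    hDc.isPreconnected (isPreconnected_lt_norm (by positivity)) hp hq hpM hqM
    (fun ζ hζ h0 h => hDfr _ h (hζ.resolve_left h0))
    (by
      rintro _ ⟨z, hz, rfl⟩ h0 h
      exact hMY _ h (by simpa using hz))
  have key : ∀ z ∈ S, z ∉ frontier D ∪ Y := by
    intro z hz
    rcases eq_or_ne z q with rfl | hzq
    · rintro (h | h)
      · exact hDfr _ hq h
      · exact hqY h
    · have := hSX z hz hzq
      rintro (h | h)
      · exact this (Or.inl (Or.inr (by simpa using h)))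
      · exact this (Or.inr ⟨z, h, rfl⟩)
  refine ⟨S, hS, hpS, hqS, subset_inter ?_ ?_⟩
  · exact subset_of_isPreconnected_of_frontier hS hDo ⟨p, hpS, hp⟩
      fun z hz h => key z hz (Or.inl h)
  · intro z hz
    by_contra h
    exact key z hz (Or.inr (Or.inr (by simpa using h)))

/-! ### Domains without holes -/

/-- `O` has no holes: its complement has no nonempty compact relatively open subset. -/
def HoleFree (O : Set ℂ) : Prop :=
  ∀ A V : Set ℂ, IsCompact A → IsOpen V → A = V \ O → A = ∅

/-- A compact relatively open part `A` of the complement cannot meet the frontier: the frontier is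
connected, so it would lie inside `A`, yet it is unbounded. Hence `A` consists of exterior points
and is open, which is impossible for a nonempty compact set. -/
theorem holeFree_of_frontier {D : Set ℂ} (hDo : IsOpen D)
    (hcurve : IsUnboundedSimpleCurve (frontier D)) : HoleFree D := by
  obtain ⟨γ, hγ, hinj, htop, hbot, hran⟩ := hcurve
  intro A V hA hV hAV
  have hDfr : ∀ z ∈ frontier D, z ∉ D := fun z hz h => by
    rw [hDo.frontier_eq] at hz; exact hz.2 h
  have hpre : IsPreconnected (frontier D) := by rw [← hran]; exact isPreconnected_range hγ
  have hdisj : ∀ z ∈ frontier D, z ∉ A := by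
    by_contra! hcon
    obtain ⟨z, hz, hzA⟩ := hcon
    obtain ⟨r, hr⟩ := hA.isBounded.subset_closedBall 0
    obtain ⟨t, ht⟩ := (htop.eventually_gt_atTop r).exists
    have htA : γ t ∉ A := fun h => by
      have := hr h
      simp only [Metric.mem_closedBall, dist_zero_right] at this
      linarith
    obtain ⟨x, hx, hxV, hxA⟩ := hpre V Aᶜ hV hA.isClosed.isOpen_compl
      (fun x _ => by
        by_cases h : x ∈ A
        · rw [hAV] at h; exact Or.inl h.1
        · exact Or.inr h)
      ⟨z, hz, by rw [hAV] at hzA; exact hzA.1⟩ ⟨γ t, hran ▸ mem_range_self t, htA⟩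
    exact hxA (by rw [hAV]; exact ⟨hxV, hDfr x hx⟩)
  by_contra hne
  -- A rightmost point of `A` would be an interior point of `A`.
  obtain ⟨z, hz, hmax⟩ := hA.exists_isMaxOn (nonempty_iff_ne_empty.2 hne)
    Complex.continuous_re.continuousOn
  have hzV : z ∈ V \ D := hAV ▸ hz
  have hzint : z ∉ closure D := fun h => hdisj z (by rw [hDo.frontier_eq]; exact ⟨h, hzV.2⟩) hz
  have hnhds : A ∈ 𝓝 z := by
    filter_upwards [hV.mem_nhds hzV.1, isClosed_closure.isOpen_compl.mem_nhds hzint] with x h1 h2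
    rw [hAV]
    exact ⟨h1, fun h => h2 (subset_closure h)⟩
  obtain ⟨r, hr, hrA⟩ := Metric.mem_nhds_iff.1 hnhds
  have : z + (r / 2 : ℝ) ∈ A := hrA (by
    simp only [Metric.mem_ball, dist_eq_norm, add_sub_cancel_left, Complex.norm_real,
      Real.norm_eq_abs, abs_of_pos (half_pos hr)]
    linarith)
  have := hmax this
  simp only [mem_ofPred_eq, Complex.add_re, Complex.ofReal_re] at this
  linarith

/-! ### Cauchy's theorem for polygonal chains, after Dixon -/

open MeasureTheory in
/-- Holomorphic dependence of an integral on a parameter. -/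
lemma differentiableOn_intervalIntegral {F : ℂ → ℝ → ℂ} {U : Set ℂ} (hU : IsOpen U)
    (hF : ContinuousOn (Function.uncurry F) (U ×ˢ Icc 0 1))
    (hd : ∀ t ∈ Icc (0 : ℝ) 1, DifferentiableOn ℂ (fun z => F z t) U) :
    DifferentiableOn ℂ (fun z => ∫ t in (0 : ℝ)..1, F z t) U := by
  intro z₀ hz₀
  obtain ⟨r, hr, hrU⟩ := Metric.nhds_basis_closedBall.mem_iff.1 (hU.mem_nhds hz₀)
  have hcont : ∀ z ∈ U, ContinuousOn (F z) (Icc 0 1) := fun z hz =>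
    hF.comp (f := fun t => (z, t)) (by fun_prop) fun t ht => ⟨hz, ht⟩
  have hint : ∀ z ∈ U, AEStronglyMeasurable (F z) (volume.restrict (uIoc 0 1)) := fun z hz => by
    rw [uIoc_of_le zero_le_one]
    exact ((hcont z hz).mono Ioc_subset_Icc_self).aestronglyMeasurable measurableSet_Ioc
  obtain ⟨C, hC⟩ := ((isCompact_closedBall z₀ r).prod (isCompact_Icc (a := (0 : ℝ)) (b := 1))
    ).exists_bound_of_continuousOn (hF.mono (prod_mono hrU subset_rfl))
  have hder : ∀ t ∈ Icc (0 : ℝ) 1, ∀ x ∈ U, HasDerivAt (fun z => F z t)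
      (deriv (fun z => F z t) x) x := fun t ht x hx =>
    ((hd t ht).differentiableAt (hU.mem_nhds hx)).hasDerivAt
  have hIoc : ∀ t ∈ uIoc (0 : ℝ) 1, t ∈ Icc (0 : ℝ) 1 := fun t ht => by
    rw [uIoc_of_le zero_le_one] at ht; exact Ioc_subset_Icc_self ht
  refine (intervalIntegral.hasDerivAt_integral_of_dominated_loc_of_deriv_le
    (F' := fun z t => deriv (fun z => F z t) z) (bound := fun _ => C / (r / 2))
    (Metric.ball_mem_nhds z₀ (half_pos hr)) ?_ ?_ ?_ ?_ ?_ ?_).2.differentiableAt.differentiableWithinAt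
  · filter_upwards [hU.mem_nhds hz₀] with z hz using hint z hz
  · exact ContinuousOn.intervalIntegrable (by rw [uIcc_of_le zero_le_one]; exact hcont z₀ hz₀)
  -- Measurability in `t` of the `z`-derivative: it is a pointwise limit of difference quotients
  -- along a sequence. The domination `C / (r / 2)` is Cauchy's estimate on discs of radius `r / 2`.
  · obtain ⟨u, hu⟩ : ∃ u : ℕ → ℂ, Tendsto u atTop (𝓝[≠] 0) := exists_seq_tendsto _
    have hev : ∀ᶠ n in atTop, z₀ + u n ∈ U := by
      have : Tendsto (fun n => z₀ + u n) atTop (𝓝 (z₀ + 0)) :=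
        (tendsto_nhds_of_tendsto_nhdsWithin hu).const_add z₀
      rw [add_zero] at this
      exact this (hU.mem_nhds hz₀)
    obtain ⟨n₀, hn₀⟩ := hev.exists_forall_of_atTop
    refine aestronglyMeasurable_of_tendsto_ae atTop
      (f := fun n t => (u (n + n₀))⁻¹ * (F (z₀ + u (n + n₀)) t - F z₀ t)) (fun n => ?_) ?_
    · exact ((hint _ (hn₀ _ (Nat.le_add_left _ _))).sub (hint z₀ hz₀)).const_mul _
    · refine (ae_restrict_iff' measurableSet_uIoc).2 (ae_of_all _ fun t ht => ?_)
      have := (hasDerivAt_iff_tendsto_slope_zero.1 (hder t (hIoc t ht) z₀ hz₀)).comp hu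
      exact this.comp (tendsto_add_atTop_nat n₀)
  · refine ae_of_all _ fun t ht x hx => ?_
    have hsub : Metric.closedBall x (r / 2) ⊆ Metric.closedBall z₀ r := by
      refine Metric.closedBall_subset_closedBall' ?_
      have := Metric.mem_ball.1 hx
      linarith
    refine Complex.norm_deriv_le_of_forall_mem_sphere_norm_le (half_pos hr) ?_ fun z hz => ?_
    · refine DifferentiableOn.diffContOnCl ?_
      rw [closure_ball _ (half_pos hr).ne']
      exact (hd t (hIoc t ht)).mono (hsub.trans hrU)
    · exact hC (z, t) ⟨hsub (Metric.sphere_subset_closedBall hz), hIoc t ht⟩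
  · exact intervalIntegrable_const
  · refine ae_of_all _ fun t ht x hx => hder t (hIoc t ht) x (hrU ?_)
    exact Metric.closedBall_subset_closedBall (half_le_self hr.le) (Metric.ball_subset_closedBall hx)

/-- At the diagonal this is strict differentiability of `h`, combined with continuity of `deriv h`
for points on the diagonal itself. Joint continuity lets the difference quotient be integrated over
a chain with holomorphic dependence on the other variable. -/
lemma continuousOn_dslope_prod {h : ℂ → ℂ} {O : Set ℂ} (hO : IsOpen O)
    (hh : DifferentiableOn ℂ h O) :
    ContinuousOn (fun p : ℂ × ℂ => dslope h p.2 p.1) (O ×ˢ O) := by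
  have hd : ∀ z ∈ O, HasStrictDerivAt h (deriv h z) z := fun z hz =>
    (hh.analyticAt (hO.mem_nhds hz)).hasStrictDerivAt
  rintro ⟨a, b⟩ ⟨ha, hb⟩
  refine ContinuousAt.continuousWithinAt ?_
  by_cases hab : a = b
  · subst hab
    have hdc : ContinuousAt (deriv h) a :=
      ((hh.deriv hO).differentiableAt (hO.mem_nhds ha)).continuousAt
    rw [Metric.continuousAt_iff']
    intro ε hε
    have h1 := (hasStrictFDerivAt_iff_isLittleO.1 (hd a ha).hasStrictFDerivAt).def (half_pos hε)
    have h2 : ∀ᶠ p : ℂ × ℂ in 𝓝 (a, a), dist (deriv h p.1) (deriv h a) < ε :=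
      (hdc.tendsto.comp continuousAt_fst.tendsto) (Metric.ball_mem_nhds _ hε)
    filter_upwards [h1, h2] with p hp1 hp2
    simp only [dslope_same]
    by_cases hp : p.1 = p.2
    · rw [← hp, dslope_same]; exact hp2
    · rw [dslope_of_ne _ hp, dist_eq_norm, slope_def_field]
      have hne : p.1 - p.2 ≠ 0 := sub_ne_zero.2 hp
      have : (h p.1 - h p.2) / (p.1 - p.2) - deriv h a
          = (h p.1 - h p.2 - (p.1 - p.2) • deriv h a) / (p.1 - p.2) := by
        rw [smul_eq_mul]; field_simp
      rw [this, norm_div]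
      refine lt_of_le_of_lt ?_ (half_lt_self hε)
      rw [div_le_iff₀ (norm_pos_iff.2 hne)]
      exact hp1
  · have hev : ∀ᶠ p : ℂ × ℂ in 𝓝 (a, b), (h p.1 - h p.2) / (p.1 - p.2) = dslope h p.2 p.1 := by
      have : IsOpen {p : ℂ × ℂ | p.1 ≠ p.2} := isOpen_ne_fun continuous_fst continuous_snd
      filter_upwards [this.mem_nhds hab] with p hp
      rw [dslope_of_ne _ hp, slope_def_field]
    refine ContinuousAt.congr ?_ hev
    have ca : ContinuousAt h a := (hd a ha).hasDerivAt.continuousAt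
    have cb : ContinuousAt h b := (hd b hb).hasDerivAt.continuousAt
    have c1 : ContinuousAt (fun p : ℂ × ℂ => h p.1) (a, b) :=
      ContinuousAt.comp (g := h) (f := Prod.fst) ca continuousAt_fst
    have c2 : ContinuousAt (fun p : ℂ × ℂ => h p.2) (a, b) :=
      ContinuousAt.comp (g := h) (f := Prod.snd) cb continuousAt_snd
    exact (c1.sub c2).div (by fun_prop) (sub_ne_zero.2 hab)

/-- The integral of `h` along the segment from `a` to `b`. -/
noncomputable def segInt (a b : ℂ) (h : ℂ → ℂ) : ℂ :=
  ∫ t in (0 : ℝ)..1, h (a + t * (b - a)) * (b - a)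

lemma add_mul_sub_mem_segment (a b : ℂ) {t : ℝ} (ht : t ∈ Icc (0 : ℝ) 1) :
    a + t * (b - a) ∈ segment ℝ a b := by
  rw [segment_eq_image']
  exact ⟨t, ht, by simp⟩

/-- `IsChain O a b J K` means that `J` is integration along some polygonal path in `O` from `a` to
`b` whose trace is `K`. -/
inductive IsChain (O : Set ℂ) : ℂ → ℂ → ((ℂ → ℂ) → ℂ) → Set ℂ → Prop
  | seg (a b : ℂ) (h : segment ℝ a b ⊆ O) : IsChain O a b (segInt a b) (segment ℝ a b)
  | trans {a b c : ℂ} {J₁ J₂ : (ℂ → ℂ) → ℂ} {K₁ K₂ : Set ℂ} (h₁ : IsChain O a b J₁ K₁)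
      (h₂ : IsChain O b c J₂ K₂) : IsChain O a c (fun h => J₁ h + J₂ h) (K₁ ∪ K₂)

namespace IsChain

variable {O : Set ℂ} {a b : ℂ} {J : (ℂ → ℂ) → ℂ} {K : Set ℂ}

lemma isCompact (h : IsChain O a b J K) : IsCompact K := by
  induction h with
  | seg a b h =>
    rw [segment_eq_image']
    exact isCompact_Icc.image (by fun_prop)
  | trans _ _ h₁ h₂ => exact h₁.union h₂

lemma subset (h : IsChain O a b J K) : K ⊆ O := by
  induction h with
  | seg a b h => exact h
  | trans _ _ h₁ h₂ => exact union_subset h₁ h₂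

lemma nonempty (h : IsChain O a b J K) : K.Nonempty := by
  induction h with
  | seg a b h => exact ⟨a, left_mem_segment ℝ a b⟩
  | trans _ _ h₁ h₂ => exact h₁.inl

lemma congr (h : IsChain O a b J K) {f g : ℂ → ℂ} (hfg : EqOn f g K) : J f = J g := by
  induction h with
  | seg a b h =>
    refine intervalIntegral.integral_congr fun t ht => ?_
    rw [uIcc_of_le zero_le_one] at ht
    rw [hfg (add_mul_sub_mem_segment a b ht)]
  | trans _ _ h₁ h₂ =>
    simp only
    rw [h₁ (hfg.mono subset_union_left), h₂ (hfg.mono subset_union_right)]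

lemma map_const_mul (h : IsChain O a b J K) (c : ℂ) (f : ℂ → ℂ) :
    J (fun z => c * f z) = c * J f := by
  induction h with
  | seg a b h =>
    simp only [segInt, mul_assoc]
    exact intervalIntegral.integral_const_mul c _
  | trans _ _ h₁ h₂ => simp only [h₁, h₂, mul_add]

lemma continuousOn_seg {a b : ℂ} {f : ℂ → ℂ} (hf : ContinuousOn f (segment ℝ a b)) :
    ContinuousOn (fun t : ℝ => f (a + t * (b - a)) * (b - a)) (Icc 0 1) :=
  (hf.comp (by fun_prop) fun t ht => add_mul_sub_mem_segment a b ht).mul continuousOn_const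

lemma map_sub (h : IsChain O a b J K) {f g : ℂ → ℂ} (hf : ContinuousOn f K)
    (hg : ContinuousOn g K) : J (fun z => f z - g z) = J f - J g := by
  induction h with
  | seg a b h =>
    simp only [segInt, sub_mul]
    refine intervalIntegral.integral_sub ?_ ?_
    · refine ContinuousOn.intervalIntegrable ?_
      rw [uIcc_of_le zero_le_one]; exact continuousOn_seg hf
    · refine ContinuousOn.intervalIntegrable ?_
      rw [uIcc_of_le zero_le_one]; exact continuousOn_seg hg
  | trans _ _ h₁ h₂ =>
    simp only
    rw [h₁ (hf.mono subset_union_left) (hg.mono subset_union_left),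
      h₂ (hf.mono subset_union_right) (hg.mono subset_union_right)]
    ring

lemma eq_sub (h : IsChain O a b J K) {f P : ℂ → ℂ} (hf : ContinuousOn f K)
    (hP : ∀ z ∈ K, HasDerivAt P (f z) z) : J f = P b - P a := by
  induction h with
  | seg a b h =>
    have := intervalIntegral.integral_eq_sub_of_hasDerivAt (a := 0) (b := 1)
      (f := fun t : ℝ => P (a + t * (b - a))) (f' := fun t : ℝ => f (a + t * (b - a)) * (b - a))
      (fun t ht => by
        rw [uIcc_of_le zero_le_one] at ht
        have h1 := hP _ (add_mul_sub_mem_segment a b ht)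
        have h2 : HasDerivAt (fun t : ℝ => a + t * (b - a)) (b - a) t := by
          simpa using ((Complex.ofRealCLM.hasDerivAt (x := t)).mul_const (b - a)).const_add a
        exact h1.comp t h2)
      (by
        refine ContinuousOn.intervalIntegrable ?_
        rw [uIcc_of_le zero_le_one]; exact continuousOn_seg hf)
    simpa [segInt] using this
  | trans _ _ h₁ h₂ =>
    simp only
    rw [h₁ (hf.mono subset_union_left) fun z hz => hP z (Or.inl hz),
      h₂ (hf.mono subset_union_right) fun z hz => hP z (Or.inr hz)]
    ring

lemma exists_norm_le (h : IsChain O a b J K) :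
    ∃ C : ℝ, 0 ≤ C ∧ ∀ (f : ℂ → ℂ) (M : ℝ), (∀ z ∈ K, ‖f z‖ ≤ M) → ‖J f‖ ≤ C * M := by
  induction h with
  | seg a b h =>
    refine ⟨‖b - a‖, norm_nonneg _, fun f M hM => ?_⟩
    have := intervalIntegral.norm_integral_le_of_norm_le_const (a := 0) (b := 1)
      (f := fun t : ℝ => f (a + t * (b - a)) * (b - a)) (C := ‖b - a‖ * M) fun t ht => by
        rw [uIoc_of_le zero_le_one] at ht
        rw [norm_mul, mul_comm]
        exact mul_le_mul_of_nonneg_left (hM _ (add_mul_sub_mem_segment a b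
          (Ioc_subset_Icc_self ht))) (norm_nonneg _)
    simpa [segInt] using this
  | trans _ _ h₁ h₂ =>
    obtain ⟨C₁, h0, h1⟩ := h₁
    obtain ⟨C₂, h0', h2⟩ := h₂
    refine ⟨C₁ + C₂, add_nonneg h0 h0', fun f M hM => ?_⟩
    rw [add_mul]
    exact (norm_add_le _ _).trans (add_le_add (h1 f M fun z hz => hM z (Or.inl hz))
      (h2 f M fun z hz => hM z (Or.inr hz)))

lemma differentiableOn_param (h : IsChain O a b J K) {U : Set ℂ} (hU : IsOpen U)
    {F : ℂ → ℂ → ℂ} (hF : ContinuousOn (Function.uncurry F) (U ×ˢ K))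
    (hd : ∀ w ∈ K, DifferentiableOn ℂ (fun z => F z w) U) :
    DifferentiableOn ℂ (fun z => J (F z)) U := by
  induction h with
  | seg a b h =>
    refine differentiableOn_intervalIntegral
      (F := fun z t => F z (a + t * (b - a)) * (b - a)) hU ?_ fun t ht => ?_
    · refine ContinuousOn.mul ?_ continuousOn_const
      exact hF.comp (f := fun p : ℂ × ℝ => (p.1, a + p.2 * (b - a))) (by fun_prop)
        fun p hp => ⟨hp.1, add_mul_sub_mem_segment a b hp.2⟩
    · exact (hd _ (add_mul_sub_mem_segment a b ht)).mul_const _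
  | trans _ _ h₁ h₂ =>
    exact (h₁ (hF.mono (prod_mono subset_rfl subset_union_left)) fun w hw => hd w (Or.inl hw)).add
      (h₂ (hF.mono (prod_mono subset_rfl subset_union_right)) fun w hw => hd w (Or.inr hw))

lemma exists_reverse (h : IsChain O a b J K) :
    ∃ J', IsChain O b a J' K ∧ ∀ f, J' f = -J f := by
  induction h with
  | seg a b h =>
    refine ⟨segInt b a, ?_, fun f => ?_⟩
    · rw [segment_symm] at h ⊢
      exact IsChain.seg b a h
    · have := intervalIntegral.integral_comp_sub_left (a := 0) (b := 1)
        (fun t : ℝ => f (a + t * (b - a)) * (b - a)) 1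
      simp only [sub_self, sub_zero] at this
      rw [segInt, segInt, ← this, ← intervalIntegral.integral_neg]
      congr 1
      ext t
      push_cast
      rw [← mul_neg, neg_sub]
      congr 2
      ring
  | trans _ _ h₁ h₂ =>
    obtain ⟨J₁, c1, e1⟩ := h₁
    obtain ⟨J₂, c2, e2⟩ := h₂
    refine ⟨_, by rw [union_comm]; exact c2.trans c1, fun f => ?_⟩
    simp only [e1, e2]
    ring

lemma continuousOn_inv_sub {ζ : ℂ} (hζ : ζ ∉ K) : ContinuousOn (fun w => (w - ζ)⁻¹) K :=
  ContinuousOn.inv₀ (by fun_prop) fun _ hw h0 => hζ (sub_eq_zero.1 h0 ▸ hw)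

/-- For `ξ` close to `ζ` the quotient `(w - ξ) / (w - ζ)` stays within distance `1` of `1` on `K`.
Its principal logarithm is then a primitive of the difference of the integrands, and the chain is
closed. -/
lemma eventually_winding_eq (h : IsChain O a a J K) {ζ : ℂ} (hζ : ζ ∉ K) :
    ∀ᶠ ξ in 𝓝 ζ, J (fun w => (w - ξ)⁻¹) = J (fun w => (w - ζ)⁻¹) := by
  obtain ⟨d, hd, hdK⟩ := Metric.isOpen_iff.1 h.isCompact.isClosed.isOpen_compl ζ hζ
  filter_upwards [Metric.ball_mem_nhds ζ (half_pos hd)] with ξ hξ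
  have hξK : ξ ∉ K := hdK (Metric.ball_subset_ball (half_le_self hd.le) hξ)
  have hwne : ∀ w ∈ K, w - ζ ≠ 0 := fun w hw h0 => hζ (sub_eq_zero.1 h0 ▸ hw)
  have hwne' : ∀ w ∈ K, w - ξ ≠ 0 := fun w hw h0 => hξK (sub_eq_zero.1 h0 ▸ hw)
  have hslit : ∀ w ∈ K, (w - ξ) / (w - ζ) ∈ Complex.slitPlane := by
    intro w hw
    have h1 : ‖(ζ - ξ) / (w - ζ)‖ < 1 := by
      rw [norm_div, div_lt_one (norm_pos_iff.2 (hwne w hw))]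
      have h2 : ¬ dist w ζ < d := fun h' => hdK h' hw
      have h3 : dist ξ ζ < d / 2 := hξ
      rw [dist_comm, dist_eq_norm] at h3
      rw [dist_eq_norm] at h2
      linarith
    have := Complex.mem_slitPlane_of_norm_lt_one h1
    convert this using 1
    field_simp [hwne w hw]
    ring
  have hcont : ContinuousOn (fun w => (w - ξ)⁻¹ - (w - ζ)⁻¹) K :=
    (continuousOn_inv_sub hξK).sub (continuousOn_inv_sub hζ)
  rw [← sub_eq_zero, ← h.map_sub (continuousOn_inv_sub hξK) (continuousOn_inv_sub hζ),
    h.eq_sub (P := fun w => Complex.log ((w - ξ) / (w - ζ))) hcont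
      fun w hw => ?_, sub_self]
  have h1 : HasDerivAt (fun w => (w - ξ) / (w - ζ))
      ((1 * (w - ζ) - (w - ξ) * 1) / (w - ζ) ^ 2) w :=
    ((hasDerivAt_id w).sub_const ξ).div ((hasDerivAt_id w).sub_const ζ) (hwne w hw)
  refine (h1.clog (hslit w hw)).congr_deriv ?_
  have := hwne w hw
  have := hwne' w hw
  field_simp

/-- Far out, `log (1 - w / ζ)` is a single-valued primitive of `1 / (w - ζ)` on `K`. -/
lemma exists_winding_eq_zero_of_lt_norm (h : IsChain O a a J K) :
    ∃ r : ℝ, (∀ w ∈ K, ‖w‖ ≤ r) ∧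
      ∀ ζ : ℂ, r < ‖ζ‖ → ζ ∉ K ∧ J (fun w => (w - ζ)⁻¹) = 0 := by
  obtain ⟨r, hr⟩ := h.isCompact.isBounded.subset_closedBall 0
  have hr' : ∀ w ∈ K, ‖w‖ ≤ r := fun w hw => by simpa using hr hw
  refine ⟨r, hr', fun ζ hζ => ?_⟩
  have hle : ∀ w ∈ K, ‖w‖ < ‖ζ‖ := fun w hw => (hr' w hw).trans_lt hζ
  have hζ0 : ζ ≠ 0 := by
    rintro rfl
    obtain ⟨w, hw⟩ := h.nonempty
    have := hle w hw
    simp only [norm_zero] at this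
    linarith [norm_nonneg w]
  have hζK : ζ ∉ K := fun h => lt_irrefl _ (hle ζ h)
  refine ⟨hζK, ?_⟩
  have hslit : ∀ w ∈ K, 1 - w / ζ ∈ Complex.slitPlane := fun w hw => by
    have : ‖-(w / ζ)‖ < 1 := by
      rw [norm_neg, norm_div, div_lt_one (norm_pos_iff.2 hζ0)]; exact hle w hw
    simpa [sub_eq_add_neg] using Complex.mem_slitPlane_of_norm_lt_one this
  rw [h.eq_sub (P := fun w => Complex.log (1 - w / ζ)) (continuousOn_inv_sub hζK)
    fun w hw => ?_, sub_self]
  have h1 : HasDerivAt (fun w => 1 - w / ζ) (-(1 / ζ)) w :=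
    ((hasDerivAt_id w).div_const ζ).const_sub 1
  refine (h1.clog (hslit w hw)).congr_deriv ?_
  have h2 : w - ζ ≠ 0 := fun h0 => hζK (sub_eq_zero.1 h0 ▸ hw)
  have h3 : ζ - w ≠ 0 := fun h0 => h2 (by linear_combination -h0)
  field_simp
  ring

/-- The winding number integral of a closed chain vanishes off a set without holes. -/
lemma winding_eq_zero (h : IsChain O a a J K) (hOo : IsOpen O) (hO : HoleFree O) {ζ : ℂ}
    (hζ : ζ ∉ O) : J (fun w => (w - ζ)⁻¹) = 0 := by
  by_contra hne
  have hopen : ∀ s : Set ℂ, IsOpen {ξ | ξ ∉ K ∧ J (fun w => (w - ξ)⁻¹) ∈ s} := by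
    intro s
    rw [isOpen_iff_mem_nhds]
    rintro ξ ⟨h1, h2⟩
    filter_upwards [h.eventually_winding_eq h1, h.isCompact.isClosed.isOpen_compl.mem_nhds h1]
      with x hx hxK
    exact ⟨hxK, hx ▸ h2⟩
  -- The winding integral is locally constant off `K` and zero far out. The points of the complement
  -- of `O` where it is nonzero thus form a compact relatively open set, which must be empty.
  set V := {ξ | ξ ∉ K ∧ J (fun w => (w - ξ)⁻¹) ∈ ({0}ᶜ : Set ℂ)} with hV
  have hmem : ζ ∈ V \ O := ⟨⟨fun hk => hζ (h.subset hk), hne⟩, hζ⟩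
  rw [hO (V \ O) V ?_ (hopen _) rfl] at hmem
  · exact hmem
  · obtain ⟨r, -, hr⟩ := h.exists_winding_eq_zero_of_lt_norm
    refine Metric.isCompact_of_isClosed_isBounded ?_ ((Metric.isBounded_closedBall (x := 0)
      (r := r)).subset fun ξ hξ => ?_)
    · have : (V \ O)ᶜ = O ∪ {ξ | ξ ∉ K ∧ J (fun w => (w - ξ)⁻¹) ∈ ({0} : Set ℂ)} := by
        ext ξ
        simp only [hV, mem_compl_iff, Set.mem_sdiff, mem_ofPred_eq, mem_singleton_iff, mem_union]
        have hsub : ξ ∈ K → ξ ∈ O := fun hk => h.subset hk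
        tauto
      rw [← isOpen_compl_iff, this]
      exact hOo.union (hopen _)
    · by_contra hcon
      simp only [Metric.mem_closedBall, dist_zero_right, not_le] at hcon
      exact hξ.1.2 (hr ξ hcon).2

/-- **Dixon's form of Cauchy's formula** for closed chains in an open set without holes. -/
lemma integral_div_sub_eq (h : IsChain O a a J K) (hOo : IsOpen O) (hO : HoleFree O) {f : ℂ → ℂ}
    (hf : DifferentiableOn ℂ f O) {z : ℂ} (hz : z ∈ O) (hzK : z ∉ K) :
    J (fun w => f w * (w - z)⁻¹) = f z * J (fun w => (w - z)⁻¹) := by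
  classical
  have hfK : ContinuousOn f K := hf.continuousOn.mono h.subset
  -- Dixon's function: where the winding integral vanishes the two expressions agree, and these
  -- points together with `O` cover the plane. So `G` is entire; it tends to `0` at infinity and is
  -- identically `0` by Liouville.
  set G : ℂ → ℂ := fun z => if z ∈ O then J (fun w => dslope f w z)
    else J (fun w => f w * (w - z)⁻¹) with hG
  have hformula : ∀ z ∈ O, z ∉ K → J (fun w => dslope f w z)
      = J (fun w => f w * (w - z)⁻¹) - f z * J (fun w => (w - z)⁻¹) := by
    intro z hz hzK
    have c1 : ContinuousOn (fun w => f w * (w - z)⁻¹) K := hfK.mul (continuousOn_inv_sub hzK)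
    have c2 : ContinuousOn (fun w => f z * (w - z)⁻¹) K :=
      continuousOn_const.mul (continuousOn_inv_sub hzK)
    rw [← h.map_const_mul, ← h.map_sub c1 c2]
    refine h.congr fun w hw => ?_
    have hzw : z ≠ w := fun h' => hzK (h' ▸ hw)
    have h1 : z - w ≠ 0 := sub_ne_zero.2 hzw
    have h2 : w - z ≠ 0 := sub_ne_zero.2 hzw.symm
    rw [dslope_of_ne _ hzw, slope_def_field]
    field_simp
    ring
  set V := {ξ | ξ ∉ K ∧ J (fun w => (w - ξ)⁻¹) = 0} with hV
  have hVo : IsOpen V := by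
    rw [isOpen_iff_mem_nhds]
    rintro ξ ⟨h1, h2⟩
    filter_upwards [h.eventually_winding_eq h1, h.isCompact.isClosed.isOpen_compl.mem_nhds h1]
      with x hx hxK
    exact ⟨hxK, hx.trans h2⟩
  have hGV : ∀ z ∈ V, G z = J (fun w => f w * (w - z)⁻¹) := by
    intro z hz
    by_cases hzO : z ∈ O
    · simp only [hG, if_pos hzO]
      rw [hformula z hzO hz.1, hz.2]
      ring
    · simp [hG, hzO]
  have hGd : Differentiable ℂ G := by
    intro z
    by_cases hzO : z ∈ O
    · have h1 : DifferentiableOn ℂ (fun z => J (fun w => dslope f w z)) O :=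
        h.differentiableOn_param (F := fun z w => dslope f w z) hOo
          ((continuousOn_dslope_prod hOo hf).mono (prod_mono subset_rfl h.subset))
          fun w hw => (Complex.differentiableOn_dslope (hOo.mem_nhds (h.subset hw))).2 hf
      refine (h1.differentiableAt (hOo.mem_nhds hzO)).congr_of_eventuallyEq ?_
      filter_upwards [hOo.mem_nhds hzO] with x hx
      simp [hG, hx]
    · have hzV : z ∈ V := ⟨fun hk => hzO (h.subset hk), h.winding_eq_zero hOo hO hzO⟩
      have hne : ∀ p ∈ V ×ˢ K, p.2 - p.1 ≠ 0 := fun p hp h0 =>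
        hp.1.1 (sub_eq_zero.1 h0 ▸ hp.2)
      have h1 : DifferentiableOn ℂ (fun z => J (fun w => f w * (w - z)⁻¹)) V := by
        refine h.differentiableOn_param (F := fun z w => f w * (w - z)⁻¹) hVo ?_ fun w hw => ?_
        · exact (hfK.comp continuousOn_snd fun p hp => hp.2).mul
            (ContinuousOn.inv₀ (by fun_prop) hne)
        · exact DifferentiableOn.const_mul (DifferentiableOn.inv (by fun_prop)
            fun x hx => hne (x, w) ⟨hx, hw⟩) _
      refine (h1.differentiableAt (hVo.mem_nhds hzV)).congr_of_eventuallyEq ?_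
      filter_upwards [hVo.mem_nhds hzV] with x hx using hGV x hx
  have hlim : Tendsto G (cocompact ℂ) (𝓝 0) := by
    obtain ⟨r, hrK, hr⟩ := h.exists_winding_eq_zero_of_lt_norm
    obtain ⟨C, hC, hCJ⟩ := h.exists_norm_le
    obtain ⟨M, hM⟩ := h.isCompact.exists_bound_of_continuousOn hfK
    have hn := tendsto_norm_cocompact_atTop (E := ℂ)
    have h1 : Tendsto (fun z : ℂ => C * (M * (‖z‖ - r)⁻¹)) (cocompact ℂ) (𝓝 0) := by
      have := ((tendsto_atTop_add_const_right _ (-r) hn).inv_tendsto_atTop.const_mul M).const_mul C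
      simpa [sub_eq_add_neg] using this
    refine squeeze_zero_norm' ?_ h1
    filter_upwards [hn.eventually_gt_atTop r] with z hz
    rw [hGV z (hr z hz)]
    refine hCJ _ _ fun w hw => ?_
    rw [norm_mul, norm_inv]
    have h2 : ‖z‖ - r ≤ ‖w - z‖ := by
      rw [norm_sub_rev]
      linarith [norm_sub_norm_le z w, hrK w hw]
    have h3 : 0 < ‖z‖ - r := by linarith
    exact mul_le_mul (hM w hw) (inv_anti₀ h3 h2) (by positivity) ((norm_nonneg _).trans (hM w hw))
  have h0 := hGd.apply_eq_of_tendsto_cocompact z hlim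
  simp only [hG, if_pos hz] at h0
  rw [hformula z hz hzK] at h0
  exact sub_eq_zero.1 h0

/-- **Cauchy's theorem** for closed chains in an open set without holes. -/
theorem integral_eq_zero (h : IsChain O a a J K) (hOo : IsOpen O) (hO : HoleFree O) {f : ℂ → ℂ}
    (hf : DifferentiableOn ℂ f O) : J f = 0 := by
  obtain ⟨z, hz, hzK⟩ : ∃ z ∈ O, z ∉ K := by
    by_contra! hcon
    have hOK : O = K := subset_antisymm hcon h.subset
    rcases isClopen_iff.1 (⟨hOK ▸ h.isCompact.isClosed, hOo⟩ : IsClopen O) with h0 | h0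
    · exact h.nonempty.ne_empty (hOK ▸ h0)
    · exact noncompact_univ ℂ (h0 ▸ hOK ▸ h.isCompact)
  -- Cauchy's formula for `(w - z) f w`, which vanishes at `z`, is Cauchy's theorem for `f`.
  have := h.integral_div_sub_eq hOo hO (f := fun w => (w - z) * f w)
    (DifferentiableOn.mul (by fun_prop) hf) hz hzK
  rw [sub_self, zero_mul, zero_mul] at this
  rw [← this]
  refine h.congr fun w hw => ?_
  have : w - z ≠ 0 := fun h' => hzK (sub_eq_zero.1 h' ▸ hw)
  field_simp

end IsChain

/-! ### Primitives and holomorphic logarithms -/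

lemma exists_isChain {O : Set ℂ} (hOo : IsOpen O) (hOc : IsPreconnected O) {x y : ℂ}
    (hx : x ∈ O) (hy : y ∈ O) : ∃ J K, IsChain O x y J K := by
  refine hOc.induction₂' (fun x y => ∃ J K, IsChain O x y J K) (fun x hx => ?_) ?_ hx hy
  · obtain ⟨r, hr, hrO⟩ := Metric.isOpen_iff.1 hOo x hx
    filter_upwards [mem_nhdsWithin_of_mem_nhds (Metric.ball_mem_nhds x hr)] with y hy
    have h1 : segment ℝ x y ⊆ O :=
      ((convex_ball x r).segment_subset (Metric.mem_ball_self hr) hy).trans hrO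
    exact ⟨⟨_, _, .seg x y h1⟩, ⟨_, _, .seg y x (segment_symm ℝ x y ▸ h1)⟩⟩
  · rintro x y z - - - ⟨J₁, K₁, h₁⟩ ⟨J₂, K₂, h₂⟩
    exact ⟨_, _, h₁.trans h₂⟩

/-- Holomorphic functions on a domain without holes have primitives. -/
theorem exists_primitive {O : Set ℂ} (hOo : IsOpen O) (hOc : IsConnected O) (hO : HoleFree O)
    {f : ℂ → ℂ} (hf : DifferentiableOn ℂ f O) : ∃ P : ℂ → ℂ, ∀ z ∈ O, HasDerivAt P (f z) z := by
  classical
  obtain ⟨z₀, hz₀⟩ := hOc.nonempty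
  have hex : ∀ z ∈ O, ∃ J K, IsChain O z₀ z J K := fun z hz =>
    exists_isChain hOo hOc.isPreconnected hz₀ hz
  choose! J K hJ using hex
  -- Path independence: one chain followed by the reverse of another is closed.
  have huniq : ∀ z ∈ O, ∀ J' K', IsChain O z₀ z J' K' → J z f = J' f := by
    intro z hz J' K' h'
    obtain ⟨J'', h'', he⟩ := h'.exists_reverse
    have := ((hJ z hz).trans h'').integral_eq_zero hOo hO hf
    rw [he] at this
    linear_combination this
  refine ⟨fun z => J z f, fun z hz => ?_⟩
  obtain ⟨r, hr, hrO⟩ := Metric.isOpen_iff.1 hOo z hz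
  obtain ⟨P, hP⟩ := (hf.mono hrO).isExactOn_ball
  have : ∀ᶠ x in 𝓝 z, J x f = P x + (J z f - P z) := by
    filter_upwards [Metric.ball_mem_nhds z hr] with x hx
    have hsub := (convex_ball z r).segment_subset (Metric.mem_ball_self hr) hx
    have hseg := IsChain.seg z x (hsub.trans hrO)
    rw [huniq x (hrO hx) _ _ ((hJ z hz).trans hseg),
      hseg.eq_sub (hf.continuousOn.mono (hsub.trans hrO)) fun w hw => hP w (hsub hw)]
    ring
  exact ((hP z (Metric.mem_ball_self hr)).add_const _).congr_of_eventuallyEq this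

/-- Nonvanishing holomorphic functions on a domain without holes have holomorphic logarithms. -/
theorem exists_holomorphic_log {O : Set ℂ} (hOo : IsOpen O) (hOc : IsConnected O) (hO : HoleFree O)
    {f : ℂ → ℂ} (hf : DifferentiableOn ℂ f O) (h0 : ∀ z ∈ O, f z ≠ 0) :
    ∃ g : ℂ → ℂ, DifferentiableOn ℂ g O ∧ ∀ z ∈ O, Complex.exp (g z) = f z := by
  obtain ⟨P, hP⟩ := exists_primitive hOo hOc hO ((hf.deriv hOo).div hf h0)
  obtain ⟨z₀, hz₀⟩ := hOc.nonempty
  -- As `P' = f' / f`, the product `f exp (-P)` is constant, and a logarithm of this constant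
  -- corrects `P`.
  have hder : ∀ z ∈ O, HasDerivAt (fun z => f z * Complex.exp (-P z)) 0 z := by
    intro z hz
    have h1 := (hf.differentiableAt (hOo.mem_nhds hz)).hasDerivAt
    refine (h1.mul (hP z hz).neg.cexp).congr_deriv ?_
    have := h0 z hz
    simp only [Pi.div_apply]
    field_simp
    ring
  have hconst : ∀ z ∈ O, f z * Complex.exp (-P z) = f z₀ * Complex.exp (-P z₀) := fun z hz =>
    hOo.is_const_of_deriv_eq_zero hOc.isPreconnected
      (fun w hw => (hder w hw).differentiableAt.differentiableWithinAt)
      (fun w hw => (hder w hw).deriv) hz hz₀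
  refine ⟨fun z => P z + Complex.log (f z₀ * Complex.exp (-P z₀)), fun z hz =>
    ((hP z hz).differentiableAt.add_const _).differentiableWithinAt, fun z hz => ?_⟩
  rw [Complex.exp_add, Complex.exp_log (mul_ne_zero (h0 _ hz₀) (Complex.exp_ne_zero _)),
    ← hconst z hz, mul_comm, mul_assoc, ← Complex.exp_add]
  simp

/-! ### Injective holomorphic functions and their inverses -/

section Univalent

variable {f : ℂ → ℂ} {U : Set ℂ}

lemma not_eventually_eq_of_injOn (hU : IsOpen U) (hi : InjOn f U) {z : ℂ} (hz : z ∈ U) :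
    ¬ ∀ᶠ x in 𝓝 z, f x = f z := by
  intro h
  have h1 : ∀ᶠ x in 𝓝[≠] z, False := by
    filter_upwards [nhdsWithin_le_nhds h, nhdsWithin_le_nhds (hU.mem_nhds hz),
      self_mem_nhdsWithin] with x h1 h2 h3
    exact h3 (hi h2 hz h1)
  exact (h1.exists).elim fun _ h => h

lemma nhds_le_map_of_injOn (hU : IsOpen U) (hf : DifferentiableOn ℂ f U) (hi : InjOn f U) {z : ℂ}
    (hz : z ∈ U) : 𝓝 (f z) ≤ map f (𝓝 z) :=
  ((hf.analyticAt (hU.mem_nhds hz)).eventually_constant_or_nhds_le_map_nhds).resolve_left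
    (not_eventually_eq_of_injOn hU hi hz)

lemma isOpen_image_of_injOn (hU : IsOpen U) (hf : DifferentiableOn ℂ f U) (hi : InjOn f U) :
    IsOpen (f '' U) := by
  rw [isOpen_iff_mem_nhds]
  rintro _ ⟨z, hz, rfl⟩
  exact nhds_le_map_of_injOn hU hf hi hz (image_mem_map (hU.mem_nhds hz))

lemma continuousAt_invFunOn (hU : IsOpen U) (hf : DifferentiableOn ℂ f U) (hi : InjOn f U) {z : ℂ}
    (hz : z ∈ U) : ContinuousAt (Function.invFunOn f U) (f z) := by
  rw [ContinuousAt, hi.leftInvOn_invFunOn hz]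
  refine Tendsto.mono_left ?_ (nhds_le_map_of_injOn hU hf hi hz)
  rw [tendsto_map'_iff]
  refine tendsto_id.congr' ?_
  filter_upwards [hU.mem_nhds hz] with x hx
  exact (hi.leftInvOn_invFunOn hx).symm

lemma hasDerivAt_invFunOn (hU : IsOpen U) (hf : DifferentiableOn ℂ f U) (hi : InjOn f U) {z : ℂ}
    (hz : z ∈ U) (hd : deriv f z ≠ 0) :
    HasDerivAt (Function.invFunOn f U) (deriv f z)⁻¹ (f z) := by
  have h1 := continuousAt_invFunOn hU hf hi hz
  have h2 : HasDerivAt f (deriv f z) (Function.invFunOn f U (f z)) := by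
    rw [hi.leftInvOn_invFunOn hz]
    exact (hf.differentiableAt (hU.mem_nhds hz)).hasDerivAt
  refine h2.of_local_left_inverse h1 hd (nhds_le_map_of_injOn hU hf hi hz (mem_map.2 ?_))
  filter_upwards [hU.mem_nhds hz] with x hx
  simp only [mem_preimage, mem_ofPred_eq, hi.leftInvOn_invFunOn hx]

/-- The inverse of an injective holomorphic function is holomorphic. -/
lemma differentiableAt_invFunOn (hU : IsOpen U) (hf : DifferentiableOn ℂ f U) (hi : InjOn f U)
    {z : ℂ} (hz : z ∈ U) : DifferentiableAt ℂ (Function.invFunOn f U) (f z) := by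
  -- Critical points are isolated, since otherwise `f` would be constant near `z`. The inverse is
  -- thus holomorphic on a punctured neighbourhood of `f z` and continuous there, so the singularity
  -- is removable.
  have hne : ∀ᶠ x in 𝓝[≠] z, deriv f x ≠ 0 := by
    have han : AnalyticAt ℂ (deriv f) z := (hf.deriv hU).analyticAt (hU.mem_nhds hz)
    refine han.eventually_eq_zero_or_eventually_ne_zero.resolve_left fun h => ?_
    refine not_eventually_eq_of_injOn hU hi hz ?_
    obtain ⟨r, hr, hrs⟩ := Metric.mem_nhds_iff.1 (inter_mem h (hU.mem_nhds hz))
    filter_upwards [Metric.ball_mem_nhds z hr] with x hx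
    exact Metric.isOpen_ball.is_const_of_deriv_eq_zero (convex_ball z r).isPreconnected
      (hf.mono fun y hy => (hrs hy).2) (fun y hy => (hrs hy).1) hx (Metric.mem_ball_self hr)
  refine (Complex.analyticAt_of_differentiable_on_punctured_nhds_of_continuousAt ?_
    (continuousAt_invFunOn hU hf hi hz)).differentiableAt
  rw [eventually_nhdsWithin_iff] at hne ⊢
  refine nhds_le_map_of_injOn hU hf hi hz (mem_map.2 ?_)
  filter_upwards [hne, hU.mem_nhds hz] with x hx hxU hxz
  exact (hasDerivAt_invFunOn hU hf hi hxU
    (hx fun h => hxz (by rw [mem_singleton_iff.1 h]; rfl))).differentiableAt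

/-- An injective holomorphic function has no critical points. -/
lemma deriv_ne_zero_of_injOn (hU : IsOpen U) (hf : DifferentiableOn ℂ f U) (hi : InjOn f U) {z : ℂ}
    (hz : z ∈ U) : deriv f z ≠ 0 := by
  have h1 := (differentiableAt_invFunOn hU hf hi hz).hasDerivAt
  have h2 := (hf.differentiableAt (hU.mem_nhds hz)).hasDerivAt
  have h3 := h1.comp z h2
  have h4 : HasDerivAt (Function.invFunOn f U ∘ f) 1 z := by
    refine (hasDerivAt_id z).congr_of_eventuallyEq ?_
    filter_upwards [hU.mem_nhds hz] with x hx
    exact hi.leftInvOn_invFunOn hx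
  intro h0
  rw [h0, mul_zero] at h3
  exact zero_ne_one (h3.unique h4)

end Univalent

/-! ### The Riemann mapping theorem -/

/-- Every nonvanishing holomorphic function on `O` has a holomorphic square root. -/
def HasSqrts (O : Set ℂ) : Prop :=
  ∀ f : ℂ → ℂ, DifferentiableOn ℂ f O → (∀ z ∈ O, f z ≠ 0) →
    ∃ S : ℂ → ℂ, DifferentiableOn ℂ S O ∧ ∀ z ∈ O, S z ^ 2 = f z

lemma hasSqrts_of_holeFree {O : Set ℂ} (hOo : IsOpen O) (hOc : IsConnected O) (hO : HoleFree O) :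
    HasSqrts O := by
  intro f hf h0
  obtain ⟨g, hg, he⟩ := exists_holomorphic_log hOo hOc hO hf h0
  refine ⟨fun z => Complex.exp (g z / 2), (hg.div_const 2).cexp, fun z hz => ?_⟩
  rw [← Complex.exp_nat_mul, ← he z hz]
  congr 1
  push_cast
  ring

/-- A domain with square roots, other than the plane, carries a bounded univalent function without
zeros that tends to zero at infinity. -/
lemma exists_bounded_univalent {O : Set ℂ} (hOo : IsOpen O) (hne : O.Nonempty) (hO : O ≠ univ)
    (hs : HasSqrts O) : ∃ χ : ℂ → ℂ, DifferentiableOn ℂ χ O ∧ InjOn χ O ∧ (∀ z ∈ O, χ z ≠ 0) ∧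
      (∃ B, ∀ z ∈ O, ‖χ z‖ ≤ B) ∧ ∀ ε > 0, ∃ M : ℝ, ∀ z ∈ O, M < ‖z‖ → ‖χ z‖ < ε := by
  obtain ⟨a, ha⟩ := (ne_univ_iff_exists_notMem O).1 hO
  obtain ⟨S, hS, hSq⟩ := hs (fun z => z - a) (by fun_prop)
    fun z hz h => ha (sub_eq_zero.1 h ▸ hz)
  have hinj' : ∀ z ∈ O, ∀ w ∈ O, S z ^ 2 = S w ^ 2 → z = w := fun z hz w hw h => by
    rw [hSq z hz, hSq w hw] at h
    exact sub_left_injective h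
  have hSi : InjOn S O := fun z hz w hw h => hinj' z hz w hw (by rw [h])
  have hS0 : ∀ z ∈ O, S z ≠ 0 := fun z hz h => by
    have := hSq z hz
    rw [h] at this
    refine ha ?_
    have : z = a := by linear_combination -this
    rwa [← this]
  obtain ⟨z₀, hz₀⟩ := hne
  obtain ⟨ρ, hρ, hρO⟩ := Metric.isOpen_iff.1 (isOpen_image_of_injOn hOo hS hSi) (S z₀)
    (mem_image_of_mem S hz₀)
  -- A branch of `√(z - a)` never takes both a value and its negative. Its image contains a disc
  -- about `S z₀`, so it omits the reflected disc about `-S z₀`, and `1 / (S + S z₀)` is bounded.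
  have hlow : ∀ z ∈ O, ρ ≤ ‖S z + S z₀‖ := by
    intro z hz
    by_contra hcon
    have : -S z ∈ Metric.ball (S z₀) ρ := by
      rw [Metric.mem_ball, dist_eq_norm, ← norm_neg]
      simpa [add_comm] using hcon
    obtain ⟨w, hw, hwz⟩ := hρO this
    have : w = z := hinj' w hw z hz (by rw [hwz]; ring)
    rw [this] at hwz
    exact hS0 z hz (by linear_combination hwz / 2)
  have hden : ∀ z ∈ O, S z + S z₀ ≠ 0 := fun z hz h => by
    have := hlow z hz
    rw [h, norm_zero] at this
    linarith
  refine ⟨fun z => (S z + S z₀)⁻¹, (hS.add_const _).inv hden, ?_, fun z hz => inv_ne_zero (hden z hz),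
    ⟨ρ⁻¹, fun z hz => ?_⟩, fun ε hε => ?_⟩
  · intro z hz w hw h
    exact hSi hz hw (add_right_cancel (inv_injective h))
  · rw [norm_inv]
    exact inv_anti₀ hρ (hlow z hz)
  · refine ⟨(ε⁻¹ + ‖S z₀‖) ^ 2 + ‖a‖, fun z hz hzM => ?_⟩
    have h1 : (ε⁻¹ + ‖S z₀‖) ^ 2 < ‖S z‖ ^ 2 := by
      rw [← norm_pow, hSq z hz]
      linarith [norm_sub_norm_le z a]
    have h2 : ε⁻¹ + ‖S z₀‖ < ‖S z‖ := lt_of_pow_lt_pow_left₀ 2 (norm_nonneg _) h1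
    have h3 : ε⁻¹ < ‖S z + S z₀‖ := by
      have := norm_sub_le_norm_add (S z) (S z₀)
      linarith
    rw [norm_inv]
    exact inv_lt_of_inv_lt₀ hε h3

/-- Pointwise limits along an ultrafilter of uniformly bounded holomorphic functions are locally
uniform. -/
lemma exists_tendstoLocallyUniformlyOn {O : Set ℂ} (hOo : IsOpen O) {ι : Type*}
    (l : Ultrafilter ι) {F : ι → ℂ → ℂ} (hF : ∀ n, DifferentiableOn ℂ (F n) O)
    (hb : ∀ n, ∀ z ∈ O, ‖F n z‖ ≤ 1) :
    ∃ f : ℂ → ℂ, TendstoLocallyUniformlyOn F f l O := by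
  have hlim : ∀ z ∈ O, ∃ w, Tendsto (fun n => F n z) l (𝓝 w) := by
    intro z hz
    obtain ⟨w, -, hw⟩ := (isCompact_closedBall (0 : ℂ) 1).ultrafilter_le_nhds
      (l.map fun n => F n z) (by
        rw [Ultrafilter.coe_map, le_principal_iff, mem_map]
        exact Eventually.of_forall fun n => by simpa using hb n z hz)
    exact ⟨w, hw⟩
  choose! f hf using hlim
  refine ⟨f, Metric.tendstoLocallyUniformlyOn_iff.2 fun ε hε x hx => ?_⟩
  obtain ⟨r, hr, hrO⟩ := Metric.isOpen_iff.1 hOo x hx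
  -- By the Schwarz lemma the family is equi-Lipschitz near `x`, with `2` bounding the distance
  -- between two values; this upgrades pointwise to locally uniform convergence.
  have hlip : ∀ n, ∀ y ∈ Metric.ball x r, dist (F n y) (F n x) ≤ 2 / r * dist y x := by
    intro n y hy
    refine Complex.dist_le_div_mul_dist_of_mapsTo_ball ((hF n).mono hrO) (fun z hz => ?_) hy
    rw [Metric.mem_closedBall]
    refine (dist_le_norm_add_norm _ _).trans ?_
    linarith [hb n z (hrO hz), hb n x hx]
  have hlip' : ∀ y ∈ Metric.ball x r, dist (f y) (f x) ≤ 2 / r * dist y x := fun y hy =>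
    le_of_tendsto ((hf y (hrO hy)).dist (hf x hx)) (Eventually.of_forall fun n => hlip n y hy)
  set η := min r (ε * r / 6)
  have hη : 0 < η := lt_min hr (by positivity)
  refine ⟨Metric.ball x η, mem_nhdsWithin_of_mem_nhds (Metric.ball_mem_nhds x hη), ?_⟩
  filter_upwards [(hf x hx) (Metric.ball_mem_nhds (f x) (by positivity : (0 : ℝ) < ε / 3))]
    with n hn y hy
  have hyr : y ∈ Metric.ball x r := Metric.ball_subset_ball (min_le_left _ _) hy
  have h1 : 2 / r * dist y x < ε / 3 := by
    have : dist y x < ε * r / 6 := (Metric.mem_ball.1 hy).trans_le (min_le_right _ _)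
    calc 2 / r * dist y x < 2 / r * (ε * r / 6) := by gcongr
      _ = ε / 3 := by field_simp; ring
  have h2 := hlip n y hyr
  have h3 := hlip' y hyr
  have h4 : dist (F n x) (f x) < ε / 3 := hn
  calc dist (f y) (F n y) ≤ dist (f y) (f x) + dist (f x) (F n x) + dist (F n x) (F n y) :=
        dist_triangle4 _ _ _ _
    _ < ε := by rw [dist_comm (f x), dist_comm (F n x) (F n y)]; linarith

/-- **Hurwitz's theorem**: a nonconstant locally uniform limit of injective holomorphic functions is
injective. -/
lemma injOn_of_tendstoLocallyUniformlyOn {O : Set ℂ} (hOo : IsOpen O) (hOc : IsPreconnected O)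
    {ι : Type*} {l : Filter ι} [l.NeBot] {F : ι → ℂ → ℂ} {f : ℂ → ℂ}
    (hF : ∀ n, DifferentiableOn ℂ (F n) O) (hi : ∀ n, InjOn (F n) O)
    (hlim : TendstoLocallyUniformlyOn F f l O) (hnc : ∃ z ∈ O, ∃ w ∈ O, f z ≠ f w) :
    InjOn f O := by
  have hf : DifferentiableOn ℂ f O := hlim.differentiableOn (Eventually.of_forall hF) hOo
  intro a ha b hb hab
  by_contra hne
  have hev : ∀ᶠ x in 𝓝[≠] b, f x - f b ≠ 0 := by
    have han : AnalyticAt ℂ (fun x => f x - f b) b :=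
      (hf.analyticAt (hOo.mem_nhds hb)).sub analyticAt_const
    refine han.eventually_eq_zero_or_eventually_ne_zero.resolve_left fun h => ?_
    have := ((hf.analyticOnNhd hOo).sub analyticOnNhd_const
      ).eqOn_zero_of_preconnected_of_eventuallyEq_zero hOc hb h
    obtain ⟨z, hz, w, hw, hzw⟩ := hnc
    exact hzw ((sub_eq_zero.1 (this hz)).trans (sub_eq_zero.1 (this hw)).symm)
  rw [eventually_nhdsWithin_iff] at hev
  obtain ⟨r, hr, hrs⟩ := Metric.nhds_basis_closedBall.mem_iff.1
    (inter_mem (inter_mem hev (hOo.mem_nhds hb)) (isOpen_ne.mem_nhds (Ne.symm hne) : {a}ᶜ ∈ 𝓝 b))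
  have hsphere : ∀ x ∈ Metric.sphere b r, f x - f b ≠ 0 := fun x hx =>
    (hrs (Metric.sphere_subset_closedBall hx)).1.1 fun h => by
      rw [mem_singleton_iff.1 h, Metric.mem_sphere, dist_self] at hx
      exact hr.ne hx
  have hsO : Metric.sphere b r ⊆ O := fun x hx => (hrs (Metric.sphere_subset_closedBall hx)).1.2
  obtain ⟨x₀, hx₀, hmin⟩ := (isCompact_sphere b r).exists_isMinOn
    (NormedSpace.sphere_nonempty.2 hr.le) ((hf.continuousOn.mono hsO).sub continuousOn_const).norm
  set ε := ‖f x₀ - f b‖ with hε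
  have hε0 : 0 < ε := norm_pos_iff.2 (hsphere x₀ hx₀)
  have hunif := (tendstoLocallyUniformlyOn_iff_forall_isCompact hOo).1 hlim _ hsO (isCompact_sphere b r)
  have e1 := Metric.tendstoUniformlyOn_iff.1 hunif (ε / 4) (by positivity)
  have e2 : ∀ᶠ n in l, dist (F n a) (f a) < ε / 4 :=
    (hlim.tendsto_at ha) (Metric.ball_mem_nhds _ (by positivity))
  have e3 : ∀ᶠ n in l, dist (F n b) (f b) < ε / 4 :=
    (hlim.tendsto_at hb) (Metric.ball_mem_nhds _ (by positivity))
  obtain ⟨n, h1, h2, h3⟩ := (e1.and (e2.and e3)).exists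
  -- Since `a` is outside the disc, injectivity makes `F n - F n a` zero-free there. On the circle
  -- it is at least `ε - ε / 4 - ε / 4` in modulus, so the maximum principle for its reciprocal
  -- gives `ε / 2` at `b` as well. But both `F n a` and `F n b` are within `ε / 4` of `f b`.
  have hnv : ∀ x ∈ Metric.closedBall b r, F n x - F n a ≠ 0 := fun x hx h0 =>
    (hrs hx).2 (hi n (hrs hx).1.2 ha (sub_eq_zero.1 h0))
  have hbd := Complex.norm_le_of_forall_mem_frontier_norm_le (f := fun x => (F n x - F n a)⁻¹)
    (U := Metric.ball b r) Metric.isBounded_ball (by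
      refine DifferentiableOn.diffContOnCl ?_
      rw [closure_ball b hr.ne']
      exact DifferentiableOn.inv (((hF n).mono fun x hx => (hrs hx).1.2).sub_const _) hnv)
    (C := (ε / 2)⁻¹) (by
      rw [frontier_ball b hr.ne']
      intro x hx
      rw [norm_inv]
      refine inv_anti₀ (by positivity) ?_
      have h4 : ε ≤ ‖f x - f b‖ := hmin hx
      have h5 := h1 x hx
      rw [dist_eq_norm] at h5
      rw [dist_eq_norm, hab] at h2
      have : f x - f b = (f x - F n x) + (F n x - F n a) + (F n a - f b) := by ring
      rw [this] at h4
      have := norm_add₃_le (a := f x - F n x) (b := F n x - F n a) (c := F n a - f b)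
      linarith)
    (subset_closure (Metric.mem_ball_self hr))
  rw [norm_inv] at hbd
  have h6 : ε / 2 ≤ ‖F n b - F n a‖ := by
    refine (inv_le_inv₀ (norm_pos_iff.2 (hnv b (Metric.mem_closedBall_self hr.le)))
      (by positivity)).1 hbd
  rw [dist_eq_norm] at h2 h3
  rw [hab] at h2
  have : F n b - F n a = (F n b - f b) - (F n a - f b) := by ring
  rw [this] at h6
  have := norm_sub_le (F n b - f b) (F n a - f b)
  linarith

/-- The disc automorphism `w ↦ (w - a) / (1 - ā w)`. -/
noncomputable def mobius (a w : ℂ) : ℂ := (w - a) / (1 - (starRingEnd ℂ) a * w)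

lemma mobius_den_ne {a w : ℂ} (ha : ‖a‖ < 1) (hw : ‖w‖ < 1) : 1 - (starRingEnd ℂ) a * w ≠ 0 := by
  intro h
  have h1 : ‖(starRingEnd ℂ) a * w‖ < 1 := by
    rw [norm_mul, RCLike.norm_conj]
    nlinarith [norm_nonneg a, norm_nonneg w]
  rw [← sub_eq_zero.1 h, norm_one] at h1
  exact lt_irrefl _ h1

lemma norm_mobius_lt {a w : ℂ} (ha : ‖a‖ < 1) (hw : ‖w‖ < 1) : ‖mobius a w‖ < 1 := by
  have hd := mobius_den_ne ha hw
  rw [mobius, norm_div, div_lt_one (norm_pos_iff.2 hd)]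
  refine lt_of_pow_lt_pow_left₀ 2 (norm_nonneg _) ?_
  have ha' : a.re ^ 2 + a.im ^ 2 < 1 := by
    have := Complex.sq_norm a
    rw [Complex.normSq_apply] at this
    nlinarith [norm_nonneg a]
  have hw' : w.re ^ 2 + w.im ^ 2 < 1 := by
    have := Complex.sq_norm w
    rw [Complex.normSq_apply] at this
    nlinarith [norm_nonneg w]
  rw [Complex.sq_norm, Complex.sq_norm, Complex.normSq_apply, Complex.normSq_apply]
  simp only [Complex.sub_re, Complex.sub_im, Complex.one_re, Complex.one_im, Complex.mul_re,
    Complex.mul_im, Complex.conj_re, Complex.conj_im]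
  -- This is the identity `|1 - ā w|² - |w - a|² = (1 - |a|²)(1 - |w|²)`.
  nlinarith [mul_pos (sub_pos.2 ha') (sub_pos.2 hw')]

lemma mobius_injOn {a : ℂ} (ha : ‖a‖ < 1) {w₁ w₂ : ℂ} (h₁ : ‖w₁‖ < 1) (h₂ : ‖w₂‖ < 1)
    (h : mobius a w₁ = mobius a w₂) : w₁ = w₂ := by
  rw [mobius, mobius, div_eq_div_iff (mobius_den_ne ha h₁) (mobius_den_ne ha h₂)] at h
  have hna : 1 - (starRingEnd ℂ) a * a ≠ 0 := mobius_den_ne ha ha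
  refine sub_eq_zero.1 ((mul_eq_zero.1 (?_ : (1 - (starRingEnd ℂ) a * a) * (w₁ - w₂) = 0)).resolve_left hna)
  linear_combination h

lemma hasDerivAt_mobius {a w : ℂ} (ha : ‖a‖ < 1) (hw : ‖w‖ < 1) :
    HasDerivAt (mobius a) ((1 - (starRingEnd ℂ) a * a) / (1 - (starRingEnd ℂ) a * w) ^ 2) w := by
  have h1 : HasDerivAt (fun w => 1 - (starRingEnd ℂ) a * w) (-((starRingEnd ℂ) a * 1)) w :=
    ((hasDerivAt_id w).const_mul _).const_sub 1
  refine (((hasDerivAt_id w).sub_const a).div h1 (mobius_den_ne ha hw)).congr_deriv ?_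
  congr 1
  simp only [id]
  ring

/-- Injective holomorphic maps of `O` into the unit disc that take the point `p` to `0`. -/
def univalentMaps (O : Set ℂ) (p : ℂ) : Set (ℂ → ℂ) :=
  {ψ | DifferentiableOn ℂ ψ O ∧ InjOn ψ O ∧ (∀ z ∈ O, ‖ψ z‖ < 1) ∧ ψ p = 0}

lemma univalentMaps_nonempty {O : Set ℂ} (hOo : IsOpen O) {p : ℂ} (hp : p ∈ O) (hO : O ≠ univ)
    (hs : HasSqrts O) : (univalentMaps O p).Nonempty := by
  obtain ⟨χ, hχ, hi, -, ⟨B, hB⟩, -⟩ := exists_bounded_univalent hOo ⟨p, hp⟩ hO hs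
  have hB0 : 0 ≤ B := (norm_nonneg _).trans (hB p hp)
  have hc : ((2 * B + 1 : ℝ) : ℂ) ≠ 0 := Complex.ofReal_ne_zero.2 (by positivity)
  refine ⟨fun z => (χ z - χ p) / ((2 * B + 1 : ℝ) : ℂ), (hχ.sub_const _).div_const _,
    fun z hz w hw h => hi hz hw ?_, fun z hz => ?_, by simp⟩
  · have := (div_left_inj' hc).1 h
    exact sub_left_injective this
  · rw [norm_div, Complex.norm_real, Real.norm_of_nonneg (by positivity),
      div_lt_one (by positivity)]
    linarith [norm_sub_le (χ z) (χ p), hB z hz, hB p hp]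

/-- Cauchy's estimate bounds the derivatives at `p`, and a maximising sequence converges along an
ultrafilter. The limit has nonzero derivative at `p`, hence is not constant; Hurwitz then gives
injectivity and the maximum principle gives values in the open disc. -/
lemma exists_isMaxOn_univalentMaps {O : Set ℂ} (hOo : IsOpen O) (hOc : IsPreconnected O) {p : ℂ}
    (hp : p ∈ O) (hne : (univalentMaps O p).Nonempty) :
    ∃ ψ ∈ univalentMaps O p, ∀ ψ' ∈ univalentMaps O p, ‖deriv ψ' p‖ ≤ ‖deriv ψ p‖ := by
  set T := (fun ψ : ℂ → ℂ => ‖deriv ψ p‖) '' univalentMaps O p with hT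
  obtain ⟨r, hr, hrO⟩ := Metric.isOpen_iff.1 hOo p hp
  have hbdd : BddAbove T := by
    refine ⟨1 / r, ?_⟩
    rintro _ ⟨ψ, ⟨hd, -, hb, h0⟩, rfl⟩
    refine Complex.norm_deriv_le_div_of_mapsTo_ball (hd.mono hrO) (fun z hz => ?_) hr
    rw [h0]
    simpa using (hb z (hrO hz)).le
  obtain ⟨u, -, hu, huT⟩ := exists_seq_tendsto_sSup (hne.image _) hbdd
  choose F hFm hFu using huT
  set l : Ultrafilter ℕ := hyperfilter ℕ
  have hlat : (l : Filter ℕ) ≤ atTop := Nat.hyperfilter_le_atTop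
  obtain ⟨ψ, hψ⟩ := exists_tendstoLocallyUniformlyOn hOo l (fun n => (hFm n).1)
    fun n z hz => ((hFm n).2.2.1 z hz).le
  have hFd : ∀ᶠ n in (l : Filter ℕ), DifferentiableOn ℂ (F n) O :=
    Eventually.of_forall fun n => (hFm n).1
  have hψd : DifferentiableOn ℂ ψ O := hψ.differentiableOn hFd hOo
  have hder : ‖deriv ψ p‖ = sSup T := by
    have h1 := ((hψ.deriv hFd hOo).tendsto_at hp).norm
    refine tendsto_nhds_unique h1 ?_
    have : (fun n => ‖(deriv ∘ F) n p‖) = u := funext hFu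
    rw [this]
    exact hu.mono_left hlat
  have hle : ∀ ψ' ∈ univalentMaps O p, ‖deriv ψ' p‖ ≤ ‖deriv ψ p‖ := fun ψ' h' => by
    rw [hder]
    exact le_csSup hbdd ⟨ψ', h', rfl⟩
  have hpos : deriv ψ p ≠ 0 := by
    obtain ⟨ψ', h'⟩ := hne
    have h1 := norm_pos_iff.2 (deriv_ne_zero_of_injOn hOo h'.1 h'.2.1 hp)
    exact norm_pos_iff.1 (h1.trans_le (hle ψ' h'))
  have hnc : ∀ c, ¬ ∀ z ∈ O, ψ z = c := by
    intro c hc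
    refine hpos ?_
    have : ψ =ᶠ[𝓝 p] fun _ => c := by
      filter_upwards [hOo.mem_nhds hp] with z hz using hc z hz
    rw [this.deriv_eq, deriv_const]
  have hb1 : ∀ z ∈ O, ‖ψ z‖ ≤ 1 := fun z hz =>
    le_of_tendsto (hψ.tendsto_at hz).norm (Eventually.of_forall fun n => ((hFm n).2.2.1 z hz).le)
  refine ⟨ψ, ⟨hψd, ?_, fun z hz => ?_, ?_⟩, hle⟩
  · refine injOn_of_tendstoLocallyUniformlyOn hOo hOc (fun n => (hFm n).1) (fun n => (hFm n).2.1) hψ ?_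
    by_contra! hcon
    exact hnc (ψ p) fun z hz => hcon z hz p hp
  · refine lt_of_le_of_ne (hb1 z hz) fun h => ?_
    have := Complex.eqOn_of_isPreconnected_of_isMaxOn_norm hOc hOo hψd hz
      (fun w hw => by simpa [h] using hb1 w hw)
    exact hnc _ this
  · refine tendsto_nhds_unique (hψ.tendsto_at hp) ?_
    simp only [fun n => (hFm n).2.2.2]
    exact tendsto_const_nhds

/-- The **Riemann mapping theorem** for a proper subdomain of the plane with holomorphic square
roots. -/
theorem exists_riemann_map {O : Set ℂ} (hOo : IsOpen O) (hOc : IsConnected O) (hO : O ≠ univ)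
    (hs : HasSqrts O) : ∃ ψ : ℂ → ℂ, DifferentiableOn ℂ ψ O ∧ BijOn ψ O (Metric.ball 0 1) := by
  obtain ⟨p, hp⟩ := hOc.nonempty
  obtain ⟨ψ, ⟨hd, hi, hb, h0⟩, hmax⟩ := exists_isMaxOn_univalentMaps hOo hOc.isPreconnected hp
    (univalentMaps_nonempty hOo hp hO hs)
  refine ⟨ψ, hd, fun z hz => by simpa using hb z hz, hi, fun a ha => ?_⟩
  by_contra hcon
  have ha1 : ‖a‖ < 1 := by simpa using ha
  have haψ : ∀ z ∈ O, ψ z ≠ a := fun z hz h => hcon ⟨z, hz, h⟩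
  set T : ℂ → ℂ := fun z => mobius a (ψ z) with hT
  have hTder : ∀ z ∈ O, HasDerivAt T
      ((1 - (starRingEnd ℂ) a * a) / (1 - (starRingEnd ℂ) a * ψ z) ^ 2 * deriv ψ z) z :=
    fun z hz => (hasDerivAt_mobius ha1 (hb z hz)).comp z
      (hd.differentiableAt (hOo.mem_nhds hz)).hasDerivAt
  have hTd : DifferentiableOn ℂ T O := fun z hz =>
    (hTder z hz).differentiableAt.differentiableWithinAt
  -- Koebe's square-root trick: if `a` is omitted, the disc automorphism carries `ψ` to a zero-free
  -- map. Its square root, renormalised to vanish at `p`, has a larger derivative there.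
  obtain ⟨S, hS, hSq⟩ := hs T hTd fun z hz =>
    div_ne_zero (sub_ne_zero.2 (haψ z hz)) (mobius_den_ne ha1 (hb z hz))
  have hS1 : ∀ z ∈ O, ‖S z‖ < 1 := fun z hz => by
    have h1 : ‖S z‖ ^ 2 < 1 := by
      rw [← norm_pow, hSq z hz]
      exact norm_mobius_lt ha1 (hb z hz)
    exact (sq_lt_one_iff₀ (norm_nonneg _)).1 h1
  set s := S p with hs'
  have hs1 : ‖s‖ < 1 := hS1 p hp
  have hsq : s ^ 2 = -a := by
    rw [hSq p hp]
    simp [hT, mobius, h0]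
  have ha0 : a ≠ 0 := fun h => haψ p hp (by rw [h0, h])
  have hs0 : s ≠ 0 := by
    intro h
    rw [h] at hsq
    apply ha0
    linear_combination hsq
  have hSder : HasDerivAt S (deriv S p) p :=
    (hS.differentiableAt (hOo.mem_nhds hp)).hasDerivAt
  have hmem : (fun z => mobius s (S z)) ∈ univalentMaps O p := by
    refine ⟨fun z hz => ?_, fun z hz w hw h => ?_, fun z hz => norm_mobius_lt hs1 (hS1 z hz), ?_⟩
    · exact ((hasDerivAt_mobius hs1 (hS1 z hz)).differentiableAt.comp z
        (hS.differentiableAt (hOo.mem_nhds hz))).differentiableWithinAt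
    · have h1 := mobius_injOn hs1 (hS1 z hz) (hS1 w hw) h
      refine hi hz hw (mobius_injOn ha1 (hb z hz) (hb w hw) ?_)
      change T z = T w
      rw [← hSq z hz, ← hSq w hw, h1]
    · simp [mobius, ← hs']
  have hle := hmax _ hmem
  have hd2 : deriv (fun z => mobius s (S z)) p
      = (1 - (starRingEnd ℂ) s * s) / (1 - (starRingEnd ℂ) s * s) ^ 2 * deriv S p :=
    ((hasDerivAt_mobius hs1 (hS1 p hp)).comp p hSder).deriv
  have hd1 : 2 * s * deriv S p = (1 - (starRingEnd ℂ) a * a) * deriv ψ p := by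
    have h1 : HasDerivAt (fun z => S z ^ 2) (2 * s * deriv S p) p := by
      simpa using hSder.fun_pow 2
    have h2 : HasDerivAt (fun z => S z ^ 2) ((1 - (starRingEnd ℂ) a * a) * deriv ψ p) p := by
      have := hTder p hp
      rw [h0] at this
      simp only [mul_zero, sub_zero, one_pow, div_one] at this
      refine this.congr_of_eventuallyEq ?_
      filter_upwards [hOo.mem_nhds hp] with z hz using hSq z hz
    exact h1.unique h2
  have hψ0 : 0 < ‖deriv ψ p‖ := norm_pos_iff.2 (deriv_ne_zero_of_injOn hOo hd hi hp)
  have hconj : ∀ x : ℂ, (1 : ℂ) - (starRingEnd ℂ) x * x = ((1 - ‖x‖ ^ 2 : ℝ) : ℂ) := fun x => by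
    rw [Complex.conj_mul']; push_cast; ring
  set m := ‖s‖ with hm
  have hm0 : 0 < m := norm_pos_iff.2 hs0
  have ham : ‖a‖ = m ^ 2 := by rw [hm, ← norm_pow, hsq, norm_neg]
  have hm2 : 0 < 1 - m ^ 2 := by nlinarith
  have n1 := congrArg norm hd1
  rw [hconj, norm_mul, norm_mul, norm_mul, Complex.norm_real, ham, Real.norm_eq_abs,
    abs_of_pos (by nlinarith : 0 < 1 - (m ^ 2) ^ 2)] at n1
  simp only [Complex.norm_ofNat] at n1
  rw [hd2, hconj, norm_mul, norm_div, norm_pow, Complex.norm_real, Real.norm_eq_abs,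
    abs_of_pos (by rw [← hm]; exact hm2), ← hm] at hle
  have h3 : ‖deriv S p‖ ≤ (1 - m ^ 2) * ‖deriv ψ p‖ := by
    have : (1 - m ^ 2) / (1 - m ^ 2) ^ 2 * ‖deriv S p‖ = ‖deriv S p‖ / (1 - m ^ 2) := by
      field_simp
    rw [this, div_le_iff₀ hm2] at hle
    linarith
  -- Cancelling `(1 - m²) |ψ'(p)| > 0` leaves `1 + m² ≤ 2m`, which contradicts `m < 1`.
  have h4 : (1 - (m ^ 2) ^ 2) * ‖deriv ψ p‖ ≤ 2 * m * ((1 - m ^ 2) * ‖deriv ψ p‖) := by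
    rw [← n1, ← hm]
    exact mul_le_mul_of_nonneg_left h3 (by positivity)
  have h5 : 0 < (1 - m ^ 2) * ‖deriv ψ p‖ := by positivity
  nlinarith [mul_pos h5 (by nlinarith [sq_pos_of_pos (sub_pos.2 hs1)] : (0 : ℝ) < (1 - m) ^ 2)]

/-! ### Positive harmonic functions with one boundary singularity -/

/-- The Poisson integral formula for the real part, on the circle of radius `r < 1`. -/
theorem circleAverage_poisson_re {G : ℂ → ℂ} (hG : DifferentiableOn ℂ G (Metric.ball 0 1))
    {w : ℂ} (hw : w ∈ Metric.ball (0 : ℂ) 1) {r : ℝ} (hr0 : 0 < r) (hr1 : r < 1) :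
    CircleIntegrable (fun ζ => ((ζ + w) / (ζ - w)).re * (G (r * ζ)).re) 0 1 ∧
    Real.circleAverage (fun ζ => ((ζ + w) / (ζ - w)).re * (G (r * ζ)).re) 0 1
      = (G (r * w)).re := by
  have hmaps : MapsTo (fun ζ : ℂ => (r : ℂ) * ζ) (Metric.closedBall 0 1) (Metric.ball 0 1) := by
    intro ζ hζ
    simp only [mem_closedBall_zero_iff, mem_ball_zero_iff, norm_mul, Complex.norm_real,
      Real.norm_eq_abs, abs_of_pos hr0] at hζ ⊢
    nlinarith [norm_nonneg ζ]
  have hd : DifferentiableOn ℂ (fun ζ : ℂ => G (r * ζ)) (Metric.closedBall 0 1) :=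
    hG.comp (by fun_prop) hmaps
  have hdc : DiffContOnCl ℂ (fun ζ : ℂ => G (r * ζ)) (Metric.ball 0 1) := by
    apply DifferentiableOn.diffContOnCl
    rwa [closure_ball _ one_ne_zero]
  have hker : ContinuousOn (fun ζ : ℂ => ((ζ + w) / (ζ - w)).re) (Metric.sphere 0 1) := by
    refine Complex.continuous_re.comp_continuousOn (ContinuousOn.div (by fun_prop) (by fun_prop) ?_)
    intro ζ hζ h
    rw [sub_eq_zero] at h
    subst h
    simp only [mem_sphere_zero_iff_norm, mem_ball_zero_iff] at hζ hw
    linarith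
  have hGc : ContinuousOn (fun ζ : ℂ => G (r * ζ)) (Metric.sphere 0 1) :=
    hd.continuousOn.mono Metric.sphere_subset_closedBall
  have hi : CircleIntegrable (fun ζ => ((ζ + w) / (ζ - w)).re • G (r * ζ)) 0 1 :=
    (hker.smul hGc).circleIntegrable zero_le_one
  have hi' : CircleIntegrable (fun ζ => ((ζ + w) / (ζ - w)).re * (G (r * ζ)).re) 0 1 := by
    refine ContinuousOn.circleIntegrable zero_le_one ?_
    exact hker.mul (Complex.continuous_re.comp_continuousOn hGc)
  refine ⟨hi', ?_⟩
  have h := hdc.circleAverage_re_herglotzRieszKernel_smul' hw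
  simp only [sub_zero] at h
  rw [← h]
  have h2 := Complex.reCLM.circleAverage_comp_comm hi
  simp only [Complex.reCLM_apply] at h2
  rw [← h2]
  congr 1
  funext ζ
  simp

theorem eq_const_of_re_eq_zero {h : ℂ → ℂ} (hd : DifferentiableOn ℂ h (Metric.ball 0 1))
    (hre : ∀ z ∈ Metric.ball (0 : ℂ) 1, (h z).re = 0) :
    ∃ w, ∀ z ∈ Metric.ball (0 : ℂ) 1, h z = w := by
  rcases (hd.analyticOnNhd Metric.isOpen_ball).is_constant_or_isOpen
    (convex_ball (0 : ℂ) 1).isPreconnected with h1 | h1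
  · exact h1
  · exfalso
    have ho := h1 _ subset_rfl Metric.isOpen_ball
    have h0 : h 0 ∈ h '' Metric.ball 0 1 := mem_image_of_mem _ (by simp)
    obtain ⟨ε, hε, hb⟩ := Metric.isOpen_iff.1 ho _ h0
    have hm : h 0 + (ε / 2 : ℝ) ∈ Metric.ball (h 0) ε := by
      simp only [Metric.mem_ball, dist_self_add_left, Complex.norm_real, Real.norm_eq_abs]
      rw [abs_of_pos] <;> linarith
    obtain ⟨z, hz, hz'⟩ := hb hm
    have := congrArg Complex.re hz'
    rw [hre z hz, Complex.add_re, hre 0 (by simp), Complex.ofReal_re] at this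
    linarith

/-- A positive harmonic function vanishing on the unit circle except at `1` is a multiple of the
Poisson kernel. -/
theorem re_eq_poisson {G : ℂ → ℂ} (hG : DifferentiableOn ℂ G (Metric.ball 0 1))
    (hpos : ∀ z ∈ Metric.ball (0 : ℂ) 1, 0 < (G z).re)
    (hbd : ∀ ζ ∈ Metric.sphere (0 : ℂ) 1, ζ ≠ 1 →
      Tendsto (fun t => (G t).re) (𝓝[Metric.ball 0 1] ζ) (𝓝 0))
    {w : ℂ} (hw : w ∈ Metric.ball (0 : ℂ) 1) :
    (G w).re = (G 0).re * ((1 + w) / (1 - w)).re := by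
  have h0 : (0 : ℂ) ∈ Metric.ball (0 : ℂ) 1 := by simp
  have hc := hpos 0 h0
  set c := (G 0).re with hcdef
  set p : ℂ → ℝ := fun ζ => ((ζ + w) / (ζ - w)).re with hp
  have hker : ContinuousOn p (Metric.sphere 0 1) := by
    refine Complex.continuous_re.comp_continuousOn (ContinuousOn.div (by fun_prop) (by fun_prop) ?_)
    intro ζ hζ h
    rw [sub_eq_zero] at h
    subst h
    simp only [mem_sphere_zero_iff_norm, mem_ball_zero_iff] at hζ hw
    linarith
  obtain ⟨M, hM⟩ := (isCompact_sphere (0 : ℂ) 1).exists_bound_of_continuousOn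
    (hker.sub (continuousOn_const (c := p 1)))
  have h1s : (1 : ℂ) ∈ Metric.sphere (0 : ℂ) 1 := by simp
  have hM0 : 0 ≤ M := (norm_nonneg _).trans (hM 1 h1s)
  have hrw : Tendsto (fun r : ℝ => (G (r * w)).re) (𝓝[<] 1) (𝓝 (G w).re) := by
    have h1 : ContinuousAt G w := (hG.differentiableAt (Metric.isOpen_ball.mem_nhds hw)).continuousAt
    have h2 : Tendsto (fun r : ℝ => (r : ℂ) * w) (𝓝[<] 1) (𝓝 w) := by
      have : Continuous (fun r : ℝ => (r : ℂ) * w) := by fun_prop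
      simpa using (this.tendsto 1).mono_left nhdsWithin_le_nhds
    exact (Complex.continuous_re.tendsto _).comp (h1.tendsto.comp h2)
  -- The positive densities `Re G (r ζ)` have mean `c` and, as `r → 1`, concentrate at `ζ = 1`. Near
  -- `1` the kernel is within `ε` of `p 1`; away from `1` the density is below `ε / (M + 1)` while
  -- the kernel differs from `p 1` by at most `M`. Hence the integrand is at most `ε Re G (r ζ) +
  -- ε`.
  have key : ∀ ε > 0, |(G w).re - p 1 * c| ≤ ε * (c + 1) := by
    intro ε hε
    obtain ⟨δ, hδ, hδ'⟩ := Metric.continuousWithinAt_iff.1 (hker 1 h1s) ε hε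
    have hK : IsCompact (Metric.sphere (0 : ℂ) 1 \ Metric.ball 1 δ) :=
      (isCompact_sphere _ _).diff Metric.isOpen_ball
    have hev : ∀ᶠ r : ℝ in 𝓝 1, ∀ ζ ∈ Metric.sphere (0 : ℂ) 1 \ Metric.ball 1 δ,
        (r : ℂ) * ζ ∈ Metric.ball (0 : ℂ) 1 → (G (r * ζ)).re < ε / (M + 1) := by
      refine hK.eventually_forall_of_forall_eventually ?_
      rintro ζ ⟨hζ, hζ'⟩
      have hne : ζ ≠ 1 := by
        rintro rfl
        exact hζ' (Metric.mem_ball_self hδ)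
      have h1 := (hbd ζ hζ hne).eventually (gt_mem_nhds (show 0 < ε / (M + 1) by positivity))
      rw [eventually_nhdsWithin_iff] at h1
      have hcont : Continuous (fun q : ℝ × ℂ => (q.1 : ℂ) * q.2) := by fun_prop
      have h2 := hcont.tendsto (1, ζ)
      simp only [Complex.ofReal_one, one_mul] at h2
      exact h2.eventually h1
    have hmain : ∀ᶠ r : ℝ in 𝓝[<] 1, |(G (r * w)).re - p 1 * c| ≤ ε * (c + 1) := by
      have hpos' : ∀ᶠ r : ℝ in 𝓝[<] 1, 0 < r :=
        nhdsWithin_le_nhds (lt_mem_nhds one_pos)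
      filter_upwards [hev.filter_mono nhdsWithin_le_nhds, hpos', self_mem_nhdsWithin]
        with r hr hr0 hr1
      have hr1 : r < 1 := hr1
      have hball : ∀ ζ ∈ Metric.sphere (0 : ℂ) 1, (r : ℂ) * ζ ∈ Metric.ball (0 : ℂ) 1 := by
        intro ζ hζ
        simp only [mem_sphere_zero_iff_norm, mem_ball_zero_iff, norm_mul, Complex.norm_real,
          Real.norm_eq_abs, abs_of_pos hr0] at hζ ⊢
        rw [hζ]; linarith
      obtain ⟨hi1, he1⟩ := circleAverage_poisson_re hG hw hr0 hr1
      obtain ⟨hi2', he2'⟩ := circleAverage_poisson_re hG h0 hr0 hr1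
      have hs : EqOn (fun ζ : ℂ => ((ζ + 0) / (ζ - 0)).re * (G (r * ζ)).re)
          (fun ζ : ℂ => (G (r * ζ)).re) (Metric.sphere 0 |1|) := by
        intro ζ hζ
        have : ζ ≠ 0 := by
          rintro rfl
          simp at hζ
        simp [this]
      have he2 : Real.circleAverage (fun ζ : ℂ => (G (r * ζ)).re) 0 1 = c := by
        rw [← Real.circleAverage_congr_sphere hs, he2']
        simp [hcdef]
      have hi2 : CircleIntegrable (fun ζ : ℂ => (G (r * ζ)).re) 0 1 := by
        refine ContinuousOn.circleIntegrable zero_le_one ?_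
        refine Complex.continuous_re.comp_continuousOn (hG.continuousOn.comp (by fun_prop) ?_)
        exact fun ζ hζ => hball ζ hζ
      have hdiff : (G (r * w)).re - p 1 * c
          = Real.circleAverage (fun ζ => p ζ * (G (r * ζ)).re - p 1 • (G (r * ζ)).re) 0 1 := by
        rw [Real.circleAverage_fun_sub hi1 (hi2.const_fun_smul (a := p 1)), he1,
          Real.circleAverage_fun_smul, he2, smul_eq_mul]
      have hiD : CircleIntegrable (fun ζ => p ζ * (G (r * ζ)).re - p 1 • (G (r * ζ)).re) 0 1 :=
        hi1.sub (hi2.const_fun_smul (a := p 1))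
      have hiE : CircleIntegrable (fun ζ => ε • (G (r * ζ)).re + ε) 0 1 :=
        (hi2.const_fun_smul (a := ε)).add (circleIntegrable_const ε 0 1)
      rw [hdiff]
      refine Real.abs_circleAverage_le_circleAverage_abs.trans ?_
      have hle : Real.circleAverage
          |fun ζ => p ζ * (G (r * ζ)).re - p 1 • (G (r * ζ)).re| 0 1
          ≤ Real.circleAverage (fun ζ => ε • (G (r * ζ)).re + ε) 0 1 := by
        refine Real.circleAverage_mono hiD.abs hiE ?_
        intro ζ hζ
        rw [abs_one] at hζ
        have hg := hpos _ (hball ζ hζ)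
        simp only [Pi.abs_apply, smul_eq_mul]
        rw [← sub_mul, abs_mul, abs_of_pos hg]
        by_cases hn : ζ ∈ Metric.ball 1 δ
        · have h3 := hδ' hζ hn
          rw [Real.dist_eq] at h3
          nlinarith
        · have h3 := hr ζ ⟨hζ, hn⟩ (hball ζ hζ)
          have h4 : |p ζ - p 1| ≤ M := hM ζ hζ
          rw [lt_div_iff₀ (by positivity)] at h3
          nlinarith [abs_nonneg (p ζ - p 1)]
      refine hle.trans (le_of_eq ?_)
      rw [Real.circleAverage_fun_add (hi2.const_fun_smul (a := ε)) (circleIntegrable_const ε 0 1),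
        Real.circleAverage_fun_smul, he2, Real.circleAverage_const, smul_eq_mul]
      ring
    exact le_of_tendsto ((hrw.sub_const _).abs) hmain
  have : |(G w).re - p 1 * c| ≤ 0 := by
    refine le_of_forall_pos_le_add fun ε hε => ?_
    have h2 := key (ε / (c + 1)) (by positivity)
    rw [div_mul_cancel₀ _ (by positivity)] at h2
    linarith
  have h3 := abs_eq_zero.1 (le_antisymm this (abs_nonneg _))
  have : (G w).re = p 1 * c := by linarith
  rw [this, mul_comm]

/-- The Poisson kernel at `1` is the real part of `(1 + z) / (1 - z)`. The difference has zero real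
part, hence is an imaginary constant by the open mapping theorem. -/
theorem eq_mul_add_of_re_pos {G : ℂ → ℂ} (hG : DifferentiableOn ℂ G (Metric.ball 0 1))
    (hpos : ∀ z ∈ Metric.ball (0 : ℂ) 1, 0 < (G z).re)
    (hbd : ∀ ζ ∈ Metric.sphere (0 : ℂ) 1, ζ ≠ 1 →
      Tendsto (fun t => (G t).re) (𝓝[Metric.ball 0 1] ζ) (𝓝 0)) :
    ∃ c θ : ℝ, 0 < c ∧ ∀ z ∈ Metric.ball (0 : ℂ) 1,
      G z = c * ((1 + z) / (1 - z)) + Complex.I * θ := by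
  have hne : ∀ z ∈ Metric.ball (0 : ℂ) 1, 1 - z ≠ 0 := by
    intro z hz h
    rw [sub_eq_zero] at h
    subst h
    simp at hz
  obtain ⟨w, hw⟩ := eq_const_of_re_eq_zero
    (h := fun z => G z - (G 0).re * ((1 + z) / (1 - z)))
    (hG.sub ((DifferentiableOn.div (by fun_prop) (by fun_prop) hne).const_mul _)) (by
      intro z hz
      rw [Complex.sub_re, Complex.re_ofReal_mul, re_eq_poisson hG hpos hbd hz, sub_self])
  refine ⟨(G 0).re, w.im, hpos 0 (by simp), fun z hz => ?_⟩
  have hw0 : w.re = 0 := by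
    have := hw 0 (by simp)
    rw [← this]; simp
  have hw' : w = Complex.I * w.im := by
    apply Complex.ext <;> simp [hw0]
  have := hw z hz
  rw [← hw', ← this]; ring

/-! ### The length-area estimate -/

-- For injective `F` the integral of `|F'|²` is the area of the image, finite as `F` is bounded;
-- moreover `|F'| ≤ 1 + |F'|²`.
open MeasureTheory in
theorem lintegral_enorm_deriv_ne_top {F : ℂ → ℂ} (hF : DifferentiableOn ℂ F (Metric.ball 0 1))
    (hinj : InjOn F (Metric.ball 0 1)) {B : ℝ} (hB : ∀ z ∈ Metric.ball (0 : ℂ) 1, ‖F z‖ ≤ B) :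
    ∫⁻ z in Metric.ball (0 : ℂ) 1, ‖deriv F z‖ₑ ≠ ⊤ := by
  have hder : ∀ x ∈ Metric.ball (0 : ℂ) 1, HasFDerivWithinAt F
      ((ContinuousLinearMap.toSpanSingleton ℂ (deriv F x)).restrictScalars ℝ)
      (Metric.ball 0 1) x := fun x hx =>
    ((hF.differentiableAt (Metric.isOpen_ball.mem_nhds hx)).hasDerivAt.hasFDerivAt.restrictScalars
      ℝ).hasFDerivWithinAt
  have h := lintegral_abs_det_fderiv_eq_addHaar_image volume measurableSet_ball hder hinj
  have hdet : ∀ x, ENNReal.ofReal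
      |((ContinuousLinearMap.toSpanSingleton ℂ (deriv F x)).restrictScalars ℝ).det|
      = ‖deriv F x‖ₑ ^ 2 := by
    intro x
    have : ((ContinuousLinearMap.toSpanSingleton ℂ (deriv F x)).restrictScalars ℝ).det
        = ‖deriv F x‖ ^ 2 := by
      simp [ContinuousLinearMap.det, LinearMap.det_restrictScalars, Algebra.norm_complex_apply,
        Complex.normSq_eq_norm_sq]
    rw [this, abs_of_nonneg (by positivity), ENNReal.ofReal_pow (norm_nonneg _), ofReal_norm]
  simp only [hdet] at h
  have hfin : volume (F '' Metric.ball 0 1) ≠ ⊤ := by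
    refine ne_top_of_le_ne_top (measure_closedBall_lt_top (x := (0 : ℂ)) (r := B)).ne
      (measure_mono ?_)
    rintro _ ⟨z, hz, rfl⟩
    simpa using hB z hz
  have hle : ∫⁻ z in Metric.ball (0 : ℂ) 1, ‖deriv F z‖ₑ
      ≤ ∫⁻ z in Metric.ball (0 : ℂ) 1, (1 + ‖deriv F z‖ₑ ^ 2) := by
    refine lintegral_mono fun z => ?_
    rcases le_total ‖deriv F z‖ₑ 1 with h1 | h1
    · exact h1.trans le_self_add
    · refine le_trans ?_ le_add_self
      rw [sq]
      exact le_mul_of_one_le_right' h1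
  refine ne_top_of_le_ne_top ?_ hle
  rw [lintegral_add_left measurable_const, h]
  simp only [lintegral_const, one_mul, Measure.restrict_apply MeasurableSet.univ, univ_inter]
  exact ENNReal.add_ne_top.2 ⟨measure_ball_lt_top.ne, hfin⟩

-- Absolute continuity of the integral: the annulus has area `π (1 - r²)`, which tends to `0`.
open MeasureTheory in
theorem eventually_lintegral_annulus_lt {g : ℂ → ENNReal}
    (hg : ∫⁻ z in Metric.ball (0 : ℂ) 1, g z ≠ ⊤) {η : ENNReal} (hη : η ≠ 0) :
    ∀ᶠ r : ℝ in 𝓝[<] 1, ∫⁻ z in Metric.ball (0 : ℂ) 1 \ Metric.closedBall 0 r, g z < η := by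
  obtain ⟨δ, hδ, h⟩ := exists_pos_setLIntegral_lt_of_measure_lt hg hη
  have hvol : Tendsto (fun r : ℝ => volume (Metric.ball (0 : ℂ) 1 \ Metric.closedBall 0 r))
      (𝓝[<] 1) (𝓝 0) := by
    have h1 : (fun r : ℝ => ENNReal.ofReal (1 - r ^ 2) * NNReal.pi) =ᶠ[𝓝[<] 1]
        fun r : ℝ => volume (Metric.ball (0 : ℂ) 1 \ Metric.closedBall 0 r) := by
      filter_upwards [self_mem_nhdsWithin,
        nhdsWithin_le_nhds (lt_mem_nhds (show (0 : ℝ) < 1 by norm_num))] with r hr hr0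
      have hr : r < 1 := hr
      rw [measure_sdiff (Metric.closedBall_subset_ball hr) measurableSet_closedBall.nullMeasurableSet
        measure_closedBall_lt_top.ne, Complex.volume_ball, Complex.volume_closedBall,
        ENNReal.ofReal_sub _ (by positivity), ENNReal.sub_mul (by simp), ENNReal.ofReal_pow hr0.le]
      simp
    refine Tendsto.congr' h1 ?_
    have h2 : Tendsto (fun r : ℝ => ENNReal.ofReal (1 - r ^ 2)) (𝓝[<] 1) (𝓝 0) := by
      have : Continuous fun r : ℝ => ENNReal.ofReal (1 - r ^ 2) :=
        ENNReal.continuous_ofReal.comp (by fun_prop)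
      simpa using (this.tendsto 1).mono_left nhdsWithin_le_nhds
    simpa using ENNReal.Tendsto.mul_const h2 (Or.inr (by simp : (NNReal.pi : ENNReal) ≠ ⊤))
  filter_upwards [hvol.eventually (gt_mem_nhds hδ)] with r hr
  have hsub : Metric.ball (0 : ℂ) 1 \ Metric.closedBall 0 r ⊆ Metric.ball (0 : ℂ) 1 := sdiff_subset
  have := h (Metric.ball (0 : ℂ) 1 \ Metric.closedBall 0 r)
    ((Measure.restrict_apply_le _ _).trans_lt hr)
  rwa [Measure.restrict_restrict (measurableSet_ball.diff measurableSet_closedBall),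
    inter_eq_self_of_subset_left hsub] at this

-- The polar Jacobian `s` is at least `1 / 2` on the annulus, whence the factor `2`.
open MeasureTheory in
theorem lintegral_polar_le {g : ℂ → ENNReal} (hg : Measurable g) {r : ℝ} (hr : 1 / 2 ≤ r) :
    ∫⁻ θ in Ioo (-Real.pi) Real.pi, ∫⁻ s in Ioo r 1, g (s * Complex.exp (θ * Complex.I))
      ≤ 2 * ∫⁻ z in Metric.ball (0 : ℂ) 1 \ Metric.closedBall 0 r, g z := by
  set A := Metric.ball (0 : ℂ) 1 \ Metric.closedBall 0 r with hA
  have hAm : MeasurableSet A := measurableSet_ball.diff measurableSet_closedBall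
  have hm : Measurable (fun p : ℝ × ℝ => g (p.1 * Complex.exp (p.2 * Complex.I))) :=
    hg.comp (by fun_prop)
  have hp := Complex.lintegral_comp_polarCoord_symm (A.indicator g)
  rw [lintegral_indicator hAm] at hp
  rw [← hp, ← lintegral_const_mul' _ _ (by simp), polarCoord_target]
  have h1 : ∫⁻ θ in Ioo (-Real.pi) Real.pi, ∫⁻ s in Ioo r 1, g (s * Complex.exp (θ * Complex.I))
      = ∫⁻ p in Ioo r 1 ×ˢ Ioo (-Real.pi) Real.pi, g (p.1 * Complex.exp (p.2 * Complex.I)) := by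
    rw [Measure.volume_eq_prod, ← Measure.prod_restrict, lintegral_prod_symm _ hm.aemeasurable]
  rw [h1]
  have h2 : ∀ p ∈ Ioo r 1 ×ˢ Ioo (-Real.pi) Real.pi,
      g (p.1 * Complex.exp (p.2 * Complex.I))
        ≤ 2 * (ENNReal.ofReal p.1 • A.indicator g (Complex.polarCoord.symm p)) := by
    rintro ⟨s, θ⟩ ⟨hs, hθ⟩
    simp only [mem_Ioo] at hs
    have he : Complex.polarCoord.symm (s, θ) = s * Complex.exp (θ * Complex.I) := by
      rw [Complex.polarCoord_symm_apply, Complex.exp_mul_I]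
      simp
    have hmem : (s : ℂ) * Complex.exp (θ * Complex.I) ∈ A := by
      rw [hA]
      have hs0 : 0 < s := by linarith
      simp only [Set.mem_sdiff, mem_ball_zero_iff, mem_closedBall_zero_iff, norm_mul,
        Complex.norm_exp_ofReal_mul_I, Complex.norm_real, Real.norm_eq_abs, abs_of_pos hs0, mul_one,
        not_le]
      exact ⟨hs.2, hs.1⟩
    rw [he, indicator_of_mem hmem, smul_eq_mul, ← mul_assoc]
    refine le_mul_of_one_le_left' ?_
    have : (2 : ENNReal) = ENNReal.ofReal 2 := by simp
    rw [this, ← ENNReal.ofReal_mul (by norm_num), ← ENNReal.ofReal_one]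
    exact ENNReal.ofReal_le_ofReal (by linarith [hs.1])
  refine (setLIntegral_mono' (measurableSet_Ioo.prod measurableSet_Ioo) h2).trans ?_
  refine lintegral_mono_set (prod_mono ?_ subset_rfl)
  intro s hs
  exact mem_Ioi.2 (by linarith [hs.1])

open MeasureTheory in
theorem enorm_le_add_lintegral_deriv {F : ℂ → ℂ} (hF : DifferentiableOn ℂ F (Metric.ball 0 1))
    {ω : ℂ} (hω : ‖ω‖ = 1) {r s : ℝ} (hr : 0 ≤ r) (hrs : r ≤ s) (hs : s < 1) :
    ‖F (r * ω)‖ₑ ≤ ‖F (s * ω)‖ₑ + ∫⁻ t in Ioo r 1, ‖deriv F (t * ω)‖ₑ := by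
  have hmem : ∀ t ∈ Icc r s, (t : ℂ) * ω ∈ Metric.ball (0 : ℂ) 1 := by
    intro t ht
    simp only [mem_ball_zero_iff, norm_mul, Complex.norm_real, Real.norm_eq_abs, hω, mul_one]
    rw [abs_of_nonneg (hr.trans ht.1)]
    exact ht.2.trans_lt hs
  have hline : ContDiff ℝ 1 (fun t : ℝ => (t : ℂ) * ω) := by
    exact (Complex.ofRealCLM.contDiff).mul contDiff_const
  have hcd : ContDiffOn ℝ 1 (fun t : ℝ => F (t * ω)) (Icc r s) := by
    have h1 : ContDiffOn ℂ 1 F (Metric.ball 0 1) := hF.contDiffOn Metric.isOpen_ball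
    exact (h1.restrict_scalars ℝ).comp hline.contDiffOn hmem
  have h := enorm_sub_le_lintegral_deriv_of_contDiffOn_Icc hcd hrs
  have hd : ∀ t ∈ Icc r s, ‖deriv (fun t : ℝ => F (t * ω)) t‖ₑ = ‖deriv F (t * ω)‖ₑ := by
    intro t ht
    have h1 := (hF.differentiableAt (Metric.isOpen_ball.mem_nhds (hmem t ht))).hasDerivAt
    have h2 : HasDerivAt (fun t : ℝ => (t : ℂ) * ω) ω t := by
      simpa using (Complex.ofRealCLM.hasDerivAt (x := t)).mul_const ω
    have h3 := HasDerivAt.scomp t h1 h2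
    have : deriv (fun t : ℝ => F (t * ω)) t = ω • deriv F (t * ω) := h3.deriv
    rw [this, enorm_smul, ← ofReal_norm, hω]
    simp
  rw [setLIntegral_congr_fun measurableSet_Icc hd] at h
  have h4 : ∫⁻ t in Icc r s, ‖deriv F (t * ω)‖ₑ ≤ ∫⁻ t in Ioo r 1, ‖deriv F (t * ω)‖ₑ := by
    rw [setLIntegral_congr (Ioo_ae_eq_Ico (a := r) (b := (1 : ℝ)))]
    exact lintegral_mono_set fun t ht => ⟨ht.1, ht.2.trans_lt hs⟩
  calc ‖F (r * ω)‖ₑ = ‖F (s * ω) - (F (s * ω) - F (r * ω))‖ₑ := by rw [sub_sub_cancel]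
    _ ≤ ‖F (s * ω)‖ₑ + ‖F (s * ω) - F (r * ω)‖ₑ := enorm_sub_le
    _ ≤ _ := by gcongr; exact h.trans h4

/-- If `F` is arbitrarily small along the diameter through `ω`, then `F (r ω) F (-r ω)` is
controlled by the length of the image of the ends of that diameter. -/
theorem enorm_mul_neg_le {F : ℂ → ℂ} (hF : DifferentiableOn ℂ F (Metric.ball 0 1))
    (h0 : ∀ z ∈ Metric.ball (0 : ℂ) 1, F z ≠ 0) {B : ℝ}
    (hB : ∀ z ∈ Metric.ball (0 : ℂ) 1, ‖F z‖ ≤ B) {ω : ℂ} (hω : ‖ω‖ = 1)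
    (hsmall : ∀ ε > 0, ∃ s : ℝ, |s| < 1 ∧ ‖F (s * ω)‖ < ε) {r : ℝ} (hr : 0 ≤ r) (hr1 : r < 1) :
    ‖F (r * ω) * F (-(r * ω))‖ₑ ≤
      ENNReal.ofReal B * ∫⁻ t in Ioo r 1, (‖deriv F (t * ω)‖ₑ + ‖deriv F (-(t * ω))‖ₑ) := by
  have hωb : ∀ t : ℝ, |t| < 1 → (t : ℂ) * ω ∈ Metric.ball (0 : ℂ) 1 := by
    intro t ht
    simpa [hω] using ht
  set u := ∫⁻ t in Ioo r 1, (‖deriv F (t * ω)‖ₑ + ‖deriv F (-(t * ω))‖ₑ) with hu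
  -- A point of the diameter where `|F| < ε₀` lies beyond radius `r`, at one of the two ends.
  -- Integrating `F'` from there bounds one factor of the product, and `B` bounds the other.
  obtain ⟨ε₀, hε₀, hmin⟩ : ∃ ε₀ > 0, ∀ z ∈ Metric.closedBall (0 : ℂ) r, ε₀ ≤ ‖F z‖ := by
    obtain ⟨z, hz, hzm⟩ := (isCompact_closedBall (0 : ℂ) r).exists_isMinOn
      (Metric.nonempty_closedBall.2 hr)
      (hF.continuousOn.mono (Metric.closedBall_subset_ball hr1)).norm
    exact ⟨‖F z‖, norm_pos_iff.2 (h0 z (Metric.closedBall_subset_ball hr1 hz)),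
      fun w hw => hzm hw⟩
  have key : ∀ ε : ℝ, 0 < ε → ε ≤ ε₀ →
      ‖F (r * ω) * F (-(r * ω))‖ₑ ≤ ENNReal.ofReal B * (ENNReal.ofReal ε + u) := by
    intro ε hε hεε
    obtain ⟨s, hs1, hs⟩ := hsmall ε hε
    have hrs : r < |s| := by
      by_contra! hle
      have := hmin (s * ω) (by simpa [hω] using hle)
      linarith
    have hrb : |r| < 1 := by rwa [abs_of_nonneg hr]
    have hb1 : ‖F (r * ω)‖ₑ ≤ ENNReal.ofReal B := by
      rw [← ofReal_norm]; exact ENNReal.ofReal_le_ofReal (hB _ (hωb r hrb))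
    have hb2 : ‖F (-(r * ω))‖ₑ ≤ ENNReal.ofReal B := by
      rw [← ofReal_norm]; refine ENNReal.ofReal_le_ofReal (hB _ ?_)
      simpa using hωb r hrb
    rw [enorm_mul]
    rcases le_total 0 s with h | h
    · rw [abs_of_nonneg h] at hrs hs1
      have h1 := enorm_le_add_lintegral_deriv hF hω hr hrs.le hs1
      have h2 : ‖F (r * ω)‖ₑ ≤ ENNReal.ofReal ε + u := by
        refine h1.trans (add_le_add ?_ ?_)
        · rw [← ofReal_norm]; exact ENNReal.ofReal_le_ofReal hs.le
        · exact MeasureTheory.lintegral_mono fun t => le_self_add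
      rw [mul_comm]
      gcongr
    · rw [abs_of_nonpos h] at hrs hs1
      have h1 := enorm_le_add_lintegral_deriv hF (ω := -ω) (by simpa using hω) hr hrs.le hs1
      simp only [mul_neg, Complex.ofReal_neg, neg_mul, neg_neg] at h1
      have h2 : ‖F (-(r * ω))‖ₑ ≤ ENNReal.ofReal ε + u := by
        refine h1.trans (add_le_add ?_ ?_)
        · rw [← ofReal_norm]; exact ENNReal.ofReal_le_ofReal hs.le
        · exact MeasureTheory.lintegral_mono fun t => le_add_self
      gcongr
  have hlim : Tendsto (fun ε : ℝ => ENNReal.ofReal B * (ENNReal.ofReal ε + u)) (𝓝[>] 0)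
      (𝓝 (ENNReal.ofReal B * (0 + u))) := by
    refine ENNReal.Tendsto.const_mul ?_ (Or.inr (by simp))
    refine Tendsto.add_const _ ?_
    simpa using (ENNReal.continuous_ofReal.tendsto 0).mono_left
      (nhdsWithin_le_nhds (s := Ioi (0 : ℝ)))
  rw [zero_add] at hlim
  refine ge_of_tendsto hlim ?_
  filter_upwards [Ioc_mem_nhdsGT hε₀] with ε hε
  exact key ε hε.1 hε.2

open MeasureTheory in
/-- A bounded nonvanishing univalent function on the disc is not small on connected sets joining
neighbourhoods of `1` and `-1`. -/
theorem false_of_small_near_antipodes {F : ℂ → ℂ} (hF : DifferentiableOn ℂ F (Metric.ball 0 1))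
    (hinj : InjOn F (Metric.ball 0 1)) (h0 : ∀ z ∈ Metric.ball (0 : ℂ) 1, F z ≠ 0) {B : ℝ}
    (hB : ∀ z ∈ Metric.ball (0 : ℂ) 1, ‖F z‖ ≤ B)
    (hT : ∀ ε > 0, ∀ U ∈ 𝓝 (1 : ℂ), ∀ V ∈ 𝓝 (-1 : ℂ), ∃ T ⊆ Metric.ball (0 : ℂ) 1,
      IsPreconnected T ∧ (T ∩ U).Nonempty ∧ (T ∩ V).Nonempty ∧ ∀ z ∈ T, ‖F z‖ < ε) : False := by
  have hsmall : ∀ ω : ℂ, ‖ω‖ = 1 → ω.im ≠ 0 → ∀ ε > 0, ∃ s : ℝ, |s| < 1 ∧ ‖F (s * ω)‖ < ε := by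
    intro ω hω him ε hε
    -- `ℓ` vanishes exactly on the line through `0` and `ω`, and equals `-(Im ω)²` at `1` and `(Im
    -- ω)²` at `-1`. A connected set joining small neighbourhoods of these points must cross the
    -- diameter.
    set ℓ : ℂ → ℝ := fun z => (z * (starRingEnd ℂ) ω).im * ω.im with hℓ
    have hℓc : Continuous ℓ := by
      rw [hℓ]; fun_prop
    have hU : {z | ℓ z < 0} ∈ 𝓝 (1 : ℂ) := by
      refine (isOpen_lt hℓc continuous_const).mem_nhds ?_
      simp only [hℓ, mem_ofPred_eq, one_mul, Complex.conj_im]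
      nlinarith [mul_self_pos.2 him]
    have hV : {z | 0 < ℓ z} ∈ 𝓝 (-1 : ℂ) := by
      refine (isOpen_lt continuous_const hℓc).mem_nhds ?_
      simp only [hℓ, mem_ofPred_eq, neg_mul, one_mul, Complex.neg_im, Complex.conj_im, neg_neg]
      exact mul_self_pos.2 him
    obtain ⟨T, hTb, hTc, ⟨p, hpT, hp⟩, ⟨q, hqT, hq⟩, hTs⟩ := hT ε hε _ hU _ hV
    obtain ⟨z, hzT, hz⟩ := hTc.intermediate_value hpT hqT hℓc.continuousOn
      (show (0 : ℝ) ∈ Icc (ℓ p) (ℓ q) from ⟨le_of_lt hp, le_of_lt hq⟩)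
    have hz' : (z * (starRingEnd ℂ) ω).im = 0 := by
      simpa [hℓ, him] using hz
    have hωω : (starRingEnd ℂ) ω * ω = 1 := by
      rw [mul_comm, Complex.mul_conj, Complex.normSq_eq_norm_sq, hω]; simp
    have hzs : (((z * (starRingEnd ℂ) ω).re : ℝ) : ℂ) * ω = z := by
      have : (((z * (starRingEnd ℂ) ω).re : ℝ) : ℂ) = z * (starRingEnd ℂ) ω := by
        apply Complex.ext <;> simp [-Complex.mul_im, -Complex.mul_re, hz']
      rw [this, mul_assoc, hωω, mul_one]
    refine ⟨(z * (starRingEnd ℂ) ω).re, ?_, ?_⟩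
    · have h1 := hTb hzT
      rw [← hzs] at h1
      simpa [-Complex.mul_re, hω] using h1
    · rw [hzs]; exact hTs z hzT
  have hFn : DifferentiableOn ℂ (fun z => F (-z)) (Metric.ball 0 1) :=
    hF.comp (by fun_prop) (fun z hz => by simpa using hz)
  have hfin1 := lintegral_enorm_deriv_ne_top hF hinj hB
  have hfin2 : ∫⁻ z in Metric.ball (0 : ℂ) 1, ‖deriv F (-z)‖ₑ ≠ ⊤ := by
    have h := lintegral_enorm_deriv_ne_top hFn (fun z hz w hw h => neg_injective
      (hinj (by simpa using hz) (by simpa using hw) h)) (fun z hz => hB _ (by simpa using hz))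
    simpa [deriv_comp_neg] using h
  have hmd : Measurable (fun z => ‖deriv F z‖ₑ) := (measurable_deriv F).enorm
  have hmd2 : Measurable (fun z => ‖deriv F (-z)‖ₑ) := hmd.comp measurable_neg
  have hfin : ∫⁻ z in Metric.ball (0 : ℂ) 1, (‖deriv F z‖ₑ + ‖deriv F (-z)‖ₑ) ≠ ⊤ := by
    rw [lintegral_add_left hmd]
    exact ENNReal.add_ne_top.2 ⟨hfin1, hfin2⟩
  -- By the mean value property `H 0` is the average of `F (r ω) F (-r ω)` over the circle. Up to
  -- constants this is at most the integral of `|F' z| + |F' (-z)|` over the annulus, which tends to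
  -- `0`, whereas `H 0 = F 0 ² ≠ 0`.
  set H : ℂ → ℂ := fun z => F z * F (-z) with hH
  have hHd : DifferentiableOn ℂ H (Metric.ball 0 1) := hF.mul hFn
  have hH0 : ‖H 0‖ₑ ≠ 0 := by
    simp [hH, h0 0 (by simp)]
  have hbound : ∀ r : ℝ, 1 / 2 ≤ r → r < 1 → ‖H 0‖ₑ ≤ ENNReal.ofReal B * (2 *
      ∫⁻ z in Metric.ball (0 : ℂ) 1 \ Metric.closedBall 0 r,
        (‖deriv F z‖ₑ + ‖deriv F (-z)‖ₑ)) := by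
    intro r hr hr1
    have hr0 : 0 ≤ r := by linarith
    have hdc : DiffContOnCl ℂ H (Metric.ball 0 |r|) := by
      apply DifferentiableOn.diffContOnCl
      refine hHd.mono (Metric.closure_ball_subset_closedBall.trans ?_)
      rw [abs_of_nonneg hr0]
      exact Metric.closedBall_subset_ball hr1
    have hmean := hdc.circleAverage
    rw [Real.circleAverage_eq_integral_add (-Real.pi)] at hmean
    have h1 : ∫ θ in (0 : ℝ)..2 * Real.pi, H (circleMap 0 r (θ + -Real.pi))
        = ∫ θ in Ioc (-Real.pi) Real.pi, H (circleMap 0 r θ) := by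
      rw [intervalIntegral.integral_comp_add_right (fun θ => H (circleMap 0 r θ))]
      rw [intervalIntegral.integral_of_le (by linarith [Real.pi_pos])]
      congr 3 <;> ring
    rw [h1] at hmean
    have h2 : ‖(2 * Real.pi)⁻¹‖ₑ ≤ 1 := by
      rw [← ofReal_norm, ← ENNReal.ofReal_one]
      refine ENNReal.ofReal_le_ofReal ?_
      rw [Real.norm_eq_abs, abs_of_nonneg (by positivity)]
      exact inv_le_one_of_one_le₀ (by linarith [Real.pi_gt_three])
    rw [← hmean, enorm_smul]
    refine (mul_le_mul' h2 (enorm_integral_le_lintegral_enorm _)).trans ?_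
    rw [one_mul, setLIntegral_congr (Ioo_ae_eq_Ioc (a := -Real.pi) (b := Real.pi)).symm]
    refine le_trans ?_ (mul_le_mul_right (lintegral_polar_le (hmd.add hmd2) hr) _)
    rw [← lintegral_const_mul' _ _ (by simp)]
    refine lintegral_mono_ae ?_
    have hne : ∀ᵐ θ : ℝ ∂volume.restrict (Ioo (-Real.pi) Real.pi), θ ≠ 0 :=
      ae_restrict_of_ae (by simp [ae_iff])
    filter_upwards [hne, ae_restrict_mem measurableSet_Ioo] with θ hθ0 hθ
    have hω : ‖Complex.exp (θ * Complex.I)‖ = 1 := Complex.norm_exp_ofReal_mul_I θ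
    have him : (Complex.exp (θ * Complex.I)).im ≠ 0 := by
      rw [Complex.exp_ofReal_mul_I_im]
      exact fun h => hθ0 ((Real.sin_eq_zero_iff_of_lt_of_lt hθ.1 hθ.2).1 h)
    have := enorm_mul_neg_le hF h0 hB hω (hsmall _ hω him) hr0 hr1
    simpa [hH, circleMap_zero] using this
  -- With this choice the bound reads `(2B + 1) η ≤ 2B η`, impossible for finite `η > 0`.
  set η : ENNReal := ‖H 0‖ₑ / (ENNReal.ofReal B * 2 + 1) with hη
  have hBt : ENNReal.ofReal B * 2 + 1 ≠ ⊤ := by finiteness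
  have hη0 : η ≠ 0 := ENNReal.div_ne_zero.2 ⟨hH0, hBt⟩
  have hhalf : ∀ᶠ r : ℝ in 𝓝[<] 1, r ∈ Ico (1 / 2 : ℝ) 1 := Ico_mem_nhdsLT (by norm_num)
  obtain ⟨r, hrη, hr, hr1⟩ := ((eventually_lintegral_annulus_lt hfin hη0).and hhalf).exists
  have h1 := hbound r hr hr1
  have h2 : ‖H 0‖ₑ ≤ (ENNReal.ofReal B * 2) * η := by
    refine h1.trans ?_
    rw [← mul_assoc]
    gcongr
  have hηt : η ≠ ⊤ := ENNReal.div_ne_top (by simp) (by simp)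
  have h3 : ‖H 0‖ₑ = (ENNReal.ofReal B * 2 + 1) * η := by
    rw [hη, ENNReal.mul_div_cancel (by simp) hBt]
  rw [h3, add_mul, one_mul] at h2
  have h4 : (ENNReal.ofReal B * 2) * η ≠ ⊤ := ENNReal.mul_ne_top (by finiteness) hηt
  have h5 := ENNReal.lt_add_right h4 hη0
  exact absurd h2 (not_le.2 h5)

/-! ### Moving two boundary points to antipodes -/

lemma mobius_mobius_neg {a w : ℂ} (ha : ‖a‖ < 1) (hw : ‖w‖ < 1) :
    mobius (-a) (mobius a w) = w := by
  have h1 := mobius_den_ne ha hw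
  have h2 : 1 - (starRingEnd ℂ) a * a ≠ 0 := mobius_den_ne ha ha
  rw [mobius, mobius, map_neg]
  generalize (starRingEnd ℂ) a = b at h1 h2
  have h3 : 1 - -b * ((w - a) / (1 - b * w)) = (1 - b * a) / (1 - b * w) := by
    rw [eq_div_iff h1, sub_mul, mul_assoc, div_mul_cancel₀ _ h1]; ring
  have h4 : (w - a) / (1 - b * w) - -a = w * (1 - b * a) / (1 - b * w) := by
    rw [eq_div_iff h1, sub_mul, div_mul_cancel₀ _ h1]; ring
  rw [h3, h4, div_div_div_cancel_right₀ h1, mul_div_cancel_right₀ _ h2]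

/-- There is a Möbius transformation of the disc, up to a rotation, which moves two given distinct
points of the circle to `1` and `-1`. -/
lemma exists_mobius_antipodes {ζ₁ ζ₂ : ℂ} (h₁ : ‖ζ₁‖ = 1) (h₂ : ‖ζ₂‖ = 1) (hne : ζ₁ ≠ ζ₂) :
    ∃ c p : ℂ, ‖c‖ = 1 ∧ ‖p‖ < 1 ∧ 1 - (starRingEnd ℂ) p * (c * ζ₁) ≠ 0 ∧
      1 - (starRingEnd ℂ) p * (c * ζ₂) ≠ 0 ∧ mobius p (c * ζ₁) = 1 ∧ mobius p (c * ζ₂) = -1 := by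
  have z1 : ζ₁ ≠ 0 := by rintro rfl; simp at h₁
  have z2 : ζ₂ ≠ 0 := by rintro rfl; simp at h₂
  -- The rotation makes the points symmetric about the imaginary axis: `c ζ₁ = μ` and `c ζ₂ = -1 / μ
  -- = -μ̄`. If `Re μ` were `0`, the two points would coincide.
  obtain ⟨c, hc, hre⟩ : ∃ c : ℂ, c ^ 2 * (ζ₁ * ζ₂) = -1 ∧ 0 < (c * ζ₁).re := by
    obtain ⟨d, hd⟩ := IsAlgClosed.exists_pow_nat_eq (-(ζ₁ * ζ₂)⁻¹) (n := 2) two_pos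
    have hd' : d ^ 2 * (ζ₁ * ζ₂) = -1 := by rw [hd]; field_simp
    have hdn : ‖d‖ = 1 := by
      have := congrArg norm hd'
      simp only [norm_mul, norm_pow, h₁, h₂, norm_neg, norm_one, mul_one] at this
      exact (pow_eq_one_iff_of_nonneg (norm_nonneg d) two_ne_zero).1 this
    have hne0 : (d * ζ₁).re ≠ 0 := by
      intro h0
      have hsq : (d * ζ₁) ^ 2 = -1 := by
        have hn : Complex.normSq (d * ζ₁) = 1 := by
          rw [Complex.normSq_eq_norm_sq, norm_mul, hdn, h₁]; norm_num
        rw [Complex.normSq_apply, h0] at hn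
        apply Complex.ext
        · rw [sq, Complex.mul_re (d * ζ₁), h0]; simp only [Complex.neg_re, Complex.one_re]; linarith
        · rw [sq, Complex.mul_im (d * ζ₁), h0]; simp
      have hd0 : d ≠ 0 := by rintro rfl; simp at hdn
      refine hne (mul_left_cancel₀ (mul_ne_zero (pow_ne_zero 2 hd0) z1) ?_)
      linear_combination hsq - hd'
    rcases lt_or_gt_of_ne hne0 with h | h
    · exact ⟨-d, by rw [neg_sq, hd'], by rw [neg_mul, Complex.neg_re]; linarith⟩
    · exact ⟨d, hd', h⟩
  have hcn : ‖c‖ = 1 := by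
    have := congrArg norm hc
    simp only [norm_mul, norm_pow, h₁, h₂, norm_neg, norm_one, mul_one] at this
    exact (pow_eq_one_iff_of_nonneg (norm_nonneg c) two_ne_zero).1 this
  set μ := c * ζ₁ with hμ
  have hμn : ‖μ‖ = 1 := by rw [hμ, norm_mul, hcn, h₁, mul_one]
  have hμ2 : c * ζ₂ * μ = -1 := by rw [hμ]; linear_combination hc
  have hμ0 : μ ≠ 0 := by intro h; simp [h] at hμn
  have hconj : (starRingEnd ℂ) μ = μ⁻¹ := by rw [Complex.inv_def, Complex.normSq_eq_norm_sq, hμn]; simp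
  have hμ1 : μ + 1 ≠ 0 := by
    intro h
    have := congrArg Complex.re h
    simp only [Complex.add_re, Complex.one_re, Complex.zero_re] at this
    linarith
  have hμμ : μ ^ 2 + 1 ≠ 0 := by
    intro h
    have h1 : μ * (μ + μ⁻¹) = 0 := by field_simp; exact h
    have h2 := (mul_eq_zero.1 h1).resolve_left hμ0
    rw [← hconj, Complex.add_conj] at h2
    have h3 : 2 * μ.re = 0 := by exact_mod_cast h2
    linarith
  have hζ₂ : c * ζ₂ = -μ⁻¹ := by field_simp; linear_combination hμ2
  -- For imaginary `p`, so that `p̄ = -p`, the equation `mobius p μ = 1` reads `μ - p = 1 + p μ`;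
  -- this is its solution.
  set p := (μ - 1) / (μ + 1) with hp
  have hpc : (starRingEnd ℂ) p = -p := by
    rw [hp, map_div₀, map_sub, map_add, map_one, hconj]
    field_simp
    rw [div_eq_iff (by rwa [add_comm])]
    field_simp
    ring
  have hden : 1 + p * μ = (μ ^ 2 + 1) / (μ + 1) := by rw [hp]; field_simp; ring
  have hnum : μ - p = (μ ^ 2 + 1) / (μ + 1) := by rw [hp]; field_simp; ring
  have hq : (μ ^ 2 + 1) / (μ + 1) ≠ 0 := div_ne_zero hμμ hμ1
  have hd1 : 1 - (starRingEnd ℂ) p * μ ≠ 0 := by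
    rw [hpc, neg_mul, sub_neg_eq_add, hden]; exact hq
  have hd2e : 1 - (starRingEnd ℂ) p * (c * ζ₂) = (μ - p) / μ := by
    rw [hpc, hζ₂]; field_simp
  have hd2 : 1 - (starRingEnd ℂ) p * (c * ζ₂) ≠ 0 := by
    rw [hd2e, hnum]; exact div_ne_zero hq hμ0
  refine ⟨c, p, hcn, ?_, hd1, hd2, ?_, ?_⟩
  · rw [hp, norm_div, div_lt_one (norm_pos_iff.2 hμ1)]
    refine lt_of_pow_lt_pow_left₀ 2 (norm_nonneg _) ?_
    rw [← Complex.normSq_eq_norm_sq, ← Complex.normSq_eq_norm_sq, Complex.normSq_apply,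
      Complex.normSq_apply]
    simp only [Complex.sub_re, Complex.add_re, Complex.one_re, Complex.sub_im, Complex.add_im,
      Complex.one_im]
    nlinarith
  · rw [mobius, div_eq_one_iff_eq hd1, hpc, neg_mul, sub_neg_eq_add, hden, hnum]
  · rw [mobius, hd2e, hζ₂, div_eq_iff (by rw [hnum]; exact div_ne_zero hq hμ0)]
    have : -μ⁻¹ - p = -((1 + p * μ) / μ) := by field_simp; ring
    rw [this, hden, hnum]; ring

/-- A bounded nonvanishing univalent function on the disc cannot be arbitrarily small on connected
sets joining neighbourhoods of two distinct boundary points. -/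
theorem eq_of_small_near {F : ℂ → ℂ} (hF : DifferentiableOn ℂ F (Metric.ball 0 1))
    (hinj : InjOn F (Metric.ball 0 1)) (h0 : ∀ z ∈ Metric.ball (0 : ℂ) 1, F z ≠ 0) {B : ℝ}
    (hB : ∀ z ∈ Metric.ball (0 : ℂ) 1, ‖F z‖ ≤ B) {ζ₁ ζ₂ : ℂ} (h₁ : ‖ζ₁‖ = 1) (h₂ : ‖ζ₂‖ = 1)
    (hT : ∀ ε > 0, ∀ U ∈ 𝓝 ζ₁, ∀ V ∈ 𝓝 ζ₂, ∃ T ⊆ Metric.ball (0 : ℂ) 1,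
      IsPreconnected T ∧ (T ∩ U).Nonempty ∧ (T ∩ V).Nonempty ∧ ∀ z ∈ T, ‖F z‖ < ε) : ζ₁ = ζ₂ := by
  by_contra hne
  obtain ⟨c, p, hc, hp, hd1, hd2, hm1, hm2⟩ := exists_mobius_antipodes h₁ h₂ hne
  have hc0 : c ≠ 0 := by rintro rfl; simp at hc
  have hpn : ‖-p‖ < 1 := by rwa [norm_neg]
  set M : ℂ → ℂ := fun t => c⁻¹ * mobius (-p) t with hM
  set N : ℂ → ℂ := fun z => mobius p (c * z) with hN
  have hMb : MapsTo M (Metric.ball 0 1) (Metric.ball 0 1) := by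
    intro t ht
    rw [mem_ball_zero_iff] at ht ⊢
    rw [hM, norm_mul, norm_inv, hc, inv_one, one_mul]
    exact norm_mobius_lt hpn ht
  have hNb : ∀ z ∈ Metric.ball (0 : ℂ) 1, N z ∈ Metric.ball (0 : ℂ) 1 := by
    intro z hz
    rw [mem_ball_zero_iff] at hz ⊢
    exact norm_mobius_lt hp (by rwa [norm_mul, hc, one_mul])
  have hMN : ∀ z ∈ Metric.ball (0 : ℂ) 1, M (N z) = z := by
    intro z hz
    rw [mem_ball_zero_iff] at hz
    rw [hM, hN]
    simp only
    rw [mobius_mobius_neg hp (by rwa [norm_mul, hc, one_mul]), inv_mul_cancel_left₀ hc0]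
  have hNc : ∀ z, 1 - (starRingEnd ℂ) p * (c * z) ≠ 0 → ContinuousAt N z := by
    intro z hz
    simp only [hN, mobius]
    exact ContinuousAt.div (by fun_prop) (by fun_prop) hz
  have hMd : DifferentiableOn ℂ M (Metric.ball 0 1) := fun t ht =>
    ((hasDerivAt_mobius hpn (mem_ball_zero_iff.1 ht)).differentiableAt.const_mul
      _).differentiableWithinAt
  refine false_of_small_near_antipodes (F := F ∘ M) (hF.comp hMd hMb) ?_
    (fun z hz => h0 _ (hMb hz)) (fun z hz => hB _ (hMb hz)) ?_
  · intro z hz w hw h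
    have h1 := mul_left_cancel₀ (inv_ne_zero hc0) (hinj (hMb hz) (hMb hw) h)
    exact mobius_injOn hpn (mem_ball_zero_iff.1 hz) (mem_ball_zero_iff.1 hw) h1
  · intro ε hε U hU V hV
    have hU' : N ⁻¹' U ∈ 𝓝 ζ₁ := (hNc ζ₁ hd1).preimage_mem_nhds (by simpa only [hN, hm1] using hU)
    have hV' : N ⁻¹' V ∈ 𝓝 ζ₂ := (hNc ζ₂ hd2).preimage_mem_nhds (by simpa only [hN, hm2] using hV)
    obtain ⟨T, hTb, hTc, ⟨a, haT, ha⟩, ⟨b, hbT, hb⟩, hTs⟩ := hT ε hε _ hU' _ hV'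
    refine ⟨N '' T, ?_, hTc.image N fun z hz => ?_, ⟨N a, mem_image_of_mem N haT, ha⟩,
      ⟨N b, mem_image_of_mem N hbT, hb⟩, ?_⟩
    · rintro _ ⟨z, hz, rfl⟩
      exact hNb z (hTb hz)
    · refine (hNc z (mobius_den_ne hp ?_)).continuousWithinAt
      rw [norm_mul, hc, one_mul]
      exact mem_ball_zero_iff.1 (hTb hz)
    · rintro _ ⟨z, hz, rfl⟩
      rw [Function.comp_apply, hMN z (hTb hz)]
      exact hTs z hz

/-! ### The Riemann map at infinity -/

/-- A holomorphic bijection `φ` of the disc onto `D` with its holomorphic inverse `ψ`. -/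
structure IsRiemannPair (φ ψ : ℂ → ℂ) (D : Set ℂ) : Prop where
  dφ : DifferentiableOn ℂ φ (Metric.ball 0 1)
  dψ : DifferentiableOn ℂ ψ D
  mapsφ : ∀ t ∈ Metric.ball (0 : ℂ) 1, φ t ∈ D
  mapsψ : ∀ z ∈ D, ψ z ∈ Metric.ball (0 : ℂ) 1
  left : ∀ t ∈ Metric.ball (0 : ℂ) 1, ψ (φ t) = t
  right : ∀ z ∈ D, φ (ψ z) = z

lemma IsRiemannPair.bijOn {φ ψ : ℂ → ℂ} {D : Set ℂ} (h : IsRiemannPair φ ψ D) :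
    BijOn φ (Metric.ball 0 1) D :=
  ⟨h.mapsφ, fun s hs t ht hst => by rw [← h.left s hs, hst, h.left t ht],
    fun z hz => ⟨ψ z, h.mapsψ z hz, h.right z hz⟩⟩

/-- The Riemann map of a domain bounded by a simple curve through infinity may be normalised so that
infinity corresponds to `1`. -/
theorem exists_isRiemannPair_tendsto_one {D : Set ℂ} (hDo : IsOpen D) (hDc : IsConnected D)
    (hDb : ¬ Bornology.IsBounded D) (hDn : D ≠ univ)
    (hcurve : IsUnboundedSimpleCurve (frontier D)) :
    ∃ φ ψ : ℂ → ℂ, IsRiemannPair φ ψ D ∧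
      Tendsto ψ (Bornology.cobounded ℂ ⊓ 𝓟 D) (𝓝 1) := by
  have hs := hasSqrts_of_holeFree hDo hDc (holeFree_of_frontier hDo hcurve)
  obtain ⟨ψ, hψd, hψ⟩ := exists_riemann_map hDo hDc hDn hs
  obtain ⟨χ, hχd, hχi, hχ0, ⟨B, hB⟩, hχs⟩ := exists_bounded_univalent hDo hDc.nonempty hDn hs
  have hpair : IsRiemannPair (Function.invFunOn ψ D) ψ D :=
    { dφ := fun t ht => by
        obtain ⟨z, hz, rfl⟩ := hψ.surjOn ht
        exact (differentiableAt_invFunOn hDo hψd hψ.injOn hz).differentiableWithinAt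
      dψ := hψd
      mapsφ := fun t ht => Function.invFunOn_mem (hψ.surjOn ht)
      mapsψ := fun z hz => hψ.mapsTo hz
      left := fun t ht => Function.invFunOn_eq (hψ.surjOn ht)
      right := fun z hz => hψ.injOn.leftInvOn_invFunOn hz }
  set φ := Function.invFunOn ψ D with hφdef
  set l : Filter ℂ := Bornology.cobounded ℂ ⊓ 𝓟 D with hl
  have hlD : ∀ᶠ z in l, z ∈ D := mem_inf_of_right (mem_principal_self D)
  have hlN : ∀ N : ℝ, ∀ᶠ z in l, N < ‖z‖ := fun N =>
    (tendsto_norm_cobounded_atTop.eventually (eventually_gt_atTop N)).filter_mono inf_le_left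
  have hlne : l.NeBot := by
    rw [hl, inf_principal_neBot_iff]
    intro U hU
    by_contra hcon
    rw [not_nonempty_iff_eq_empty] at hcon
    refine hDb (Bornology.isBounded_def.2 (mem_of_superset hU fun z hz hzD => ?_))
    exact (Set.ext_iff.1 hcon z).1 ⟨hz, hzD⟩
  have hK : ∀ᶠ z in l, ψ z ∈ Metric.closedBall (0 : ℂ) 1 := by
    filter_upwards [hlD] with z hz
    exact Metric.ball_subset_closedBall (hpair.mapsψ z hz)
  -- Near an interior point `φ` is bounded, so points tending to infinity in `D` cannot have images
  -- accumulating there.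
  have hcirc : ∀ ζ ∈ Metric.closedBall (0 : ℂ) 1, MapClusterPt ζ l ψ → ‖ζ‖ = 1 := by
    intro ζ hζ hcl
    by_contra hne
    have hζ1 : ζ ∈ Metric.ball (0 : ℂ) 1 := by
      rw [mem_closedBall_zero_iff] at hζ
      rw [mem_ball_zero_iff]
      exact lt_of_le_of_ne hζ hne
    have hc : ContinuousAt φ ζ :=
      (hpair.dφ.differentiableAt (Metric.isOpen_ball.mem_nhds hζ1)).continuousAt
    have h1 : ∀ᶠ t in 𝓝 ζ, ‖φ t‖ < ‖φ ζ‖ + 1 := hc.norm.eventually (gt_mem_nhds (by linarith))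
    obtain ⟨z, hz1, hz2, hz3⟩ := ((hcl.frequently h1).and_eventually
      (hlD.and (hlN (‖φ ζ‖ + 1)))).exists
    rw [hpair.right z hz2] at hz1
    linarith
  have hF : DifferentiableOn ℂ (χ ∘ φ) (Metric.ball 0 1) := hχd.comp hpair.dφ hpair.mapsφ
  -- Points of `D` far out can be joined in `D` far out, where `χ` is small. The `ψ`-images of the
  -- joining sets connect neighbourhoods of `ζ₁` and `ζ₂` with `χ ∘ φ` small on them.
  have huniq : ∀ ζ₁, ‖ζ₁‖ = 1 → MapClusterPt ζ₁ l ψ → ∀ ζ₂, ‖ζ₂‖ = 1 → MapClusterPt ζ₂ l ψ →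
      ζ₁ = ζ₂ := by
    intro ζ₁ h₁ hc₁ ζ₂ h₂ hc₂
    refine eq_of_small_near hF (hχi.comp hpair.bijOn.injOn hpair.mapsφ)
      (fun t ht => hχ0 _ (hpair.mapsφ t ht)) (fun t ht => hB _ (hpair.mapsφ t ht)) h₁ h₂ ?_
    intro ε hε U hU V hV
    obtain ⟨N, hN⟩ := hχs ε hε
    obtain ⟨M, hM⟩ := exists_isPreconnected_subset_lt_norm hDo hDc hcurve N
    obtain ⟨p, hpU, hpD, hpM⟩ := ((hc₁.frequently hU).and_eventually (hlD.and (hlN M))).exists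
    obtain ⟨q, hqV, hqD, hqM⟩ := ((hc₂.frequently hV).and_eventually (hlD.and (hlN M))).exists
    obtain ⟨S, hS, hpS, hqS, hSD⟩ := hM p hpD hpM q hqD hqM
    refine ⟨ψ '' S, ?_, hS.image ψ (hpair.dψ.continuousOn.mono fun z hz => (hSD hz).1),
      ⟨ψ p, mem_image_of_mem ψ hpS, hpU⟩, ⟨ψ q, mem_image_of_mem ψ hqS, hqV⟩, ?_⟩
    · rintro _ ⟨z, hz, rfl⟩
      exact hpair.mapsψ z (hSD hz).1
    · rintro _ ⟨z, hz, rfl⟩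
      rw [Function.comp_apply, hpair.right z (hSD hz).1]
      exact hN z (hSD hz).1 (hSD hz).2
  obtain ⟨ζ, hζK, hζ⟩ := (isCompact_closedBall (0 : ℂ) 1).exists_mapClusterPt_of_frequently
    hK.frequently
  have hζ1 := hcirc ζ hζK hζ
  have hζ0 : ζ ≠ 0 := by rintro rfl; simp at hζ1
  have htend : Tendsto ψ l (𝓝 ζ) :=
    (isCompact_closedBall (0 : ℂ) 1).tendsto_nhds_of_unique_mapClusterPt hK
      fun ξ hξ hc => huniq ξ (hcirc ξ hξ hc) hc ζ hζ1 hζ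
  have hrot : ∀ t ∈ Metric.ball (0 : ℂ) 1, ζ * t ∈ Metric.ball (0 : ℂ) 1 := by
    intro t ht
    simpa [hζ1] using ht
  refine ⟨fun t => φ (ζ * t), fun z => ζ⁻¹ * ψ z, ⟨hpair.dφ.comp (by fun_prop) hrot,
    hψd.const_mul _, fun t ht => hpair.mapsφ _ (hrot t ht), fun z hz => ?_, fun t ht => ?_,
    fun z hz => ?_⟩, ?_⟩
  · simpa [hζ1] using hpair.mapsψ z hz
  · rw [hpair.left _ (hrot t ht), inv_mul_cancel_left₀ hζ0]
  · rw [mul_inv_cancel_left₀ hζ0, hpair.right z hz]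
  · simpa [hζ0] using htend.const_mul ζ⁻¹

/-! ### Oscillation of logarithms, boundary limits and the covering -/

/-- A continuous logarithm of a function whose values stay in a disc not surrounding the origin has
bounded oscillation. -/
theorem exists_norm_sub_le_of_exp_mem {X : Type*} [TopologicalSpace X] : ∃ K : ℝ, ∀ (a : ℂ),
    a ≠ 0 → ∀ (S : Set X) (g : X → ℂ), IsPreconnected S → ContinuousOn g S →
      (∀ x ∈ S, Complex.exp (g x) / a ∈ Metric.closedBall (1 : ℂ) (1 / 2)) →
      ∀ x ∈ S, ∀ y ∈ S, ‖g x - g y‖ ≤ K := by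
  have hsl : Metric.closedBall (1 : ℂ) (1 / 2) ⊆ Complex.slitPlane := by
    intro z hz
    left
    rw [mem_closedBall_iff_norm] at hz
    have := (abs_le.1 ((Complex.abs_re_le_norm (z - 1)).trans hz)).1
    simp only [Complex.sub_re, Complex.one_re] at this
    linarith
  have hlc : ContinuousOn Complex.log (Metric.closedBall (1 : ℂ) (1 / 2)) := fun z hz =>
    (continuousAt_clog (hsl hz)).continuousWithinAt
  obtain ⟨K, hK⟩ := (isCompact_closedBall (1 : ℂ) (1 / 2)).exists_bound_of_continuousOn hlc
  refine ⟨2 * K, fun a ha S g hS hg hmem x hx y hy => ?_⟩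
  have hL : ContinuousOn (fun x => Complex.log (Complex.exp (g x) / a) + Complex.log a) S :=
    (hlc.comp (hg.cexp.div_const a) hmem).add continuousOn_const
  have h := sub_eq_sub_of_exp_eq hS hg hL (fun z hz => by
    rw [Complex.exp_add, Complex.exp_log ha,
      Complex.exp_log (div_ne_zero (Complex.exp_ne_zero _) ha), div_mul_cancel₀ _ ha]) hx hy
  have h1 : g x - g y = Complex.log (Complex.exp (g x) / a) - Complex.log (Complex.exp (g y) / a) := by
    linear_combination h
  rw [h1]
  refine (norm_sub_le _ _).trans ?_
  linarith [hK _ (hmem x hx), hK _ (hmem y hy)]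

lemma eventually_div_mem_closedBall {X : Type*} {l : Filter X} {f : X → ℂ} {a : ℂ} (ha : a ≠ 0)
    (hf : Tendsto f l (𝓝 a)) : ∀ᶠ x in l, f x / a ∈ Metric.closedBall (1 : ℂ) (1 / 2) := by
  have h := hf.div_const a
  rw [div_self ha] at h
  exact h.eventually (Metric.closedBall_mem_nhds _ (by norm_num))

/-- A logarithm of `f` is bounded near each boundary point of a domain bounded by a simple curve. -/
theorem exists_log_bound_near_frontier {D : Set ℂ} (hDo : IsOpen D) (hDc : IsConnected D)
    (hcurve : IsUnboundedSimpleCurve (frontier D)) {f g : ℂ → ℂ} (hf : ContinuousOn f (closure D))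
    (hg : ContinuousOn g D) (hgf : ∀ z ∈ D, Complex.exp (g z) = f z) {w : ℂ} (hw : w ∈ frontier D)
    (h0 : f w ≠ 0) : ∃ C : ℝ, ∀ᶠ z in 𝓝[D] w, ‖g z‖ ≤ C := by
  obtain ⟨K, hK⟩ := exists_norm_sub_le_of_exp_mem (X := ℂ)
  have hwc : w ∈ closure D := frontier_subset_closure hw
  have hev : ∀ᶠ z in 𝓝[D] w, f z / f w ∈ Metric.closedBall (1 : ℂ) (1 / 2) :=
    eventually_div_mem_closedBall h0 ((hf w hwc).mono subset_closure)
  obtain ⟨ε, hε, hball⟩ := Metric.mem_nhdsWithin_iff.1 hev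
  -- Any point of `D` near `w` is joined to one fixed `p` inside the region where `f` is close to `f
  -- w`. Hence `g` there differs from `g p` by at most `K`, however many turns other routes might
  -- make.
  obtain ⟨δ, hδ, hS⟩ := exists_isPreconnected_subset_ball hDo hDc hcurve hw hε
  obtain ⟨p, hpD, hpw⟩ := Metric.mem_closure_iff.1 hwc δ hδ
  have hp : p ∈ D ∩ Metric.ball w δ := ⟨hpD, by rwa [Metric.mem_ball, dist_comm]⟩
  refine ⟨‖g p‖ + K, ?_⟩
  filter_upwards [self_mem_nhdsWithin, mem_nhdsWithin_of_mem_nhds (Metric.ball_mem_nhds w hδ)]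
    with q hqD hqδ
  obtain ⟨S, hSc, hpS, hqS, hSD⟩ := hS p hp q ⟨hqD, hqδ⟩
  have h1 := hK (f w) h0 S g hSc (hg.mono fun z hz => (hSD hz).1) (fun z hz => by
    rw [hgf z (hSD hz).1]
    exact hball ⟨(hSD hz).2, (hSD hz).1⟩) q hqS p hpS
  calc ‖g q‖ = ‖g p + (g q - g p)‖ := by rw [add_sub_cancel]
    _ ≤ ‖g p‖ + K := (norm_add_le _ _).trans (by linarith)

/-- Along an ultrafilter tending to a boundary point of the disc, a Riemann map with bounded values
tends to a boundary point of the domain. -/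
theorem IsRiemannPair.exists_tendsto_frontier {φ ψ : ℂ → ℂ} {D : Set ℂ} (h : IsRiemannPair φ ψ D)
    (hDo : IsOpen D) {ζ : ℂ} (hζ : ‖ζ‖ = 1) {u : Ultrafilter ℂ}
    (hu : (u : Filter ℂ) ≤ 𝓝[Metric.ball 0 1] ζ) {M : ℝ} (hM : ∀ᶠ t in u, ‖φ t‖ ≤ M) :
    ∃ w ∈ frontier D, Tendsto φ u (𝓝[D] w) := by
  have hb : ∀ᶠ t in (u : Filter ℂ), t ∈ Metric.ball (0 : ℂ) 1 := hu self_mem_nhdsWithin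
  have hD : ∀ᶠ t in (u : Filter ℂ), φ t ∈ D := hb.mono h.mapsφ
  have hle : (↑(u.map φ) : Filter ℂ) ≤ 𝓟 (Metric.closedBall 0 M) := by
    rw [le_principal_iff, Ultrafilter.coe_map, mem_map]
    filter_upwards [hM] with t ht
    simpa using ht
  obtain ⟨w, -, hw⟩ := (isCompact_closedBall (0 : ℂ) M).ultrafilter_le_nhds _ hle
  have hw' : Tendsto φ u (𝓝 w) := hw
  have hwc : w ∈ closure D := mem_closure_of_tendsto hw' hD
  refine ⟨w, ?_, tendsto_nhdsWithin_iff.2 ⟨hw', hD⟩⟩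
  rw [hDo.frontier_eq]
  -- Were `w` in `D`, then `t = ψ (φ t)` would tend to the interior point `ψ w` as well as to `ζ` on
  -- the circle.
  refine ⟨hwc, fun hwD => ?_⟩
  have h1 : Tendsto (fun t => ψ (φ t)) u (𝓝 (ψ w)) :=
    (h.dψ.differentiableAt (hDo.mem_nhds hwD)).continuousAt.tendsto.comp hw'
  have h2 : Tendsto (fun t => ψ (φ t)) u (𝓝 ζ) := by
    refine Tendsto.congr' ?_ ((tendsto_id (α := ℂ)).mono_left (hu.trans nhdsWithin_le_nhds))
    filter_upwards [hb] with t ht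
    exact (h.left t ht).symm
  have h3 := tendsto_nhds_unique h1 h2
  have h4 := h.mapsψ w hwD
  rw [h3, mem_ball_zero_iff, hζ] at h4
  exact lt_irrefl _ h4

lemma one_sub_ne_zero_of_mem_ball {t : ℂ} (ht : t ∈ Metric.ball (0 : ℂ) 1) : 1 - t ≠ 0 := by
  intro h
  rw [sub_eq_zero] at h
  subst h
  simp at ht

lemma tendsto_norm_cayley {c : ℝ} (hc : 0 < c) (b : ℂ) :
    Tendsto (fun t : ℂ => ‖(c : ℂ) * ((1 + t) / (1 - t)) + b‖) (𝓝[Metric.ball 0 1] 1) atTop := by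
  have h1 : Tendsto (fun t : ℂ => (1 - t)⁻¹) (𝓝[Metric.ball 0 1] 1) (Bornology.cobounded ℂ) := by
    refine tendsto_inv₀_nhdsNE_zero.comp (tendsto_nhdsWithin_iff.2 ⟨?_, ?_⟩)
    · have : Continuous fun t : ℂ => 1 - t := by fun_prop
      simpa using (this.tendsto 1).mono_left (nhdsWithin_le_nhds (s := Metric.ball (0 : ℂ) 1))
    · filter_upwards [self_mem_nhdsWithin] with t ht
      exact one_sub_ne_zero_of_mem_ball ht
  have h2 : Tendsto (fun t : ℂ => 2 * c * ‖(1 - t)⁻¹‖ - ‖b - c‖) (𝓝[Metric.ball 0 1] 1) atTop :=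
    tendsto_atTop_add_const_right _ _
      ((tendsto_norm_cobounded_atTop.comp h1).const_mul_atTop (by positivity))
  refine tendsto_atTop_mono' _ ?_ h2
  filter_upwards [self_mem_nhdsWithin] with t ht
  have hne := one_sub_ne_zero_of_mem_ball ht
  -- The pole at `1` is isolated by `(1 + t) / (1 - t) = 2 / (1 - t) - 1`.
  have he : (c : ℂ) * ((1 + t) / (1 - t)) + b = 2 * c * (1 - t)⁻¹ + (b - c) := by
    field_simp; ring
  have hn : ‖(2 * c * (1 - t)⁻¹ : ℂ)‖ = 2 * c * ‖(1 - t)⁻¹‖ := by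
    simp [abs_of_pos hc]
  rw [he, ← hn]
  have := norm_sub_le (2 * c * (1 - t)⁻¹ + (b - c)) (b - c : ℂ)
  rw [add_sub_cancel_right] at this
  linarith

/-- If a holomorphic logarithm of `f` maps `D` homeomorphically onto the half-plane
`{Re > log R}`, then `f : D → {|w| > R}` is a universal covering. -/
theorem isUniversalCovering_of_log {f g : ℂ → ℂ} {D : Set ℂ} {R : ℝ} (hR : 0 < R)
    (hmaps : MapsTo f D (exteriorDisc R)) (hgf : ∀ z ∈ D, Complex.exp (g z) = f z)
    (hg : ContinuousOn g D) {k : ℂ → ℂ} (hk : ContinuousOn k {w | Real.log R < w.re})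
    (hkm : MapsTo k {w | Real.log R < w.re} D) (hkg : ∀ z ∈ D, k (g z) = z)
    (hgk : ∀ w ∈ {w : ℂ | Real.log R < w.re}, g (k w) = w) :
    IsUniversalCovering (MapsTo.restrict f D (exteriorDisc R) hmaps) := by
  have hpre : Complex.exp ⁻¹' exteriorDisc R = {w | Real.log R < w.re} := by
    ext w
    rw [mem_preimage, exteriorDisc, mem_ofPred_eq, mem_ofPred_eq, Complex.norm_exp,
      Real.log_lt_iff_lt_exp hR]
  have hgm : MapsTo g D (Complex.exp ⁻¹' exteriorDisc R) := by
    intro z hz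
    rw [mem_preimage, hgf z hz]
    exact hmaps hz
  rw [← hpre] at hk hkm hgk
  let e : D ≃ₜ (Complex.exp ⁻¹' exteriorDisc R : Set ℂ) :=
    { toFun := MapsTo.restrict g D _ hgm
      invFun := MapsTo.restrict k _ D hkm
      left_inv := fun z => Subtype.ext (hkg z z.2)
      right_inv := fun w => Subtype.ext (hgk w w.2)
      continuous_toFun := hg.mapsToRestrict hgm
      continuous_invFun := hk.mapsToRestrict hkm }
  -- The covering is inherited from `exp` on the half-plane, which is convex and so simply
  -- connected.
  have hcomp : MapsTo.restrict f D (exteriorDisc R) hmaps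
      = (exteriorDisc R).restrictPreimage Complex.exp ∘ e := by
    funext z
    exact Subtype.ext (hgf z z.2).symm
  have hcov : IsCoveringMap ((exteriorDisc R).restrictPreimage Complex.exp) := by
    refine (Complex.isCoveringMapOn_exp.mono ?_).isCoveringMap_restrictPreimage
    intro w hw h0
    rw [mem_singleton_iff.1 h0, exteriorDisc, mem_ofPred_eq, norm_zero] at hw
    linarith
  refine ⟨?_, ?_, ?_⟩
  · rw [hcomp]
    exact hcov.comp_homeomorph e
  · rw [hcomp]
    refine Function.Surjective.comp ?_ e.surjective
    rintro ⟨w, hw⟩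
    have hw0 : w ≠ 0 := by
      rintro rfl
      rw [exteriorDisc, mem_ofPred_eq, norm_zero] at hw
      linarith
    refine ⟨⟨Complex.log w, ?_⟩, Subtype.ext (Complex.exp_log hw0)⟩
    rwa [mem_preimage, Complex.exp_log hw0]
  · have hconv : Convex ℝ (Complex.exp ⁻¹' exteriorDisc R) := by
      rw [hpre]
      exact convex_halfSpace_re_gt _
    have hne : (Complex.exp ⁻¹' exteriorDisc R).Nonempty := by
      rw [hpre]
      exact ⟨((Real.log R + 1 : ℝ) : ℂ), by
        rw [mem_ofPred_eq, Complex.ofReal_re]; linarith⟩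
    have := isSimplyConnected_of_convex hconv hne
    have : SimplyConnectedSpace (Complex.exp ⁻¹' exteriorDisc R : Set ℂ) := this
    exact e.toHomotopyEquiv.simplyConnectedSpace

lemma norm_cayley_inv_lt_one {q : ℂ} (hq : 0 < q.re) : ‖(q - 1) / (q + 1)‖ < 1 := by
  have hq1 : q + 1 ≠ 0 := by
    intro h
    have := congrArg Complex.re h
    simp only [Complex.add_re, Complex.one_re, Complex.zero_re] at this
    linarith
  rw [norm_div, div_lt_one (norm_pos_iff.2 hq1)]
  refine lt_of_pow_lt_pow_left₀ 2 (norm_nonneg _) ?_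
  rw [← Complex.normSq_eq_norm_sq, ← Complex.normSq_eq_norm_sq, Complex.normSq_apply,
    Complex.normSq_apply]
  simp only [Complex.sub_re, Complex.add_re, Complex.one_re, Complex.sub_im, Complex.add_im,
    Complex.one_im]
  nlinarith

lemma cayley_cayley_inv {q : ℂ} (hq : q + 1 ≠ 0) :
    (1 + (q - 1) / (q + 1)) / (1 - (q - 1) / (q + 1)) = q := by
  have h1 : 1 + (q - 1) / (q + 1) = 2 * q / (q + 1) := by field_simp; ring
  have h2 : 1 - (q - 1) / (q + 1) = 2 / (q + 1) := by field_simp; ring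
  rw [h1, h2, div_div_div_cancel_right₀ hq]
  ring

lemma cayley_inv_cayley {t : ℂ} (ht : 1 - t ≠ 0) :
    ((1 + t) / (1 - t) - 1) / ((1 + t) / (1 - t) + 1) = t := by
  have h1 : (1 + t) / (1 - t) - 1 = 2 * t / (1 - t) := by field_simp; ring
  have h2 : (1 + t) / (1 - t) + 1 = 2 / (1 - t) := by field_simp; ring
  rw [h1, h2, div_div_div_cancel_right₀ ht]
  ring

end DirectTract

/-! ### The main theorem -/

open DirectTract in
theorem theorem1 (f : ℂ → ℂ) (D : Set ℂ) (R : ℝ)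
    (hD : DirectTract.IsDirectTract f D R)
    (hcurve : DirectTract.IsUnboundedSimpleCurve (frontier D)) :
    DirectTract.IsLogarithmicTract f D R ∧
    (∃ (φ : ℂ → ℂ) (c θ : ℝ), DirectTract.IsRiemannMap φ D ∧
      Tendsto (fun t => ‖φ t‖) (𝓝[Metric.ball 0 1] 1) atTop ∧ 0 < c ∧
      ∀ z ∈ D, f z = (R : ℂ) * Complex.exp (Complex.I * (θ : ℂ)) *
        Complex.exp ((c : ℂ) *
          ((1 + Function.invFunOn φ (Metric.ball 0 1) z) /
            (1 - Function.invFunOn φ (Metric.ball 0 1) z)))) ∧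
    (∀ z ∈ D, deriv f z ≠ 0) ∧
    (∀ a : ℂ, ¬ ∃ Γ : ℝ → ℂ, DirectTract.IsAsymptoticPathIn f D a Γ) := by
  have hDn : D ≠ univ := by
    rintro rfl
    exact hD.unbounded_compl (by simp)
  have hR := hD.pos
  have hf0 : ∀ z ∈ D, f z ≠ 0 := fun z hz => norm_pos_iff.1 (hR.trans (hD.lt_norm z hz))
  obtain ⟨φ, ψ, hpair, hψ1⟩ :=
    exists_isRiemannPair_tendsto_one hD.isOpen hD.isConnected hD.unbounded hDn hcurve
  obtain ⟨g, hg, hgf⟩ := exists_holomorphic_log hD.isOpen hD.isConnected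
    (holeFree_of_frontier hD.isOpen hcurve) hD.holomorphic hf0
  have hre : ∀ z ∈ D, (g z).re = Real.log ‖f z‖ := by
    intro z hz
    rw [← hgf z hz, Complex.norm_exp, Real.log_exp]
  have hexpR : Complex.exp (Real.log R : ℝ) = R := by
    rw [← Complex.ofReal_exp, Real.exp_log hR]
  set G : ℂ → ℂ := fun t => g (φ t) - (Real.log R : ℝ) with hG
  have hGd : DifferentiableOn ℂ G (Metric.ball 0 1) :=
    (hg.comp hpair.dφ hpair.mapsφ).sub_const _
  have hGre : ∀ t ∈ Metric.ball (0 : ℂ) 1, (G t).re = Real.log ‖f (φ t)‖ - Real.log R := by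
    intro t ht
    rw [hG, Complex.sub_re, hre _ (hpair.mapsφ t ht), Complex.ofReal_re]
  have hGpos : ∀ t ∈ Metric.ball (0 : ℂ) 1, 0 < (G t).re := by
    intro t ht
    rw [hGre t ht, sub_pos]
    exact Real.log_lt_log hR (hD.lt_norm _ (hpair.mapsφ t ht))
  -- Since `ψ → 1` at infinity, `φ` is bounded near `ζ ≠ 1`. Along any ultrafilter tending to `ζ` it
  -- therefore converges to a finite frontier point, where `|f| = R`; no continuous extension of `φ`
  -- is needed.
  have hGbd : ∀ ζ ∈ Metric.sphere (0 : ℂ) 1, ζ ≠ 1 →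
      Tendsto (fun t => (G t).re) (𝓝[Metric.ball 0 1] ζ) (𝓝 0) := by
    intro ζ hζ hne
    rw [mem_sphere_zero_iff_norm] at hζ
    obtain ⟨V, hV, U, hU, hVU⟩ : ∃ V ∈ 𝓝 ζ, ∃ U ∈ 𝓝 (1 : ℂ), Disjoint V U := by
      obtain ⟨V, U, hV, hU, hVU⟩ := t2_separation_nhds hne
      exact ⟨V, hV, U, hU, hVU⟩
    obtain ⟨M, -, hM⟩ := hasBasis_cobounded_norm.mem_iff.1 (mem_inf_principal.1 (hψ1 hU))
    rw [tendsto_iff_ultrafilter]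
    intro u hu
    have hub : ∀ᶠ t in (u : Filter ℂ), t ∈ Metric.ball (0 : ℂ) 1 := hu self_mem_nhdsWithin
    have hle : ∀ᶠ t in (u : Filter ℂ), ‖φ t‖ ≤ M := by
      filter_upwards [hub, hu (mem_nhdsWithin_of_mem_nhds hV)] with t ht htV
      by_contra! hlt
      have h1 : ψ (φ t) ∈ U := hM hlt.le (hpair.mapsφ t ht)
      rw [hpair.left t ht] at h1
      exact hVU.le_bot ⟨htV, h1⟩
    obtain ⟨w, hw, hφw⟩ := hpair.exists_tendsto_frontier hD.isOpen hζ hu hle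
    have hfw : Tendsto (fun t => f (φ t)) u (𝓝 (f w)) :=
      ((hD.continuousOn w (frontier_subset_closure hw)).mono subset_closure).tendsto.comp hφw
    have hlog : Tendsto (fun t => Real.log ‖f (φ t)‖ - Real.log R) u (𝓝 0) := by
      have h1 := hfw.norm
      rw [hD.norm_eq w hw] at h1
      simpa using (h1.log hR.ne').sub_const (Real.log R)
    exact hlog.congr' (hub.mono fun t ht => (hGre t ht).symm)
  obtain ⟨c, θ, hc, hGe⟩ := eq_mul_add_of_re_pos hGd hGpos hGbd
  have hc0 : (c : ℂ) ≠ 0 := Complex.ofReal_ne_zero.2 hc.ne'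
  set b : ℂ := Complex.I * θ + (Real.log R : ℝ) with hb
  have hbre : b.re = Real.log R := by simp [hb]
  have hge : ∀ t ∈ Metric.ball (0 : ℂ) 1, g (φ t) = c * ((1 + t) / (1 - t)) + b := by
    intro t ht
    linear_combination hGe t ht
  have hge' : ∀ z ∈ D, g z = c * ((1 + ψ z) / (1 - ψ z)) + b := by
    intro z hz
    have := hge (ψ z) (hpair.mapsψ z hz)
    rwa [hpair.right z hz] at this
  have hne : ∀ z ∈ D, 1 - ψ z ≠ 0 := fun z hz => one_sub_ne_zero_of_mem_ball (hpair.mapsψ z hz)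
  have hginj : InjOn g D := by
    intro z hz z' hz' h
    rw [hge' z hz, hge' z' hz'] at h
    have h1 := mul_left_cancel₀ hc0 (add_right_cancel h)
    have h2 : ψ z = ψ z' := by
      rw [← cayley_inv_cayley (hne z hz), h1, cayley_inv_cayley (hne z' hz')]
    rw [← hpair.right z hz, h2, hpair.right z' hz']
  refine ⟨⟨hD, ?_⟩, ⟨φ, c, θ, ⟨hpair.dφ, hpair.bijOn⟩, ?_, hc, ?_⟩, ?_, ?_⟩
  -- The inverse of `g` is explicit: rescale to the right half-plane by `(w - b) / c`, apply the
  -- inverse Cayley transform, then `φ`.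
  · have hq : ∀ w ∈ {w : ℂ | Real.log R < w.re}, 0 < ((w - b) / c).re := by
      intro w hw
      rw [Complex.div_ofReal_re, Complex.sub_re, hbre]
      exact div_pos (sub_pos.2 hw) hc
    have hq1 : ∀ w ∈ {w : ℂ | Real.log R < w.re}, (w - b) / c + 1 ≠ 0 := by
      intro w hw h
      have h1 := congrArg Complex.re h
      rw [Complex.add_re, Complex.one_re, Complex.zero_re] at h1
      linarith [hq w hw]
    have hm : MapsTo (fun w : ℂ => ((w - b) / c - 1) / ((w - b) / c + 1))
        {w | Real.log R < w.re} (Metric.ball 0 1) := fun w hw =>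
      mem_ball_zero_iff.2 (norm_cayley_inv_lt_one (hq w hw))
    refine isUniversalCovering_of_log hR hD.mapsTo hgf hg.continuousOn
      (k := fun w => φ (((w - b) / c - 1) / ((w - b) / c + 1))) ?_ ?_ ?_ ?_
    · exact hpair.dφ.continuousOn.comp (ContinuousOn.div (by fun_prop) (by fun_prop) hq1) hm
    · exact fun w hw => hpair.mapsφ _ (hm hw)
    · intro z hz
      have h1 : (g z - b) / c = (1 + ψ z) / (1 - ψ z) := by
        rw [hge' z hz, add_sub_cancel_right, mul_div_cancel_left₀ _ hc0]
      simp only [h1]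
      rw [cayley_inv_cayley (hne z hz), hpair.right z hz]
    · intro w hw
      rw [hge _ (hm hw), cayley_cayley_inv (hq1 w hw), mul_div_cancel₀ _ hc0, sub_add_cancel]
  -- If `φ` did not tend to infinity at `1`, some ultrafilter at `1` would carry `φ` to a finite
  -- frontier point `w`. There `g` is bounded, but `g ∘ φ` is the Cayley expression, which blows up
  -- at `1`.
  · rw [tendsto_atTop]
    intro M
    by_contra hcon
    rw [not_eventually] at hcon
    have hneBot : (𝓝[Metric.ball 0 1] (1 : ℂ) ⊓ 𝓟 {t | ¬ M ≤ ‖φ t‖}).NeBot :=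
      frequently_mem_iff_neBot.1 hcon
    set u := Ultrafilter.of (𝓝[Metric.ball 0 1] (1 : ℂ) ⊓ 𝓟 {t | ¬ M ≤ ‖φ t‖})
    have hule := Ultrafilter.of_le (𝓝[Metric.ball 0 1] (1 : ℂ) ⊓ 𝓟 {t | ¬ M ≤ ‖φ t‖})
    have hu1 : (u : Filter ℂ) ≤ 𝓝[Metric.ball 0 1] 1 := hule.trans inf_le_left
    have hu2 : ∀ᶠ t in (u : Filter ℂ), ‖φ t‖ ≤ M := by
      have : ∀ᶠ t in (u : Filter ℂ), ¬ M ≤ ‖φ t‖ := hule (mem_inf_of_right (mem_principal_self _))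
      exact this.mono fun t ht => (not_le.1 ht).le
    obtain ⟨w, hw, hφw⟩ := hpair.exists_tendsto_frontier hD.isOpen (by simp) hu1 hu2
    have hfw : f w ≠ 0 := norm_pos_iff.1 (by rw [hD.norm_eq w hw]; exact hR)
    obtain ⟨C, hC⟩ := exists_log_bound_near_frontier hD.isOpen hD.isConnected hcurve
      hD.continuousOn hg.continuousOn hgf hw hfw
    have hub : ∀ᶠ t in (u : Filter ℂ), t ∈ Metric.ball (0 : ℂ) 1 := hu1 self_mem_nhdsWithin
    obtain ⟨t, ht1, ht2, ht3⟩ := ((hφw.eventually hC).and (hub.and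
      (((tendsto_norm_cayley hc b).mono_left hu1).eventually (eventually_gt_atTop C)))).exists
    rw [hge t ht2] at ht1
    linarith
  · intro z hz
    have hinv : Function.invFunOn φ (Metric.ball 0 1) z = ψ z := by
      have := hpair.bijOn.injOn.leftInvOn_invFunOn (hpair.mapsψ z hz)
      rwa [hpair.right z hz] at this
    rw [hinv, ← hgf z hz, hge' z hz, hb, Complex.exp_add, Complex.exp_add, hexpR]
    ring
  · intro z hz
    have h1 : HasDerivAt f (Complex.exp (g z) * deriv g z) z := by
      refine ((hg.differentiableAt (hD.isOpen.mem_nhds hz)).hasDerivAt.cexp).congr_of_eventuallyEq ?_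
      filter_upwards [hD.isOpen.mem_nhds hz] with x hx
      exact (hgf x hx).symm
    rw [h1.deriv]
    exact mul_ne_zero (Complex.exp_ne_zero _) (deriv_ne_zero_of_injOn hD.isOpen hg hginj hz)
  · rintro a ⟨Γ, hΓ⟩
    have hΓD : ∀ᶠ t : ℝ in atTop, Γ t ∈ D :=
      (eventually_ge_atTop 0).mono fun t ht => hΓ.mapsTo ht
    -- The limit inherits `|a| ≥ R > 0`. A tail of the path is then mapped by `f` into a disc about
    -- `a` that avoids `0`, so `g` has bounded oscillation along it, although `ψ ∘ Γ → 1` makes `g`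
    -- unbounded.
    have ha : a ≠ 0 := by
      have h1 : R ≤ ‖a‖ :=
        ge_of_tendsto hΓ.tendsto_value.norm (hΓD.mono fun t ht => (hD.lt_norm _ ht).le)
      exact norm_pos_iff.1 (hR.trans_le h1)
    have hψΓ : Tendsto (fun t => ψ (Γ t)) atTop (𝓝[Metric.ball 0 1] 1) := by
      refine tendsto_nhdsWithin_iff.2 ⟨hψ1.comp ?_, hΓD.mono fun t ht => hpair.mapsψ _ ht⟩
      exact tendsto_inf.2 ⟨tendsto_norm_atTop_iff_cobounded.1 hΓ.tendsto_infty,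
        tendsto_principal.2 hΓD⟩
    have hgΓ : Tendsto (fun t => ‖g (Γ t)‖) atTop atTop :=
      ((tendsto_norm_cayley hc b).comp hψΓ).congr' (hΓD.mono fun t ht => by
        simp only [Function.comp_apply, hge' _ ht])
    obtain ⟨T, hT⟩ := eventually_atTop.1 ((eventually_div_mem_closedBall ha
      hΓ.tendsto_value).and (eventually_ge_atTop 0))
    have hsub : Ici T ⊆ Ici 0 := fun t ht => (hT t ht).2
    obtain ⟨K, hK⟩ := exists_norm_sub_le_of_exp_mem (X := ℝ)
    have hbound := hK a ha (Ici T) (fun t => g (Γ t)) isPreconnected_Ici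
      (hg.continuousOn.comp (hΓ.continuousOn.mono hsub) fun t ht => hΓ.mapsTo (hsub ht))
      (fun t ht => by
        rw [hgf _ (hΓ.mapsTo (hsub ht))]
        exact (hT t ht).1)
    obtain ⟨t, ht1, ht2⟩ := ((hgΓ.eventually (eventually_gt_atTop (‖g (Γ T)‖ + K))).and
      (eventually_ge_atTop T)).exists
    have h1 := hbound t ht2 T self_mem_Ici
    have h2 := norm_sub_norm_le (g (Γ t)) (g (Γ T))
    linarith
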